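/- **Setting.** Let $\mathfrak g$ be a real Lie algebra of dimension $n\ge 3$ with a Lorentzian metric $g$ (signature $(n-1,1)$), let $\mathfrak n\subset\mathfrak g$ be a codimension-one Abelian ideal on which $g$ is non-degenerate, let $X\perp\mathfrak n$ with $g(X,X)\in\{-1,1\}$, and put $f:=\mathrm{ad}_X|_{\mathfrak n}\in\mathrm{End}(\mathfrak n)$, with adjoint $f^*$ with respect to $g|_{\mathfrak n}$ and symmetric part $f^S=\tfrac12(f+f^*)$. We take the three-form $H=0$ and the divergence operator $\delta=0$. On $E=\mathfrak g\oplus\mathfrak g^*$ let $\langle Y+\xi,Z+\eta\rangle=\tfrac12(\eta(Y)+\xi(Z))$, let $[Y+\xi,Z+\eta]=[Y,Z]-\eta\circ\mathrm{ad}_Y+\xi\circ\mathrm{ad}_Z$ be the Dorfman bracket (for $H=0$), let $\mathcal G_g(Y+\xi)=g^{-1}\xi+gY$, and let $E_\pm$ be the $\pm1$-eigenspaces of $\mathcal G_g$. A generalised Levi-Civita connection is a bilinear map $(a,b)\mapsto D_ab$ on $E$ that preserves $\langle\cdot,\cdot\rangle$ and $\mathcal G_g$ and is torsion-free, i.e.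 $D_ab-D_ba-[a,b]+(Da)^*b=0$, where $\langle (Da)^*b,c\rangle=\langle b,D_ca\rangle$. The triple $(H,\mathcal G_g,\delta)$ is *generalised Einstein* if, for a generalised Levi-Civita connection $D$ with $\mathrm{tr}(a\mapsto D_ae)=\delta(e)$ for all $e\in E$, one has $$\mathrm{tr}\bigl(E_\pm\ni a\mapsto D_aD_bc-D_bD_ac-D_{[a,b]}c\in E_\pm\bigr)=0\quad\text{for all } b\in E_\mp,\ c\in E_\pm .$$ Write $L_1(\alpha,\beta)=\begin{pmatrix}\alpha&-\beta\\ \beta&\alpha\end{pmatrix}$, $$M_3(\sigma)=\begin{pmatrix}0&0&-1+\sigma\\0&0&-1-\sigma\\-1+\sigma&1+\sigma&0\end{pmatrix},\qquad M_4(\sigma,\tau)=\begin{pmatrix}0&0&-1+\sigma&\tau\\0&0&-1-\sigma&-\tau\\-1+\sigma&1+\sigma&0&0\\ \tau&\tau&0&0\end{pmatrix}.$$ **Theorem.** In this setting, $(\mathfrak g,H=0,\mathcal G_g,\delta=0)$ is generalised Einstein if and only if $f$ is normal (i.e. $ff^*=f^*f$) and $\mathrm{tr}((f^S)^2)=0$.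 Moreover: (a) $(\mathfrak g,0,\mathcal G_g,0)$ is generalised Einstein with $\mathfrak n$ positive definite if and only if there are an orthonormal basis $(e_1,\dots,e_{n-1})$ of $\mathfrak n$ with $g(e_i,e_i)=1$ for all $i$, some $k\in\{0,\dots,\lfloor\frac{n-1}2\rfloor\}$ and $a_1\ge\dots\ge a_k>0$ such that, with respect to this basis, $f=\mathrm{diag}(L_1(0,a_1),\dots,L_1(0,a_k),0,\dots,0)$. In this case $g$ is flat. (b) $(\mathfrak g,0,\mathcal G_g,0)$ is generalised Einstein with $\mathfrak n$ Lorentzian if and only if there is an orthonormal basis $(e_1,\dots,e_{n-1})$ of $\mathfrak n$ with $g(e_1,e_1)=-1$ and $g(e_i,e_i)=1$ for $i\geq 2$ with respect to which $f$ equals one of the following matrices: - (i) $n=3$ and $f=\begin{pmatrix}0&\rho\\ \rho&0\end{pmatrix}$ for some $\rho\in\mathbb R$; - (ii) $n$ is even and either $f=0$ or $f=\mathrm{diag}(M_3(\sigma),L_1(0,a_1),\dots,L_1(0,a_k),0,\dots,0)$ for some $\sigma\in\mathbb R$, $k\in\{0,\dots,\frac{n-4}2\}$, $a_1\ge\dots\ge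 a_k>0$; - (iii) $n\ge5$ is odd and either $f=0$ or $f=\mathrm{diag}(M_4(\sigma,\tau),L_1(0,a_1),\dots,L_1(0,a_k),0,\dots,0)$ for some $\sigma\in\mathbb R$, $\tau\ge0$, $k\in\{0,\dots,\frac{n-5}2\}$, $a_1\ge\dots\ge a_k>0$; - (iv) $f=\mathrm{diag}(L_1(\alpha,\beta),L_1(a_1,b_1),\dots,L_1(a_k,b_k),c_1,\dots,c_s)$ for some $k,s\ge0$ with $2k+s=n-3$, $\alpha,a_1,\dots,a_k\in\mathbb R$, $b_1\ge\dots\ge b_k>0$, $c_1\ge\dots\ge c_s$, where $\beta=\sqrt{\alpha^2+\sum_{i=1}^ka_i^2+\sum_{j=1}^s\frac{c_j^2}2}>0$; - (v) $f=\begin{pmatrix}\frac\epsilon2&\frac\epsilon2&v^t\\-\frac\epsilon2&-\frac\epsilon2&-v^t\\v&v&\mathrm{diag}(L_1(0,a_1),\dots,L_1(0,a_k),0,\dots,0)\end{pmatrix}$ for some $\epsilon\in\{-1,1\}$, $v\in\mathbb R^{n-3}$, $k\in\{0,\dots,\lfloor\frac{n-3}2\rfloor\}$, $a_1\ge\dots\ge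 a_k>0$; - (vi) $n\ge4$ and $f=\begin{pmatrix}0&-\frac1{\sqrt2}&0&v^t\\ \frac1{\sqrt2}&0&\frac1{\sqrt2}&0\\0&\frac1{\sqrt2}&0&-v^t\\v&0&v&\mathrm{diag}(L_1(0,a_1),\dots,L_1(0,a_k),0,\dots,0)\end{pmatrix}$ for some $v\in\mathbb R^{n-4}$, $k\in\{0,\dots,\lfloor\frac{n-4}2\rfloor\}$, $a_1\ge\dots\ge a_k>0$. In the situation of (b), $g$ is flat (its Levi-Civita connection has zero curvature) if and only if $f$ is, with respect to some such basis, as in (i), (ii), (iii) or (v); in the cases (iv) and (vi) $g$ is never flat. -/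

import Mathlib

/-! ### Pseudo-Riemannian metrics on real vector spaces -/

/-- A pseudo-Riemannian metric on a real vector space: a symmetric non-degenerate bilinear form. -/
structure PseudoRiemMetric (V : Type*) [AddCommGroup V] [Module ℝ V] where
  form : LinearMap.BilinForm ℝ V
  symm : ∀ x y, form x y = form y x
  nondeg : form.Nondegenerate

/-- `e` is an orthonormal basis for `B` with `B (e i) (e i) = sgn i`. -/
def IsOrthonormalBasis {V ι : Type*} [AddCommGroup V] [Module ℝ V] [DecidableEq ι]
    (B : LinearMap.BilinForm ℝ V) (sgn : ι → ℝ) (e : Module.Basis ι ℝ V) : Prop :=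
  ∀ i j, B (e i) (e j) = if i = j then sgn i else 0

/-- Signature `(m, 1)`: there is an orthonormal basis with exactly one negative vector. -/
def IsLorentzianForm {V : Type*} [AddCommGroup V] [Module ℝ V]
    (B : LinearMap.BilinForm ℝ V) : Prop :=
  ∃ (m : ℕ) (e : Module.Basis (Fin 1 ⊕ Fin m) ℝ V),
    IsOrthonormalBasis B (Sum.elim (fun _ => -1) (fun _ => 1)) e

def IsPositiveDefiniteForm {V : Type*} [AddCommGroup V] [Module ℝ V]
    (B : LinearMap.BilinForm ℝ V) : Prop :=
  ∀ x, x ≠ 0 → 0 < B x x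

/-- `fs` is the adjoint of `f` with respect to `B`. -/
noncomputable def adjointOf {V : Type*} [AddCommGroup V] [Module ℝ V] [FiniteDimensional ℝ V]
    (B : LinearMap.BilinForm ℝ V) (hB : B.Nondegenerate) (f : V →ₗ[ℝ] V) : V →ₗ[ℝ] V :=
  B.leftAdjointOfNondegenerate hB f

/-- The symmetric part `(f + f^*) / 2` of `f`. -/
noncomputable def symmetricPart {V : Type*} [AddCommGroup V] [Module ℝ V] [FiniteDimensional ℝ V]
    (B : LinearMap.BilinForm ℝ V) (hB : B.Nondegenerate) (f : V →ₗ[ℝ] V) : V →ₗ[ℝ] V :=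
  (1 / 2 : ℝ) • (f + adjointOf B hB f)

/-- `f` commutes with its adjoint. -/
def IsNormalFor {V : Type*} [AddCommGroup V] [Module ℝ V] [FiniteDimensional ℝ V]
    (B : LinearMap.BilinForm ℝ V) (hB : B.Nondegenerate) (f : V →ₗ[ℝ] V) : Prop :=
  f ∘ₗ adjointOf B hB f = adjointOf B hB f ∘ₗ f

/-! ### Levi-Civita connection and flatness of a metric on a Lie algebra -/

section Lie

variable {𝔤 : Type*} [LieRing 𝔤] [LieAlgebra ℝ 𝔤]

/-- `nabla X Y` is the (left-invariant) Levi-Civita connection of `g`: torsion-free and metric. -/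
structure IsLeviCivita (g : PseudoRiemMetric 𝔤) (nabla : 𝔤 →ₗ[ℝ] 𝔤 →ₗ[ℝ] 𝔤) : Prop where
  torsion_free : ∀ X Y, nabla X Y - nabla Y X = ⁅X, Y⁆
  metric : ∀ X Y Z, g.form (nabla X Y) Z + g.form Y (nabla X Z) = 0

/-- The Levi-Civita connection of `g` has vanishing curvature. -/
def PseudoRiemMetric.IsFlat (g : PseudoRiemMetric 𝔤) : Prop :=
  ∃ nabla : 𝔤 →ₗ[ℝ] 𝔤 →ₗ[ℝ] 𝔤, IsLeviCivita g nabla ∧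
    ∀ X Y Z, nabla X (nabla Y Z) - nabla Y (nabla X Z) - nabla ⁅X, Y⁆ Z = 0

/-! ### Generalised geometry on `E = 𝔤 ⊕ 𝔤^*` -/

variable (𝔤) in
/-- The space `E = 𝔤 ⊕ 𝔤^*` of left-invariant sections of the generalised tangent bundle. -/
abbrev GenTangent : Type _ := 𝔤 × Module.Dual ℝ 𝔤

/-- `⟨X + ξ, Y + η⟩ = (η(X) + ξ(Y)) / 2`. -/
noncomputable def genPairing (a b : GenTangent 𝔤) : ℝ := (1 / 2 : ℝ) * (b.2 a.1 + a.2 b.1)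

/-- The linear form `H(X, Y, ·)`. -/
noncomputable def contract (H : 𝔤 [⋀^Fin 3]→ₗ[ℝ] ℝ) (X Y : 𝔤) : Module.Dual ℝ 𝔤 :=
  (AlternatingMap.ofSubsingleton ℝ 𝔤 ℝ (0 : Fin 1)).symm ((H.curryLeft X).curryLeft Y)

lemma contract_apply (H : 𝔤 [⋀^Fin 3]→ₗ[ℝ] ℝ) (X Y Z : 𝔤) :
    contract H X Y Z = H ![X, Y, Z] := by
  simp only [contract, AlternatingMap.ofSubsingleton_symm_apply_apply,
    AlternatingMap.curryLeft_apply_apply]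
  congr 1
  ext i
  fin_cases i <;> rfl

/-- The `H`-twisted Dorfman bracket on left-invariant sections,
`[X + ξ, Y + η]_H = [X, Y] + X ⌟ dη - Y ⌟ dξ + H(X, Y, ·)`, where `dη(X, Y) = -η([X, Y])`. -/
noncomputable def dorfman (H : 𝔤 [⋀^Fin 3]→ₗ[ℝ] ℝ) :
    GenTangent 𝔤 →ₗ[ℝ] GenTangent 𝔤 →ₗ[ℝ] GenTangent 𝔤 :=
  LinearMap.mk₂ ℝ
    (fun a b => (⁅a.1, b.1⁆,
      -(b.2 ∘ₗ (LieAlgebra.ad ℝ 𝔤 a.1 : 𝔤 →ₗ[ℝ] 𝔤))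
        + a.2 ∘ₗ (LieAlgebra.ad ℝ 𝔤 b.1 : 𝔤 →ₗ[ℝ] 𝔤) + contract H a.1 b.1))
    (by
      intro a a' b
      refine Prod.ext (by simp) (LinearMap.ext fun z => ?_)
      simp [contract]
      ring)
    (by
      intro c a b
      refine Prod.ext (by simp) (LinearMap.ext fun z => ?_)
      simp [contract])
    (by
      intro a b b'
      refine Prod.ext (by simp) (LinearMap.ext fun z => ?_)
      simp [contract]
      ring)
    (by
      intro c a b
      refine Prod.ext (by simp) (LinearMap.ext fun z => ?_)
      simp [contract])

variable [FiniteDimensional ℝ 𝔤]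

/-- The generalised metric `𝒢_g (X + ξ) = g⁻¹ ξ + g X`. -/
noncomputable def genMetric (g : PseudoRiemMetric 𝔤) : GenTangent 𝔤 →ₗ[ℝ] GenTangent 𝔤 :=
  ((g.form.toDual g.nondeg).symm.toLinearMap ∘ₗ LinearMap.snd ℝ 𝔤 (Module.Dual ℝ 𝔤)).prod
    ((g.form.toDual g.nondeg).toLinearMap ∘ₗ LinearMap.fst ℝ 𝔤 (Module.Dual ℝ 𝔤))

lemma genMetric_genMetric (g : PseudoRiemMetric 𝔤) (a : GenTangent 𝔤) :
    genMetric g (genMetric g a) = a := by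
  refine Prod.ext ?_ ?_ <;> simp [genMetric]

/-- The eigenspace `E_+` of the generalised metric. -/
noncomputable def Eplus (g : PseudoRiemMetric 𝔤) : Submodule ℝ (GenTangent 𝔤) :=
  Module.End.eigenspace (genMetric g) 1

/-- The eigenspace `E_-` of the generalised metric. -/
noncomputable def Eminus (g : PseudoRiemMetric 𝔤) : Submodule ℝ (GenTangent 𝔤) :=
  Module.End.eigenspace (genMetric g) (-1)

/-- The projection onto `E_+` along `E_-`. -/
noncomputable def projPlus (g : PseudoRiemMetric 𝔤) : GenTangent 𝔤 →ₗ[ℝ] Eplus g :=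
  LinearMap.codRestrict (Eplus g) ((1 / 2 : ℝ) • (LinearMap.id + genMetric g)) (by
    intro a
    rw [Eplus, Module.End.mem_eigenspace_iff]
    simp [genMetric_genMetric, add_comm])

/-- The projection onto `E_-` along `E_+`. -/
noncomputable def projMinus (g : PseudoRiemMetric 𝔤) : GenTangent 𝔤 →ₗ[ℝ] Eminus g :=
  LinearMap.codRestrict (Eminus g) ((1 / 2 : ℝ) • (LinearMap.id - genMetric g)) (by
    intro a
    rw [Eminus, Module.End.mem_eigenspace_iff]
    simp [genMetric_genMetric, smul_sub]
    abel)

/-- `D a b = D_a b` is a (left-invariant) generalised Levi-Civita connection of `𝒢_g` on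
`(E, [·,·]_H)`.  The torsion is
`T_D(a, b) = D_a b - D_b a - [a, b]_H + (Da)^* b`, where `⟨(Da)^* b, c⟩ = ⟨b, D_c a⟩`; its
vanishing is expressed by pairing with an arbitrary `c`. -/
structure IsGenLeviCivita (g : PseudoRiemMetric 𝔤) (H : 𝔤 [⋀^Fin 3]→ₗ[ℝ] ℝ)
    (D : GenTangent 𝔤 →ₗ[ℝ] GenTangent 𝔤 →ₗ[ℝ] GenTangent 𝔤) : Prop where
  pairing : ∀ a b c, genPairing (D a b) c + genPairing b (D a c) = 0
  torsion_free : ∀ a b c,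
    genPairing (D a b - D b a - dorfman H a b) c + genPairing b (D c a) = 0
  metric : ∀ a b, D a (genMetric g b) = genMetric g (D a b)

/-- The divergence `δ_D(e) = tr (De)` of a generalised connection, where `De = (a ↦ D_a e)`. -/
noncomputable def genDivergence
    (D : GenTangent 𝔤 →ₗ[ℝ] GenTangent 𝔤 →ₗ[ℝ] GenTangent 𝔤) (e : GenTangent 𝔤) : ℝ :=
  LinearMap.trace ℝ (GenTangent 𝔤) (D.flip e)

/-- The linear map `a ↦ D_a D_b c - D_b D_a c - D_{[a,b]_H} c`. -/
noncomputable def genCurvature (H : 𝔤 [⋀^Fin 3]→ₗ[ℝ] ℝ)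
    (D : GenTangent 𝔤 →ₗ[ℝ] GenTangent 𝔤 →ₗ[ℝ] GenTangent 𝔤) (b c : GenTangent 𝔤) :
    GenTangent 𝔤 →ₗ[ℝ] GenTangent 𝔤 :=
  D.flip (D b c) - D b ∘ₗ D.flip c - D.flip c ∘ₗ (dorfman H).flip b

/-- `RC⁺_D(b, c) = tr (E_+ ∋ a ↦ R_D(a, b) c ∈ E_+)` for `b ∈ E_-`, `c ∈ E_+`.
(The values are in `E_+` since `D` preserves `E_+`, so `projPlus` only records the codomain.) -/
noncomputable def genRicciPlus (g : PseudoRiemMetric 𝔤) (H : 𝔤 [⋀^Fin 3]→ₗ[ℝ] ℝ)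
    (D : GenTangent 𝔤 →ₗ[ℝ] GenTangent 𝔤 →ₗ[ℝ] GenTangent 𝔤)
    (b : Eminus g) (c : Eplus g) : ℝ :=
  LinearMap.trace ℝ (Eplus g) (projPlus g ∘ₗ genCurvature H D b c ∘ₗ (Eplus g).subtype)

/-- `RC⁻_D(b, c) = tr (E_- ∋ a ↦ R_D(a, b) c ∈ E_-)` for `b ∈ E_+`, `c ∈ E_-`. -/
noncomputable def genRicciMinus (g : PseudoRiemMetric 𝔤) (H : 𝔤 [⋀^Fin 3]→ₗ[ℝ] ℝ)
    (D : GenTangent 𝔤 →ₗ[ℝ] GenTangent 𝔤 →ₗ[ℝ] GenTangent 𝔤)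
    (b : Eplus g) (c : Eminus g) : ℝ :=
  LinearMap.trace ℝ (Eminus g) (projMinus g ∘ₗ genCurvature H D b c ∘ₗ (Eminus g).subtype)

/-- `(𝔤, H, 𝒢_g, δ)` is generalised Einstein: the generalised Ricci curvature
`RC = RC⁺ - RC⁻ ∈ (E_- ⊗ E_+) ⊕ (E_+ ⊗ E_-)` of a generalised Levi-Civita connection with
divergence operator `δ` vanishes. -/
def IsGeneralisedEinstein (g : PseudoRiemMetric 𝔤) (H : 𝔤 [⋀^Fin 3]→ₗ[ℝ] ℝ)
    (δ : Module.Dual ℝ (GenTangent 𝔤)) : Prop :=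
  ∃ D : GenTangent 𝔤 →ₗ[ℝ] GenTangent 𝔤 →ₗ[ℝ] GenTangent 𝔤,
    IsGenLeviCivita g H D ∧ (∀ e, genDivergence D e = δ e) ∧
    (∀ (b : Eminus g) (c : Eplus g), genRicciPlus g H D b c = 0) ∧
    (∀ (b : Eplus g) (c : Eminus g), genRicciMinus g H D b c = 0)

end Lie

/-! ### Normal forms -/

/-- `f` has matrix `M` with respect to some orthonormal basis with signs `sgn`. -/
def HasMatrix {V ι : Type*} [AddCommGroup V] [Module ℝ V] [Fintype ι] [DecidableEq ι]
    (B : LinearMap.BilinForm ℝ V) (f : V →ₗ[ℝ] V) (sgn : ι → ℝ) (M : Matrix ι ι ℝ) : Prop :=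
  ∃ e : Module.Basis ι ℝ V, IsOrthonormalBasis B sgn e ∧ LinearMap.toMatrix e e f = M

def matL1 (α β : ℝ) : Matrix (Fin 2) (Fin 2) ℝ := !![α, -β; β, α]

def matM3 (σ : ℝ) : Matrix (Fin 3) (Fin 3) ℝ :=
  !![0, 0, -1 + σ; 0, 0, -1 - σ; -1 + σ, 1 + σ, 0]

def matM4 (σ τ : ℝ) : Matrix (Fin 4) (Fin 4) ℝ :=
  !![0, 0, -1 + σ, τ; 0, 0, -1 - σ, -τ; -1 + σ, 1 + σ, 0, 0; τ, τ, 0, 0]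

/-- `diag (A, B)`. -/
def diag2 {ι κ : Type*} (A : Matrix ι ι ℝ) (B : Matrix κ κ ℝ) : Matrix (ι ⊕ κ) (ι ⊕ κ) ℝ :=
  Matrix.fromBlocks A 0 0 B

/-- `diag (L₁(a₁, b₁), …, L₁(a_k, b_k), c₁, …, c_s)`. -/
def diagL1 {k s : ℕ} (a b : Fin k → ℝ) (c : Fin s → ℝ) :
    Matrix ((Fin 2 × Fin k) ⊕ Fin s) ((Fin 2 × Fin k) ⊕ Fin s) ℝ :=
  diag2 (Matrix.blockDiagonal fun i => matL1 (a i) (b i)) (Matrix.diagonal c)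

/-- `diag (L₁(0, a₁), …, L₁(0, a_k), 0, …, 0)` with `s` zeros. -/
def diagRot {k : ℕ} (s : ℕ) (a : Fin k → ℝ) :
    Matrix ((Fin 2 × Fin k) ⊕ Fin s) ((Fin 2 × Fin k) ⊕ Fin s) ℝ :=
  diagL1 0 a 0

/-- `a₁ ≥ … ≥ a_k > 0`. -/
def IsPosDecreasing {k : ℕ} (a : Fin k → ℝ) : Prop := Antitone a ∧ ∀ i, 0 < a i

/-- The signs `(-1, 1, …, 1)` on an index set whose first block is `Fin (p + 1)`. -/
def lorentzSigns (p : ℕ) (κ : Type*) : Fin (p + 1) ⊕ κ → ℝ :=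
  Sum.elim (fun i => if i = 0 then -1 else 1) (fun _ => 1)

section Forms

variable {V : Type*} [AddCommGroup V] [Module ℝ V]

/-- Riemannian case: `f = diag (L₁(0, a₁), …, L₁(0, a_k), 0, …, 0)`. -/
def FormRiem (B : LinearMap.BilinForm ℝ V) (f : V →ₗ[ℝ] V) : Prop :=
  ∃ (k s : ℕ) (a : Fin k → ℝ), IsPosDecreasing a ∧
    HasMatrix B f (fun _ => 1) (diagRot s a)

/-- In this and the following (Lorentzian) forms, `V` has dimension `n - 1`. -/
def FormI (n : ℕ) (B : LinearMap.BilinForm ℝ V) (f : V →ₗ[ℝ] V) : Prop :=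
  n = 3 ∧ ∃ ρ : ℝ,
    HasMatrix B f (fun i : Fin 2 => if i = 0 then -1 else 1) !![0, ρ; ρ, 0]

def FormII (n : ℕ) (B : LinearMap.BilinForm ℝ V) (f : V →ₗ[ℝ] V) : Prop :=
  Even n ∧ ((IsLorentzianForm B ∧ f = 0) ∨
    ∃ (σ : ℝ) (k s : ℕ) (a : Fin k → ℝ), IsPosDecreasing a ∧
      HasMatrix B f (lorentzSigns 2 _) (diag2 (matM3 σ) (diagRot s a)))

def FormIII (n : ℕ) (B : LinearMap.BilinForm ℝ V) (f : V →ₗ[ℝ] V) : Prop :=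
  5 ≤ n ∧ Odd n ∧ ((IsLorentzianForm B ∧ f = 0) ∨
    ∃ (σ τ : ℝ) (k s : ℕ) (a : Fin k → ℝ), 0 ≤ τ ∧ IsPosDecreasing a ∧
      HasMatrix B f (lorentzSigns 3 _) (diag2 (matM4 σ τ) (diagRot s a)))

def FormIV (B : LinearMap.BilinForm ℝ V) (f : V →ₗ[ℝ] V) : Prop :=
  ∃ (α β : ℝ) (k s : ℕ) (a b : Fin k → ℝ) (c : Fin s → ℝ),
    IsPosDecreasing b ∧ Antitone c ∧
    β = Real.sqrt (α ^ 2 + (∑ i, a i ^ 2) + ∑ j, c j ^ 2 / 2) ∧ 0 < β ∧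
    HasMatrix B f (lorentzSigns 1 _) (diag2 (matL1 α β) (diagL1 a b c))

def FormV (B : LinearMap.BilinForm ℝ V) (f : V →ₗ[ℝ] V) : Prop :=
  ∃ (ε : ℝ) (k s : ℕ) (v : (Fin 2 × Fin k) ⊕ Fin s → ℝ) (a : Fin k → ℝ),
    (ε = 1 ∨ ε = -1) ∧ IsPosDecreasing a ∧
    HasMatrix B f (lorentzSigns 1 _)
      (Matrix.fromBlocks !![ε / 2, ε / 2; -(ε / 2), -(ε / 2)] (Matrix.of ![v, -v])
        (Matrix.of ![v, v]).transpose (diagRot s a))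

def FormVI (B : LinearMap.BilinForm ℝ V) (f : V →ₗ[ℝ] V) : Prop :=
  ∃ (k s : ℕ) (v : (Fin 2 × Fin k) ⊕ Fin s → ℝ) (a : Fin k → ℝ),
    IsPosDecreasing a ∧
    HasMatrix B f (lorentzSigns 2 _)
      (Matrix.fromBlocks
        !![0, -(1 / Real.sqrt 2), 0; 1 / Real.sqrt 2, 0, 1 / Real.sqrt 2; 0, 1 / Real.sqrt 2, 0]
        (Matrix.of ![v, 0, -v]) (Matrix.of ![v, 0, v]).transpose (diagRot s a))

end Forms

/-! ### Generalised connections in terms of the Levi-Civita connection -/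

section GenEinstein

variable {𝔤 : Type*} [LieRing 𝔤] [LieAlgebra ℝ 𝔤]

/-! Write f = S + A with S self-adjoint and A skew, and identify E_± with 𝔤 by u ↦ u^± = u ± gu. For
H = 0 the axioms of a generalised Levi-Civita connection determine its mixed part: D_{u^∓} v^± =
(∇_u v)^±, with ∇ the Levi-Civita connection of g (`IsGenLeviCivita.mixed`). The pure part is not
determined, but it enters the Ricci trace only through a commutator with ∇_v, which is trace-free,
and through a divergence, which is zero. What is left is −tr(u ↦ ∇_{∇_u v} w)
(`IsGenLeviCivita.trace_genCurvature`). Since a divergence-free D exists, the Einstein condition is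
a condition on ∇ alone (`isGeneralisedEinstein_zero_iff`). Here ∇ is explicit in S and A, and the
trace is ε B([S, A]v', w') + v₀ w₀ tr S², where v = v₀X + v'. So the condition is [S, A] = 0, i.e.
normality of f, together with tr S² = 0 (`IsAlmostAbelian.isGeneralisedEinstein_iff`).

On a positive definite space S and A are block diagonalised together (`exists_isNormalFrame`), tr S²
is a sum of squares, and S = 0.

On a Lorentzian space S has a causal eigenvector or an invariant plane with non-real eigenvalues.
Such a plane is killed by A and has a positive definite complement; this is (iv). A timelike
eigenvector again makes tr S² a sum of squares, so S = 0. For a null eigenvector l the trace forces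
S l = 0 and S(l^⊥) ⊂ ℝl, so S is zero, of rank one, or has a chain x ↦ u ↦ l ↦ 0. Commutation with S
makes A vanish on l, and on u for a chain, which gives (v) and (vi). If S = 0, then f is skew, and a
skew operator on Minkowski space fixes a timelike vector infinitesimally, boosts a plane, or is a
null rotation (`skewAdjoint_trichotomy`). The families M₃ and M₄ contain all three types, and the
parity of n decides which of the two block sizes is used.

For flatness, R(X, Y)X = 0 reads S² + SA = AS, hence S² = 0 in the Einstein case. This fails in (iv)
and (vi). Conversely S² = 0 with S of rank at most one and [S, A] = 0 makes the curvature vanish. -/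

lemma PseudoRiemMetric.ext_left (g : PseudoRiemMetric 𝔤) {x y : 𝔤}
    (h : ∀ z, g.form x z = g.form y z) : x = y := by
  have h1 := g.nondeg.1 (x - y) (fun z => by simp [h z])
  exact sub_eq_zero.mp h1

/-- Torsion-freeness turns the brackets into derivatives, and metricity cancels all of them but two
equal ones. Used for uniqueness and to compute the Dorfman bracket. -/
lemma IsLeviCivita.koszul {g : PseudoRiemMetric 𝔤} {nabla : 𝔤 →ₗ[ℝ] 𝔤 →ₗ[ℝ] 𝔤}
    (h : IsLeviCivita g nabla) (x y z : 𝔤) :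
    2 * g.form (nabla x y) z
      = g.form ⁅x, y⁆ z - g.form ⁅y, z⁆ x + g.form ⁅z, x⁆ y := by
  rw [← h.torsion_free x y, ← h.torsion_free y z, ← h.torsion_free z x]
  simp only [map_sub, LinearMap.sub_apply]
  have h1 := h.metric x y z
  have h2 := h.metric y x z
  have h3 := h.metric z x y
  rw [g.symm y] at h1
  rw [g.symm x] at h2
  rw [g.symm x] at h3
  linarith

lemma IsLeviCivita.unique {g : PseudoRiemMetric 𝔤} {nabla nabla' : 𝔤 →ₗ[ℝ] 𝔤 →ₗ[ℝ] 𝔤}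
    (h : IsLeviCivita g nabla) (h' : IsLeviCivita g nabla') : nabla = nabla' := by
  ext x y
  refine g.ext_left fun z => ?_
  have h1 := h.koszul x y z
  have h2 := h'.koszul x y z
  linarith

variable [FiniteDimensional ℝ 𝔤]

/-- The map `u ↦ u + s g u`, which is an isomorphism onto `E_±` for `s = ±1`. -/
noncomputable def genLift (g : PseudoRiemMetric 𝔤) (s : ℝ) : 𝔤 →ₗ[ℝ] GenTangent 𝔤 :=
  LinearMap.id.prod (s • (g.form.toDual g.nondeg).toLinearMap)

/-- The `𝔤`-valued component `(u + s g⁻¹ ξ) / 2` of `u + ξ`. -/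
noncomputable def genPart (g : PseudoRiemMetric 𝔤) (s : ℝ) : GenTangent 𝔤 →ₗ[ℝ] 𝔤 :=
  (1 / 2 : ℝ) • (LinearMap.fst ℝ 𝔤 (Module.Dual ℝ 𝔤) +
    s • ((g.form.toDual g.nondeg).symm.toLinearMap ∘ₗ LinearMap.snd ℝ 𝔤 (Module.Dual ℝ 𝔤)))

variable (g : PseudoRiemMetric 𝔤)

@[simp] lemma genLift_fst (s : ℝ) (u : 𝔤) : (genLift g s u).1 = u := rfl

@[simp] lemma genLift_snd_apply (s : ℝ) (u v : 𝔤) : (genLift g s u).2 v = s * g.form u v := by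
  simp [genLift, LinearMap.BilinForm.toDual_def]

lemma genLift_snd (s : ℝ) (u : 𝔤) : (genLift g s u).2 = s • g.form.toDual g.nondeg u := rfl

lemma genPart_apply (s : ℝ) (a : GenTangent 𝔤) :
    genPart g s a = (1 / 2 : ℝ) • (a.1 + s • (g.form.toDual g.nondeg).symm a.2) := rfl

lemma genMetric_apply (a : GenTangent 𝔤) :
    genMetric g a = ((g.form.toDual g.nondeg).symm a.2, g.form.toDual g.nondeg a.1) := rfl

lemma genMetric_genLift {s : ℝ} (hs : s * s = 1) (u : 𝔤) :
    genMetric g (genLift g s u) = s • genLift g s u := by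
  refine Prod.ext ?_ ?_
  · simp [genMetric_apply, genLift_snd]
  · simp [genMetric_apply, genLift_snd, smul_smul, hs]

lemma genLift_fst_of_genMetric {s : ℝ} (hs : s * s = 1) {a : GenTangent 𝔤}
    (h : genMetric g a = s • a) : genLift g s a.1 = a := by
  refine Prod.ext rfl ?_
  have h2 := congrArg Prod.snd h
  simp only [genMetric_apply, Prod.smul_snd] at h2
  simp [genLift_snd, h2, smul_smul, hs]

lemma genPairing_genLift_same (s : ℝ) (u v : 𝔤) :
    genPairing (genLift g s u) (genLift g s v) = s * g.form u v := by
  simp only [genPairing, genLift_snd_apply, genLift_fst, g.symm v u]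
  ring

lemma genPairing_genLift_neg (s : ℝ) (u v : 𝔤) :
    genPairing (genLift g s u) (genLift g (-s) v) = 0 := by
  simp only [genPairing, genLift_snd_apply, genLift_fst, g.symm v u]
  ring

@[simp] lemma genPart_genLift {s : ℝ} (hs : s * s = 1) (u : 𝔤) :
    genPart g s (genLift g s u) = u := by
  simp only [genPart_apply, genLift_snd, genLift_fst, map_smul, LinearEquiv.symm_apply_apply,
    smul_smul, hs]
  module

@[simp] lemma genPart_neg_genLift {s : ℝ} (hs : s * s = 1) (u : 𝔤) :
    genPart g (-s) (genLift g s u) = 0 := by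
  simp only [genPart_apply, genLift_snd, genLift_fst, map_smul, LinearEquiv.symm_apply_apply,
    smul_smul, neg_mul, hs]
  module

lemma genLift_genPart_add (a : GenTangent 𝔤) :
    genLift g 1 (genPart g 1 a) + genLift g (-1) (genPart g (-1) a) = a := by
  refine Prod.ext ?_ ?_
  · simp only [Prod.fst_add, genLift_fst, genPart_apply]
    module
  · simp only [Prod.snd_add, genLift_snd, genPart_apply]
    simp
    module

/-- The vector part is torsion-freeness of ∇. The covector part s(g(v, [u, z]) + g(u, [v, z])) comes
from adding the Koszul formulas for ∇_u v and ∇_v u. -/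
lemma dorfman_zero_genLift {g : PseudoRiemMetric 𝔤} {nabla : 𝔤 →ₗ[ℝ] 𝔤 →ₗ[ℝ] 𝔤}
    (h : IsLeviCivita g nabla) (s : ℝ) (u v : 𝔤) :
    dorfman 0 (genLift g s u) (genLift g (-s) v)
      = genLift g (-s) (nabla u v) - genLift g s (nabla v u) := by
  refine Prod.ext ?_ (LinearMap.ext fun z => ?_)
  · simp [dorfman, h.torsion_free]
  · have h1 := h.koszul u v z
    have h2 := h.koszul v u z
    have h3 : ⁅v, u⁆ = -⁅u, v⁆ := (lie_skew v u).symm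
    have h4 : ⁅z, u⁆ = -⁅u, z⁆ := (lie_skew z u).symm
    have h5 : ⁅z, v⁆ = -⁅v, z⁆ := (lie_skew z v).symm
    rw [h3, h5] at h2
    rw [h4] at h1
    simp only [map_neg, LinearMap.neg_apply] at h1 h2
    have h6 := g.symm v ⁅u, z⁆
    have h7 := g.symm u ⁅v, z⁆
    simp [dorfman, contract]
    linear_combination (s / 2) * h1 + (s / 2) * h2 + s * h6 + s * h7

/-- The isomorphism `u ↦ u + s g u` onto an eigenspace of the generalised metric. -/
noncomputable def genLiftEquiv {s : ℝ} (hs : s * s = 1) :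
    𝔤 ≃ₗ[ℝ] (Module.End.eigenspace (genMetric g) s) where
  toFun u := ⟨genLift g s u, Module.End.mem_eigenspace_iff.mpr (genMetric_genLift g hs u)⟩
  map_add' x y := Subtype.ext (by simp)
  map_smul' c x := Subtype.ext (by simp)
  invFun a := a.1.1
  left_inv u := rfl
  right_inv a := Subtype.ext
    (genLift_fst_of_genMetric g hs (Module.End.mem_eigenspace_iff.mp a.2))

section Connection

variable {g}
variable {D : GenTangent 𝔤 →ₗ[ℝ] GenTangent 𝔤 →ₗ[ℝ] GenTangent 𝔤}

lemma IsGenLeviCivita.genLift_fst {H : 𝔤 [⋀^Fin 3]→ₗ[ℝ] ℝ} (hD : IsGenLeviCivita g H D) {s : ℝ}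
    (hs : s * s = 1) (a : GenTangent 𝔤) (v : 𝔤) :
    genLift g s (D a (genLift g s v)).1 = D a (genLift g s v) :=
  genLift_fst_of_genMetric g hs (by rw [← hD.metric, genMetric_genLift g hs, map_smul])

/-- Pair the torsion of u^{-s} and v^s with z^s. The derivatives of u^{-s} stay in its eigenspace,
which is orthogonal to the other one, so only D_{u^{-s}} v^s and the bracket survive. -/
lemma IsGenLeviCivita.mixed {nabla : 𝔤 →ₗ[ℝ] 𝔤 →ₗ[ℝ] 𝔤} (hn : IsLeviCivita g nabla)
    (hD : IsGenLeviCivita g 0 D) {s : ℝ} (hs : s * s = 1) (u v : 𝔤) :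
    D (genLift g (-s) u) (genLift g s v) = genLift g s (nabla u v) := by
  have hs' : -s * -s = 1 := by linarith
  have hs0 : s ≠ 0 := by rintro rfl; simp at hs
  rw [← hD.genLift_fst hs]
  congr 1
  refine g.ext_left fun z => ?_
  have h := hD.torsion_free (genLift g (-s) u) (genLift g s v) (genLift g s z)
  have hb := dorfman_zero_genLift hn (-s) u v
  rw [neg_neg] at hb
  rw [hb, ← hD.genLift_fst hs (genLift g (-s) u) v, ← hD.genLift_fst hs' (genLift g s v) u,
    ← hD.genLift_fst hs' (genLift g s z) u, genPairing_genLift_neg] at h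
  have h2 : ∀ a b c d e : GenTangent 𝔤, genPairing (a - b - (c - d)) e
      = genPairing a e - genPairing b e - genPairing c e + genPairing d e := by
    intro a b c d e
    simp only [genPairing, Prod.fst_sub, Prod.snd_sub, map_sub, LinearMap.sub_apply]
    ring
  have h3 : ∀ x y, genPairing (genLift g (-s) x) (genLift g s y) = 0 := fun x y => by
    simpa using genPairing_genLift_neg g (-s) x y
  rw [h2, h3, h3, genPairing_genLift_same, genPairing_genLift_same] at h
  apply mul_left_cancel₀ hs0
  linarith

/-- The trace defining the two components of the generalised Ricci curvature for `H = 0` and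
vanishing divergence. -/
lemma IsGenLeviCivita.trace_genCurvature {nabla : 𝔤 →ₗ[ℝ] 𝔤 →ₗ[ℝ] 𝔤} (hn : IsLeviCivita g nabla)
    (hD : IsGenLeviCivita g 0 D) (hdiv : ∀ e, genDivergence D e = 0) {s : ℝ} (hs : s * s = 1)
    (v w : 𝔤) :
    LinearMap.trace ℝ 𝔤 (LinearMap.fst ℝ 𝔤 (Module.Dual ℝ 𝔤) ∘ₗ
      genCurvature 0 D (genLift g (-s) v) (genLift g s w) ∘ₗ genLift g s)
      = - LinearMap.trace ℝ 𝔤 (nabla.flip w ∘ₗ nabla.flip v) := by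
  have hs' : -s * -s = 1 := by linarith
  have key : ∀ x : 𝔤, D.flip (genLift g s x)
      = genLift g s ∘ₗ (LinearMap.fst ℝ 𝔤 (Module.Dual ℝ 𝔤) ∘ₗ D.flip (genLift g s x)) := by
    intro x
    refine LinearMap.ext fun a => ?_
    simp [hD.genLift_fst hs]
  have htr : ∀ x : 𝔤, LinearMap.trace ℝ 𝔤 ((LinearMap.fst ℝ 𝔤 (Module.Dual ℝ 𝔤) ∘ₗ
      D.flip (genLift g s x)) ∘ₗ genLift g s) = 0 := by
    intro x
    rw [← LinearMap.trace_comp_comm', ← key]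
    exact hdiv _
  set P := (LinearMap.fst ℝ 𝔤 (Module.Dual ℝ 𝔤) ∘ₗ D.flip (genLift g s w)) ∘ₗ genLift g s
    with hP
  -- `P` carries the undetermined pure part of D. It occurs only in a commutator with ∇_v; the other
  -- pure term has as its trace the divergence of the lift of ∇_v w.
  have heq : LinearMap.fst ℝ 𝔤 (Module.Dual ℝ 𝔤) ∘ₗ
      genCurvature 0 D (genLift g (-s) v) (genLift g s w) ∘ₗ genLift g s
      = ((LinearMap.fst ℝ 𝔤 (Module.Dual ℝ 𝔤) ∘ₗ
        D.flip (genLift g s (nabla v w))) ∘ₗ genLift g s) - nabla v ∘ₗ P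
        - (nabla.flip w ∘ₗ nabla.flip v) + P ∘ₗ nabla v := by
    ext1 u
    have h1 : (D (genLift g (-s) v) (D (genLift g s u) (genLift g s w))).1
        = nabla v (D (genLift g s u) (genLift g s w)).1 := by
      rw [← hD.genLift_fst hs (genLift g s u) w, hD.mixed hn hs]
      rfl
    have h2 := dorfman_zero_genLift hn s u v
    have h3 : (D (genLift g (-s) (nabla u v)) (genLift g s w)).1 = nabla (nabla u v) w := by
      rw [hD.mixed hn hs]; rfl
    simp only [genCurvature, hP, LinearMap.comp_apply, LinearMap.sub_apply, LinearMap.add_apply,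
      LinearMap.fst_apply, LinearMap.flip_apply, hD.mixed hn hs, h2, map_sub, Prod.fst_sub, h1, h3,
      _root_.genLift_fst]
    abel
  rw [heq, map_add, map_sub, map_sub, htr, LinearMap.trace_comp_comm' (nabla v) P]
  ring

end Connection

end GenEinstein

/-! ### Existence of divergence-free connections and the Einstein criterion -/

section GenEinsteinIff

variable {𝔤 : Type*} [LieRing 𝔤] [LieAlgebra ℝ 𝔤] [FiniteDimensional ℝ 𝔤]

lemma genPairing_eq_genPart (g : PseudoRiemMetric 𝔤) (x y : GenTangent 𝔤) :
    genPairing x y = g.form (genPart g 1 x) (genPart g 1 y)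
      - g.form (genPart g (-1) x) (genPart g (-1) y) := by
  conv_lhs => rw [← genLift_genPart_add g x, ← genLift_genPart_add g y]
  simp only [genPairing, Prod.fst_add, Prod.snd_add, genLift_fst, LinearMap.add_apply, map_add,
    genLift_snd_apply]
  rw [g.symm (genPart g 1 y) (genPart g 1 x), g.symm (genPart g 1 y) (genPart g (-1) x),
    g.symm (genPart g (-1) y) (genPart g 1 x), g.symm (genPart g (-1) y) (genPart g (-1) x)]
  ring

/-- Once the brackets are expressed by ∇, this is the form in which the torsion of `genConnection`
can be compared component by component. -/
lemma genPairing_dorfman (g : PseudoRiemMetric 𝔤) (a b c : GenTangent 𝔤) :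
    2 * genPairing (dorfman 0 a b) c =
      g.form (genPart g 1 c - genPart g (-1) c)
        ⁅genPart g 1 a + genPart g (-1) a, genPart g 1 b + genPart g (-1) b⁆
      - g.form (genPart g 1 b - genPart g (-1) b)
        ⁅genPart g 1 a + genPart g (-1) a, genPart g 1 c + genPart g (-1) c⁆
      + g.form (genPart g 1 a - genPart g (-1) a)
        ⁅genPart g 1 b + genPart g (-1) b, genPart g 1 c + genPart g (-1) c⁆ := by
  conv_lhs => rw [← genLift_genPart_add g a, ← genLift_genPart_add g b, ← genLift_genPart_add g c]
  generalize genPart g 1 a = x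
  generalize genPart g (-1) a = x'
  generalize genPart g 1 b = y
  generalize genPart g (-1) b = y'
  generalize genPart g 1 c = z
  generalize genPart g (-1) c = z'
  have h : dorfman 0 (genLift g 1 x + genLift g (-1) x') (genLift g 1 y + genLift g (-1) y') =
      (⁅x + x', y + y'⁆, -((genLift g 1 y + genLift g (-1) y').2 ∘ₗ
        (LieAlgebra.ad ℝ 𝔤 (x + x') : 𝔤 →ₗ[ℝ] 𝔤)) + (genLift g 1 x + genLift g (-1) x').2 ∘ₗ
        (LieAlgebra.ad ℝ 𝔤 (y + y') : 𝔤 →ₗ[ℝ] 𝔤) + contract 0 (x + x') (y + y')) := rfl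
  rw [h]
  have h0 : contract (0 : 𝔤 [⋀^Fin 3]→ₗ[ℝ] ℝ) (x + x') (y + y') = 0 := by
    ext z; rw [contract_apply]; rfl
  rw [h0]
  simp only [genPairing, Prod.fst_add, Prod.snd_add, genLift_fst, LinearMap.add_apply, add_zero,
    genLift_snd_apply, LinearMap.neg_apply, LinearMap.comp_apply, LieAlgebra.ad_apply, map_sub,
    LinearMap.sub_apply]
  ring

/-- The tensor `χ_u v = g(u, v) t - g(t, v) u`, used to change the divergence of a generalised
Levi-Civita connection. -/
noncomputable def divergenceShift (g : PseudoRiemMetric 𝔤) (t : 𝔤) : 𝔤 →ₗ[ℝ] 𝔤 →ₗ[ℝ] 𝔤 :=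
  LinearMap.mk₂ ℝ (fun u v => g.form u v • t - g.form t v • u)
    (by intros; simp only [map_add, LinearMap.add_apply]; module)
    (by intros; simp only [map_smul, LinearMap.smul_apply, smul_eq_mul]; module)
    (by intros; simp only [map_add]; module)
    (by intros; simp only [map_smul, smul_eq_mul]; module)

/-- The generalised connection built from the Levi-Civita connection of `g` and
`divergenceShift g t`. -/
noncomputable def genConnection (g : PseudoRiemMetric 𝔤) (nabla : 𝔤 →ₗ[ℝ] 𝔤 →ₗ[ℝ] 𝔤) (t : 𝔤) :
    GenTangent 𝔤 →ₗ[ℝ] GenTangent 𝔤 →ₗ[ℝ] GenTangent 𝔤 :=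
  ((nabla ∘ₗ LinearMap.fst ℝ 𝔤 (Module.Dual ℝ 𝔤) + divergenceShift g t ∘ₗ genPart g 1).compl₂
      (genPart g 1)).compr₂ (genLift g 1)
  + ((nabla ∘ₗ LinearMap.fst ℝ 𝔤 (Module.Dual ℝ 𝔤)
      + divergenceShift g t ∘ₗ genPart g (-1)).compl₂ (genPart g (-1))).compr₂ (genLift g (-1))

lemma genConnection_apply (g : PseudoRiemMetric 𝔤) (nabla : 𝔤 →ₗ[ℝ] 𝔤 →ₗ[ℝ] 𝔤) (t : 𝔤)
    (a b : GenTangent 𝔤) :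
    genConnection g nabla t a b
      = genLift g 1 (nabla a.1 (genPart g 1 b) + divergenceShift g t (genPart g 1 a) (genPart g 1 b))
        + genLift g (-1) (nabla a.1 (genPart g (-1) b)
          + divergenceShift g t (genPart g (-1) a) (genPart g (-1) b)) := rfl

lemma genPart_genConnection (g : PseudoRiemMetric 𝔤) (nabla : 𝔤 →ₗ[ℝ] 𝔤 →ₗ[ℝ] 𝔤) (t : 𝔤)
    (a b : GenTangent 𝔤) {s : ℝ} (hs : s = 1 ∨ s = -1) :
    genPart g s (genConnection g nabla t a b)
      = nabla (genPart g 1 a + genPart g (-1) a) (genPart g s b)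
        + divergenceShift g t (genPart g s a) (genPart g s b) := by
  have h1 : a.1 = genPart g 1 a + genPart g (-1) a := by
    conv_lhs => rw [← genLift_genPart_add g a]
    rfl
  have h2 : ∀ u, genPart g 1 (genLift g (-1) u) = 0 := fun u => by
    simpa using genPart_neg_genLift g (s := -1) (by norm_num) u
  rw [genConnection_apply, ← h1]
  rcases hs with rfl | rfl
  · rw [map_add, genPart_genLift g (by norm_num), h2, add_zero]
  · rw [map_add, genPart_genLift g (by norm_num), genPart_neg_genLift g (by norm_num), zero_add]

omit [FiniteDimensional ℝ 𝔤] in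
lemma divergenceShift_apply (g : PseudoRiemMetric 𝔤) (t u v : 𝔤) :
    divergenceShift g t u v = g.form u v • t - g.form t v • u := rfl

/-- For H = 0 the Levi-Civita part alone accounts for the Dorfman bracket. The tensor
`divergenceShift` can be added freely: it is skew in its last two slots and its cyclic sum vanishes,
so neither pairing nor torsion sees it, and it respects the splitting of E. -/
lemma isGenLeviCivita_genConnection {g : PseudoRiemMetric 𝔤} {nabla : 𝔤 →ₗ[ℝ] 𝔤 →ₗ[ℝ] 𝔤}
    (hn : IsLeviCivita g nabla) (t : 𝔤) : IsGenLeviCivita g 0 (genConnection g nabla t) where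
  pairing a b c := by
    rw [genPairing_eq_genPart g, genPairing_eq_genPart g]
    simp only [genPart_genConnection g nabla t _ _ (Or.inl rfl),
      genPart_genConnection g nabla t _ _ (Or.inr rfl)]
    generalize genPart g 1 a = x
    generalize genPart g (-1) a = x'
    generalize genPart g 1 b = y
    generalize genPart g (-1) b = y'
    generalize genPart g 1 c = z
    generalize genPart g (-1) c = z'
    have h1 := hn.metric (x + x') y z
    have h2 := hn.metric (x + x') y' z'
    have h3 : ∀ u v w, g.form (divergenceShift g t u v) w
        + g.form v (divergenceShift g t u w) = 0 := by
      intro u v w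
      simp only [divergenceShift_apply, map_sub, map_smul, LinearMap.sub_apply,
        LinearMap.smul_apply, smul_eq_mul, g.symm v t, g.symm v u]
      ring
    have h4 := h3 x y z
    have h5 := h3 x' y' z'
    simp only [map_add, LinearMap.add_apply] at h1 h2 ⊢
    linarith
  torsion_free a b c := by
    have hsub : ∀ a b c d : GenTangent 𝔤, genPairing (a - b - c) d
        = genPairing a d - genPairing b d - genPairing c d := by
      intro a b c d
      simp only [genPairing, Prod.fst_sub, Prod.snd_sub, map_sub, LinearMap.sub_apply]
      ring
    have hd := genPairing_dorfman g a b c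
    rw [hsub, genPairing_eq_genPart g (genConnection g nabla t a b),
      genPairing_eq_genPart g (genConnection g nabla t b a),
      genPairing_eq_genPart g b]
    simp only [genPart_genConnection g nabla t _ _ (Or.inl rfl),
      genPart_genConnection g nabla t _ _ (Or.inr rfl)]
    generalize genPairing (dorfman 0 a b) c = d at *
    generalize genPart g 1 a = x at *
    generalize genPart g (-1) a = x' at *
    generalize genPart g 1 b = y at *
    generalize genPart g (-1) b = y' at *
    generalize genPart g 1 c = z at *
    generalize genPart g (-1) c = z' at *
    rw [← hn.torsion_free, ← hn.torsion_free, ← hn.torsion_free] at hd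
    have hs : ∀ u v w, g.form u (nabla v w) = g.form (nabla v w) u := fun _ _ _ => g.symm _ _
    have hchi : ∀ u v w, g.form (divergenceShift g t u v) w - g.form (divergenceShift g t v u) w
        + g.form v (divergenceShift g t w u) = 0 := by
      intro u v w
      simp only [divergenceShift_apply, map_sub, map_smul, LinearMap.sub_apply,
        LinearMap.smul_apply, smul_eq_mul, g.symm v t, g.symm v u, g.symm w u, g.symm w v]
      ring
    have h4 := hchi x y z
    have h5 := hchi x' y' z'
    have key : ∀ u v w, g.form (nabla u w) v = - g.form (nabla u v) w := by
      intro u v w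
      have := hn.metric u v w
      rw [hs] at this
      linarith
    have k1 := fun u => key u y z
    have k2 := fun u => key u y' z
    have k3 := fun u => key u y z'
    have k4 := fun u => key u y' z'
    have k5 := fun u => key u x z
    have k6 := fun u => key u x' z
    have k7 := fun u => key u x z'
    have k8 := fun u => key u x' z'
    have k9 := fun u => key u x y
    have k10 := fun u => key u x' y
    have k11 := fun u => key u x y'
    have k12 := fun u => key u x' y'
    simp only [map_add, map_sub, LinearMap.add_apply, LinearMap.sub_apply, hs, k1, k2, k3, k4, k5,
      k6, k7, k8, k9, k10, k11, k12] at hd h4 h5 ⊢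
    linarith
  metric a b := by
    rw [genConnection_apply, genConnection_apply]
    have h1 := genMetric_genLift g (s := 1) (by norm_num)
    have h2 := genMetric_genLift g (s := -1) (by norm_num)
    have h3 : genMetric g b = genLift g 1 (genPart g 1 b) - genLift g (-1) (genPart g (-1) b) := by
      conv_lhs => rw [← genLift_genPart_add g b]
      rw [map_add, h1, h2]
      module
    have h4 : genPart g 1 (genMetric g b) = genPart g 1 b := by
      have := genPart_neg_genLift g (s := -1) (by norm_num) (genPart g (-1) b)
      rw [neg_neg] at this
      rw [h3, map_sub, genPart_genLift g (by norm_num), this, sub_zero]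
    have h5 : genPart g (-1) (genMetric g b) = - genPart g (-1) b := by
      rw [h3, map_sub, genPart_genLift g (by norm_num), genPart_neg_genLift g (by norm_num),
        zero_sub]
    rw [map_add (genMetric g), h1, h2, h4, h5]
    simp only [map_neg, map_add]
    module

/-- The divergence of a generalised Levi-Civita connection only involves pure components. -/
lemma IsGenLeviCivita.genDivergence_genLift {g : PseudoRiemMetric 𝔤} {H : 𝔤 [⋀^Fin 3]→ₗ[ℝ] ℝ}
    {D : GenTangent 𝔤 →ₗ[ℝ] GenTangent 𝔤 →ₗ[ℝ] GenTangent 𝔤} (hD : IsGenLeviCivita g H D)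
    {s : ℝ} (hs : s * s = 1) (x : 𝔤) :
    genDivergence D (genLift g s x) = LinearMap.trace ℝ 𝔤 ((LinearMap.fst ℝ 𝔤 (Module.Dual ℝ 𝔤) ∘ₗ
      D.flip (genLift g s x)) ∘ₗ genLift g s) := by
  have key : D.flip (genLift g s x)
      = genLift g s ∘ₗ (LinearMap.fst ℝ 𝔤 (Module.Dual ℝ 𝔤) ∘ₗ D.flip (genLift g s x)) := by
    refine LinearMap.ext fun a => ?_
    simp [hD.genLift_fst hs]
  rw [← LinearMap.trace_comp_comm', ← key]
  rfl

/-- The shift by t changes the divergence of x^± from tr(∇x) to tr(∇x) − (m − 1) g(t, x), where m =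
dim 𝔤. A suitable t makes this zero as soon as m ≠ 1, which is the role of the dimension bound. -/
lemma exists_isGenLeviCivita_genDivergence_eq_zero {g : PseudoRiemMetric 𝔤}
    {nabla : 𝔤 →ₗ[ℝ] 𝔤 →ₗ[ℝ] 𝔤} (hn : IsLeviCivita g nabla) (hdim : 2 ≤ Module.finrank ℝ 𝔤) :
    ∃ D, IsGenLeviCivita g 0 D ∧ ∀ e, genDivergence D e = 0 := by
  set m : ℝ := (Module.finrank ℝ 𝔤 : ℝ) with hm
  have hm1 : m - 1 ≠ 0 := by
    have : (2 : ℝ) ≤ m := by rw [hm]; exact_mod_cast hdim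
    linarith
  set t := (g.form.toDual g.nondeg).symm ((m - 1)⁻¹ • (LinearMap.trace ℝ 𝔤 ∘ₗ nabla.flip)) with ht
  have htv : ∀ v, (m - 1) * g.form t v = LinearMap.trace ℝ 𝔤 (nabla.flip v) := by
    intro v
    rw [ht, LinearMap.BilinForm.apply_toDual_symm_apply]
    simp only [LinearMap.smul_apply, LinearMap.comp_apply, smul_eq_mul]
    rw [mul_inv_cancel_left₀ hm1]
  have hD := isGenLeviCivita_genConnection hn t
  have hchi : ∀ v, LinearMap.trace ℝ 𝔤 ((divergenceShift g t).flip v) = (1 - m) * g.form t v := by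
    intro v
    have : (divergenceShift g t).flip v
        = (g.form v).smulRight t - g.form t v • LinearMap.id := by
      ext u
      simp [divergenceShift_apply, g.symm u v]
    rw [this, map_sub, map_smul, LinearMap.trace_smulRight, LinearMap.trace_id, g.symm v t,
      smul_eq_mul]
    ring
  have hlift : ∀ s : ℝ, (s = 1 ∨ s = -1) → ∀ x,
      genDivergence (genConnection g nabla t) (genLift g s x) = 0 := by
    intro s hs x
    have hss : s * s = 1 := by rcases hs with rfl | rfl <;> norm_num
    rw [hD.genDivergence_genLift hss]
    have : (LinearMap.fst ℝ 𝔤 (Module.Dual ℝ 𝔤) ∘ₗ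
        (genConnection g nabla t).flip (genLift g s x)) ∘ₗ genLift g s
        = nabla.flip x + (divergenceShift g t).flip x := by
      ext u
      have h1 : genPart g s (genConnection g nabla t (genLift g s u) (genLift g s x))
          = (genConnection g nabla t (genLift g s u) (genLift g s x)).1 := by
        rw [← hD.genLift_fst hss, genPart_genLift g hss, _root_.genLift_fst]
      have h2 : genPart g 1 (genLift g s u) + genPart g (-1) (genLift g s u) = u := by
        have := congrArg Prod.fst (genLift_genPart_add g (genLift g s u))
        simpa using this
      simp only [LinearMap.comp_apply, LinearMap.fst_apply, LinearMap.flip_apply,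
        LinearMap.add_apply]
      rw [← h1, genPart_genConnection g nabla t _ _ hs, h2, genPart_genLift g hss,
        genPart_genLift g hss]
    rw [this, map_add, hchi, ← htv]
    ring
  refine ⟨_, hD, fun e => ?_⟩
  rw [← genLift_genPart_add g e]
  have : ∀ x y, genDivergence (genConnection g nabla t) (x + y)
      = genDivergence (genConnection g nabla t) x + genDivergence (genConnection g nabla t) y := by
    intro x y
    simp [genDivergence]
  rw [this, hlift 1 (Or.inl rfl), hlift (-1) (Or.inr rfl), add_zero]

lemma IsGenLeviCivita.genMetric_genCurvature {g : PseudoRiemMetric 𝔤} {H : 𝔤 [⋀^Fin 3]→ₗ[ℝ] ℝ}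
    {D : GenTangent 𝔤 →ₗ[ℝ] GenTangent 𝔤 →ₗ[ℝ] GenTangent 𝔤} (hD : IsGenLeviCivita g H D)
    (a b c : GenTangent 𝔤) :
    genMetric g (genCurvature H D b c a) = genCurvature H D b (genMetric g c) a := by
  simp [genCurvature, hD.metric]

/-- The isomorphism `u ↦ u + g u` onto `E_+`. -/
noncomputable def plusEquiv (g : PseudoRiemMetric 𝔤) : 𝔤 ≃ₗ[ℝ] Eplus g :=
  genLiftEquiv g (s := 1) (by norm_num)

/-- The isomorphism `u ↦ u - g u` onto `E_-`. -/
noncomputable def minusEquiv (g : PseudoRiemMetric 𝔤) : 𝔤 ≃ₗ[ℝ] Eminus g :=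
  genLiftEquiv g (s := -1) (by norm_num)

/-- Both Ricci components equal −tr(∇w ∘ ∇v) for every divergence-free D, so the choice of D in the
definition is immaterial once one exists. -/
theorem isGeneralisedEinstein_zero_iff {g : PseudoRiemMetric 𝔤} {nabla : 𝔤 →ₗ[ℝ] 𝔤 →ₗ[ℝ] 𝔤}
    (hn : IsLeviCivita g nabla) (hdim : 2 ≤ Module.finrank ℝ 𝔤) :
    IsGeneralisedEinstein g 0 0 ↔
      ∀ v w, LinearMap.trace ℝ 𝔤 (nabla.flip w ∘ₗ nabla.flip v) = 0 := by
  have h1 : (1 : ℝ) * 1 = 1 := by norm_num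
  have h1' : (-1 : ℝ) * -1 = 1 := by norm_num
  have hplus : ∀ D, IsGenLeviCivita g 0 D → (∀ e, genDivergence D e = 0) → ∀ v w,
      genRicciPlus g 0 D (minusEquiv g v) (plusEquiv g w)
        = - LinearMap.trace ℝ 𝔤 (nabla.flip w ∘ₗ nabla.flip v) := by
    intro D hD hdiv v w
    rw [← hD.trace_genCurvature hn hdiv h1]
    refine (LinearMap.trace_conj' (R := ℝ) (M := Eplus g) (N := 𝔤) _ (plusEquiv g).symm).symm.trans ?_
    congr 1
    refine LinearMap.ext fun u => ?_
    have hE : genMetric g (genLift g 1 w) = genLift g 1 w := by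
      simpa using genMetric_genLift g h1 w
    -- The curvature commutes with 𝒢, so its value on a vector of E_+ stays in E_+ and the
    -- projection acts as the identity.
    have := hD.genMetric_genCurvature (genLift g 1 u) (genLift g (-1) v) (genLift g 1 w)
    rw [hE] at this
    change ((1 / 2 : ℝ) • (genCurvature 0 D (genLift g (-1) v) (genLift g 1 w) (genLift g 1 u)
      + genMetric g (genCurvature 0 D (genLift g (-1) v) (genLift g 1 w) (genLift g 1 u)))).1
      = (genCurvature 0 D (genLift g (-1) v) (genLift g 1 w) (genLift g 1 u)).1
    rw [this, Prod.smul_fst, Prod.fst_add]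
    module
  have hminus : ∀ D, IsGenLeviCivita g 0 D → (∀ e, genDivergence D e = 0) → ∀ v w,
      genRicciMinus g 0 D (plusEquiv g v) (minusEquiv g w)
        = - LinearMap.trace ℝ 𝔤 (nabla.flip w ∘ₗ nabla.flip v) := by
    intro D hD hdiv v w
    rw [← hD.trace_genCurvature hn hdiv h1']
    refine (LinearMap.trace_conj' (R := ℝ) (M := Eminus g) (N := 𝔤) _ (minusEquiv g).symm).symm.trans ?_
    rw [neg_neg]
    congr 1
    refine LinearMap.ext fun u => ?_
    have hE : genMetric g (genLift g (-1) w) = - genLift g (-1) w := by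
      rw [genMetric_genLift g h1' w]
      module
    have := hD.genMetric_genCurvature (genLift g (-1) u) (genLift g 1 v) (genLift g (-1) w)
    rw [hE] at this
    have h3 : genCurvature 0 D (genLift g 1 v) (-genLift g (-1) w) (genLift g (-1) u)
        = - genCurvature 0 D (genLift g 1 v) (genLift g (-1) w) (genLift g (-1) u) := by
      simp [genCurvature]
      abel
    change ((1 / 2 : ℝ) • (genCurvature 0 D (genLift g 1 v) (genLift g (-1) w) (genLift g (-1) u)
      - genMetric g (genCurvature 0 D (genLift g 1 v) (genLift g (-1) w) (genLift g (-1) u)))).1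
      = (genCurvature 0 D (genLift g 1 v) (genLift g (-1) w) (genLift g (-1) u)).1
    rw [this, h3, Prod.smul_fst, Prod.fst_sub, Prod.fst_neg]
    module
  constructor
  · rintro ⟨D, hD, hdiv, hp, -⟩ v w
    have := hplus D hD hdiv v w
    rw [hp] at this
    linarith
  · intro h
    obtain ⟨D, hD, hdiv⟩ := exists_isGenLeviCivita_genDivergence_eq_zero hn hdim
    refine ⟨D, hD, hdiv, fun b c => ?_, fun b c => ?_⟩
    · have := hplus D hD hdiv ((minusEquiv g).symm b) ((plusEquiv g).symm c)
      rw [LinearEquiv.apply_symm_apply, LinearEquiv.apply_symm_apply, h, neg_zero] at this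
      exact this
    · have := hminus D hD hdiv ((plusEquiv g).symm b) ((minusEquiv g).symm c)
      rw [LinearEquiv.apply_symm_apply, LinearEquiv.apply_symm_apply, h, neg_zero] at this
      exact this

end GenEinsteinIff

/-! ### The Levi-Civita connection of an almost abelian Lie algebra -/

section AlmostAbelian

variable {𝔤 : Type*} [LieRing 𝔤] [LieAlgebra ℝ 𝔤]

/-- The Lie algebra `𝔤` is the orthogonal sum of an abelian ideal `N` and the line spanned by `X`,
where `g(X, X) = ε = ±1`, and `ad_X` acts on `N` as `S + A`, with `S` self-adjoint and `A` skew. -/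
structure IsAlmostAbelian (g : PseudoRiemMetric 𝔤) (N : LieIdeal ℝ 𝔤)
    (B : LinearMap.BilinForm ℝ N) (X : 𝔤) (ε : ℝ) (S A : N →ₗ[ℝ] N) : Prop where
  lie_eq_zero : ∀ Y Z : N, ⁅(Y : 𝔤), (Z : 𝔤)⁆ = 0
  finrank : Module.finrank ℝ N + 1 = Module.finrank ℝ 𝔤
  form_eq : ∀ Y Z : N, B Y Z = g.form (Y : 𝔤) (Z : 𝔤)
  form_normal : ∀ Y ∈ N, g.form X Y = 0
  form_self : g.form X X = ε
  sq_eq_one : ε * ε = 1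
  lie_normal : ∀ Y : N, ⁅X, (Y : 𝔤)⁆ = (S Y + A Y : N)
  selfAdjoint : ∀ Y Z, B (S Y) Z = B Y (S Z)
  skewAdjoint : ∀ Y Z, B (A Y) Z = - B Y (A Z)

namespace IsAlmostAbelian

variable [FiniteDimensional ℝ 𝔤] {g : PseudoRiemMetric 𝔤} {N : LieIdeal ℝ 𝔤}
  {B : LinearMap.BilinForm ℝ N} {X : 𝔤} {ε : ℝ} {S A : N →ₗ[ℝ] N}
  (h : IsAlmostAbelian g N B X ε S A)

include h

/-- N is contained in the orthogonal complement of X, and both have codimension one because g(X, X)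
≠ 0. -/
lemma mem_iff (x : 𝔤) : x ∈ N ↔ g.form X x = 0 := by
  have hle : N.toSubmodule ≤ LinearMap.ker (g.form X) := fun y hy => h.form_normal y hy
  have hne : g.form X ≠ 0 := by
    intro h0
    have h1 := h.sq_eq_one
    rw [← h.form_self, h0] at h1
    simp at h1
  have h2 := Module.Dual.finrank_ker_add_one_of_ne_zero (f := g.form X) hne
  have h3 : N.toSubmodule = LinearMap.ker (g.form X) := by
    apply Submodule.eq_of_le_of_finrank_eq hle
    have := h.finrank
    change Module.finrank ℝ N.toSubmodule + 1 = _ at this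
    omega
  change x ∈ N.toSubmodule ↔ _
  rw [h3, LinearMap.mem_ker]

/-- The coefficient of `X` in the decomposition `𝔤 = ℝ X ⊕ N`. -/
noncomputable def coord (_ : IsAlmostAbelian g N B X ε S A) : 𝔤 →ₗ[ℝ] ℝ := ε • g.form X

/-- The projection `𝔤 = ℝ X ⊕ N → N`. -/
noncomputable def proj : 𝔤 →ₗ[ℝ] N :=
  LinearMap.codRestrict N.toSubmodule (LinearMap.id - h.coord.smulRight X) (by
    intro x
    change _ ∈ N
    rw [h.mem_iff]
    simp only [coord, LinearMap.sub_apply, LinearMap.id_apply, LinearMap.smulRight_apply,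
      LinearMap.smul_apply, map_sub, map_smul, h.form_self, smul_eq_mul]
    linear_combination (-g.form X x) * h.sq_eq_one)

lemma coe_proj (x : 𝔤) : (h.proj x : 𝔤) = x - h.coord x • X := rfl

lemma decomp (x : 𝔤) : x = h.coord x • X + (h.proj x : 𝔤) := by
  rw [coe_proj]; abel

omit [FiniteDimensional ℝ 𝔤] in
@[simp] lemma coord_self : h.coord X = 1 := by
  simp [coord, h.form_self, h.sq_eq_one]

omit [FiniteDimensional ℝ 𝔤] in
@[simp] lemma coord_coe (Y : N) : h.coord (Y : 𝔤) = 0 := by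
  simp [coord, h.form_normal _ Y.2]

@[simp] lemma proj_self : h.proj X = 0 := Subtype.ext (by simp [coe_proj])

@[simp] lemma proj_coe (Y : N) : h.proj (Y : 𝔤) = Y := Subtype.ext (by simp [coe_proj])

lemma form_decomp (x y : 𝔤) :
    g.form x y = ε * h.coord x * h.coord y + B (h.proj x) (h.proj y) := by
  conv_lhs => rw [h.decomp x, h.decomp y]
  have h1 := h.form_normal _ (h.proj x).2
  have h2 := h.form_normal _ (h.proj y).2
  rw [g.symm] at h1
  simp only [map_add, map_smul, LinearMap.add_apply, LinearMap.smul_apply, smul_eq_mul,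
    h.form_self, h1, h2, h.form_eq]
  ring

lemma lie_decomp (x y : 𝔤) :
    ⁅x, y⁆ = ((h.coord x • (S (h.proj y) + A (h.proj y))
      - h.coord y • (S (h.proj x) + A (h.proj x)) : N) : 𝔤) := by
  conv_lhs => rw [h.decomp x, h.decomp y]
  have h1 : ⁅((h.proj x : N) : 𝔤), X⁆ = -((S (h.proj x) + A (h.proj x) : N) : 𝔤) := by
    rw [← lie_skew, h.lie_normal]
  simp only [add_lie, lie_add, smul_lie, lie_smul, lie_self, h.lie_normal, h.lie_eq_zero, h1]
  simp only [smul_zero, zero_add, add_zero, smul_neg]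
  push_cast
  abel

/-- The Levi-Civita connection of `g`. -/
noncomputable def nabla : 𝔤 →ₗ[ℝ] 𝔤 →ₗ[ℝ] 𝔤 :=
  LinearMap.mk₂ ℝ (fun x y => ((h.coord x • A (h.proj y) - h.coord y • S (h.proj x) : N) : 𝔤)
      + (ε * B (S (h.proj x)) (h.proj y)) • X)
    (by intros; simp only [map_add, LinearMap.add_apply]; push_cast; module)
    (by intros; simp only [map_smul, LinearMap.smul_apply, smul_eq_mul]; push_cast; module)
    (by intros; simp only [map_add]; push_cast; module)
    (by intros; simp only [map_smul, smul_eq_mul]; push_cast; module)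

lemma nabla_apply (x y : 𝔤) :
    h.nabla x y = ((h.coord x • A (h.proj y) - h.coord y • S (h.proj x) : N) : 𝔤)
      + (ε * B (S (h.proj x)) (h.proj y)) • X := rfl

@[simp] lemma coord_nabla (x y : 𝔤) :
    h.coord (h.nabla x y) = ε * B (S (h.proj x)) (h.proj y) := by
  rw [nabla_apply, map_add, coord_coe, map_smul, coord_self]
  simp

@[simp] lemma proj_nabla (x y : 𝔤) :
    h.proj (h.nabla x y) = h.coord x • A (h.proj y) - h.coord y • S (h.proj x) := by
  rw [nabla_apply, map_add, proj_coe, map_smul, proj_self]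
  simp

omit [FiniteDimensional ℝ 𝔤] in
lemma form_comm (Y Z : N) : B Y Z = B Z Y := by
  rw [h.form_eq, h.form_eq, g.symm]

lemma isLeviCivita_nabla : IsLeviCivita g h.nabla where
  torsion_free x y := by
    rw [h.lie_decomp, nabla_apply, nabla_apply, h.selfAdjoint, h.form_comm]
    push_cast
    simp only [smul_add]
    module
  metric x y z := by
    rw [h.form_decomp, h.form_decomp]
    simp only [coord_nabla, proj_nabla, map_sub, LinearMap.sub_apply, map_smul,
      LinearMap.smul_apply, smul_eq_mul, h.skewAdjoint]
    rw [h.form_comm (h.proj y) (S (h.proj x))]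
    linear_combination (h.coord y * B (S (h.proj x)) (h.proj z)
      + h.coord z * B (S (h.proj x)) (h.proj y)) * h.sq_eq_one

/-- T is a rank-one map with image ℝ T X plus a map factoring through `proj`; cyclicity of the trace
moves `proj` to the other side. -/
lemma trace_eq (T : 𝔤 →ₗ[ℝ] 𝔤) :
    LinearMap.trace ℝ 𝔤 T = h.coord (T X)
      + LinearMap.trace ℝ N (h.proj ∘ₗ T ∘ₗ N.toSubmodule.subtype) := by
  have h1 : T = h.coord.smulRight (T X) + (T ∘ₗ N.toSubmodule.subtype) ∘ₗ h.proj := by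
    refine LinearMap.ext fun x => ?_
    conv_lhs => rw [h.decomp x]
    simp
  conv_lhs => rw [h1]
  rw [map_add, LinearMap.trace_smulRight]
  congr 1
  exact LinearMap.trace_comp_comm' (R := ℝ) (M := 𝔤) (N := N) h.proj (T ∘ₗ N.toSubmodule.subtype)

/-- On N the composite is v₀w₀ S² plus a rank-one map in the direction of A w'. The trace of the
latter and the X-component of the value at X are the two halves of the commutator. -/
lemma trace_nabla_comp_nabla (v w : 𝔤) :
    LinearMap.trace ℝ 𝔤 (h.nabla.flip w ∘ₗ h.nabla.flip v)
      = ε * B (S (A (h.proj v)) - A (S (h.proj v))) (h.proj w)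
        + h.coord v * h.coord w * LinearMap.trace ℝ N (S ∘ₗ S) := by
  rw [h.trace_eq]
  have h1 : (h.proj ∘ₗ (h.nabla.flip w ∘ₗ h.nabla.flip v) ∘ₗ N.toSubmodule.subtype : N →ₗ[ℝ] N)
      = (h.coord v * h.coord w) • (S ∘ₗ S)
        + (ε • (B (h.proj v) ∘ₗ S)).smulRight (A (h.proj w)) := by
    refine LinearMap.ext fun Y => ?_
    have h2 : N.toSubmodule.subtype Y = (Y : 𝔤) := rfl
    simp only [LinearMap.comp_apply, LinearMap.flip_apply, h2, proj_nabla, coord_nabla, coord_coe,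
      proj_coe, LinearMap.add_apply, LinearMap.smul_apply, LinearMap.smulRight_apply, zero_smul,
      zero_sub, map_neg, map_smul, h.form_comm (S Y), smul_eq_mul]
    module
  rw [h1, map_add, map_smul, LinearMap.trace_smulRight]
  simp only [LinearMap.comp_apply, LinearMap.flip_apply, proj_nabla, coord_nabla, coord_self,
    proj_self, LinearMap.smul_apply, map_zero, smul_zero, sub_zero, one_smul, map_sub,
    LinearMap.sub_apply, smul_eq_mul]
  rw [← h.selfAdjoint (h.proj v), h.skewAdjoint (S (h.proj v))]
  ring

/-- Vectors of N isolate the commutator in the trace formula, and the pair (X, X) isolates tr S². -/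
theorem isGeneralisedEinstein_iff (hB : B.Nondegenerate) (hdim : 2 ≤ Module.finrank ℝ 𝔤) :
    IsGeneralisedEinstein g 0 0 ↔ S ∘ₗ A = A ∘ₗ S ∧ LinearMap.trace ℝ N (S ∘ₗ S) = 0 := by
  rw [isGeneralisedEinstein_zero_iff h.isLeviCivita_nabla hdim]
  simp only [h.trace_nabla_comp_nabla]
  have hε : ε ≠ 0 := by
    intro h0
    have := h.sq_eq_one
    simp [h0] at this
  constructor
  · intro H
    constructor
    · refine LinearMap.ext fun Y => ?_
      refine sub_eq_zero.mp (hB.1 _ fun Z => ?_)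
      have := H Y Z
      simp only [proj_coe, coord_coe, zero_mul, add_zero] at this
      exact (mul_eq_zero.mp this).resolve_left hε
    · have := H X X
      simpa using this
  · rintro ⟨h1, h2⟩ v w
    have h3 := LinearMap.congr_fun h1 (h.proj v)
    simp only [LinearMap.comp_apply] at h3
    rw [h2, h3]
    simp

/-- Under the first two hypotheses the curvature reduces, up to sign, to ε(B(Sy, z)Sx − B(Sx, z)Sy).
The third one says that this vanishes; it holds whenever S has rank at most one. -/
lemma isFlat_of_comp_eq_zero (hSA : S ∘ₗ A = A ∘ₗ S) (hS : S ∘ₗ S = 0)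
    (hrank : ∀ Y Z W, B (S Z) W • S Y = B (S Y) W • S Z) : g.IsFlat := by
  refine ⟨h.nabla, h.isLeviCivita_nabla, fun x y z => ?_⟩
  have h1 : ∀ Y, S (A Y) = A (S Y) := LinearMap.congr_fun hSA
  have h2 : ∀ Y, S (S Y) = 0 := LinearMap.congr_fun hS
  have h3 : h.coord ⁅x, y⁆ = 0 := by rw [h.lie_decomp, coord_coe]
  have h4 : h.proj ⁅x, y⁆ = h.coord x • (S (h.proj y) + A (h.proj y))
      - h.coord y • (S (h.proj x) + A (h.proj x)) := by rw [h.lie_decomp, proj_coe]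
  have h5 : ∀ Y Z, B (S Y) (A Z) = - B (A (S Y)) Z := fun Y Z => by
    rw [h.skewAdjoint, neg_neg]
  have h6 : ∀ Y Z, B (S Y) (S Z) = 0 := fun Y Z => by
    rw [← h.selfAdjoint, h2]; simp
  rw [h.nabla_apply x (h.nabla y z), h.nabla_apply y (h.nabla x z), h.nabla_apply ⁅x, y⁆]
  simp only [coord_nabla, proj_nabla, h3, h4, map_sub, map_smul, map_add, h1, h2,
    LinearMap.sub_apply, LinearMap.add_apply, LinearMap.smul_apply, h5, h6, smul_eq_mul, smul_zero,
    map_zero, LinearMap.zero_apply]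
  have h7 := hrank (h.proj x) (h.proj y) (h.proj z)
  have h9 : ((ε • (B (S (h.proj y)) (h.proj z) • S (h.proj x))
      - ε • (B (S (h.proj x)) (h.proj z) • S (h.proj y)) : N) : 𝔤) = 0 := by
    rw [h7, sub_self]; rfl
  push_cast at h9 ⊢
  linear_combination (norm := module) - h9

/-- This is the N-component of R(X, Y)X = 0, the connection being unique. When S and A commute it
forces S² = 0. -/
lemma comp_of_isFlat (hflat : g.IsFlat) : S ∘ₗ S + S ∘ₗ A = A ∘ₗ S := by
  obtain ⟨n', hn', hc⟩ := hflat
  obtain rfl := h.isLeviCivita_nabla.unique hn'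
  refine LinearMap.ext fun Y => ?_
  have h1 := congrArg h.proj (hc X Y X)
  have h4 : h.proj ⁅X, (Y : 𝔤)⁆ = S Y + A Y := by rw [h.lie_decomp]; simp
  simp only [map_sub, proj_nabla, coord_nabla, h4, coord_self, proj_self, coord_coe, proj_coe,
    map_zero] at h1
  simp only [map_smul, smul_eq_mul, map_zero, map_neg, map_add, zero_smul, one_smul, zero_sub,
    smul_zero, sub_zero, mul_zero, map_sub] at h1
  simp only [LinearMap.add_apply, LinearMap.comp_apply]
  rw [← sub_eq_zero]
  linear_combination (norm := module) h1

end IsAlmostAbelian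

end AlmostAbelian

/-! ### Simultaneous normal form of S and A on positive definite subspaces -/

section Frames

variable {V : Type*} [AddCommGroup V] [Module ℝ V]

/-- A self-adjoint operator on a non-zero positive definite subspace has an eigenvector. -/
lemma exists_eigenvector_of_posDef [FiniteDimensional ℝ V] {B : LinearMap.BilinForm ℝ V}
    (hB : ∀ x y, B x y = B y x) {T : V →ₗ[ℝ] V} {W : Submodule ℝ V} (hW : W ≠ ⊥)
    (hpos : ∀ x ∈ W, x ≠ 0 → 0 < B x x) (hT : ∀ x ∈ W, T x ∈ W)
    (hsymm : ∀ x y, B (T x) y = B x (T y)) :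
    ∃ x ∈ W, x ≠ 0 ∧ ∃ μ : ℝ, T x = μ • x := by
  let core : InnerProductSpace.Core ℝ W :=
    { inner := fun x y => B x y
      conj_inner_symm := fun x y => by simp [hB (y : V) x]
      re_inner_nonneg := fun x => by
        by_cases hx : (x : V) = 0
        · simp [hx]
        · exact (hpos _ x.2 hx).le
      add_left := fun x y z => by simp
      smul_left := fun x y r => by simp
      definite := fun x hx => by
        by_contra hne
        have := hpos x x.2 (fun h0 => hne (Subtype.ext h0))
        exact this.ne' hx }
  let : NormedAddCommGroup W := core.toNormedAddCommGroup
  let : InnerProductSpace ℝ W := InnerProductSpace.ofCore core.toCore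
  have hsym : (T.restrict hT).IsSymmetric := fun x y => hsymm x y
  have hnt : Nontrivial W := Submodule.nontrivial_iff_ne_bot.mpr hW
  obtain ⟨μ, hμ⟩ : ∃ μ : ℝ, Module.End.HasEigenvalue (T.restrict hT) μ :=
    ⟨_, hsym.hasEigenvalue_iSup_of_finiteDimensional⟩
  obtain ⟨v, hv⟩ := hμ.exists_hasEigenvector
  refine ⟨v, v.2, fun h0 => hv.2 (Subtype.ext h0), μ, ?_⟩
  exact congrArg Subtype.val hv.apply_eq_smul

/-- A pseudo-orthonormal family of the right cardinality in which `f` has the matrix `M`. -/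
lemma hasMatrix_of_family [FiniteDimensional ℝ V] {ι : Type*} [Fintype ι] [DecidableEq ι]
    {B : LinearMap.BilinForm ℝ V} {f : V →ₗ[ℝ] V} {sgn : ι → ℝ} {M : Matrix ι ι ℝ} (e : ι → V)
    (he : ∀ i j, B (e i) (e j) = if i = j then sgn i else 0) (hsgn : ∀ i, sgn i ≠ 0)
    (hcard : Fintype.card ι = Module.finrank ℝ V) (hM : ∀ j, f (e j) = ∑ i, M i j • e i) :
    HasMatrix B f sgn M := by
  have hli : LinearIndependent ℝ e := by
    apply LinearMap.BilinForm.linearIndependent_of_iIsOrtho (B := B)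
    · intro i j hij
      change B (e i) (e j) = 0
      rw [he, if_neg hij]
    · intro i hi
      apply hsgn i
      have := he i i
      rw [if_pos rfl] at this
      rw [← this]
      exact hi
  have hspan := hli.span_eq_top_of_card_eq_finrank' hcard
  refine ⟨Module.Basis.mk hli hspan.ge, fun i j => by simp [he], ?_⟩
  ext i j
  rw [LinearMap.toMatrix_apply, Module.Basis.mk_apply, hM]
  have : ∀ i, e i = Module.Basis.mk hli hspan.ge i := fun i => (Module.Basis.mk_apply hli hspan.ge i).symm
  simp only [this, map_sum, map_smul, Module.Basis.repr_self, Finsupp.coe_finsetSum,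
    Finset.sum_apply, Finsupp.smul_apply, Finsupp.single_apply]
  simp

/-- An orthonormal system adapted to commuting operators `S` (self-adjoint) and `A` (skew):
on the plane spanned by `p i`, `q i` the operator `S` is multiplication by `a i` and `A` is
rotation with speed `b i`; each `r j` is an eigenvector of `S` killed by `A`. -/
structure IsNormalFrame (B : LinearMap.BilinForm ℝ V) (S A : V →ₗ[ℝ] V) {ι κ : Type*}
    [DecidableEq ι] [DecidableEq κ] (a b : ι → ℝ) (c : κ → ℝ) (p q : ι → V) (r : κ → V) :
    Prop where
  pp : ∀ i j, B (p i) (p j) = if i = j then 1 else 0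
  qq : ∀ i j, B (q i) (q j) = if i = j then 1 else 0
  rr : ∀ i j, B (r i) (r j) = if i = j then 1 else 0
  pq : ∀ i j, B (p i) (q j) = 0
  pr : ∀ i j, B (p i) (r j) = 0
  qr : ∀ i j, B (q i) (r j) = 0
  Sp : ∀ i, S (p i) = a i • p i
  Sq : ∀ i, S (q i) = a i • q i
  Sr : ∀ i, S (r i) = c i • r i
  Ap : ∀ i, A (p i) = b i • q i
  Aq : ∀ i, A (q i) = - b i • p i
  Ar : ∀ i, A (r i) = 0

lemma IsNormalFrame.reindex {B : LinearMap.BilinForm ℝ V} {S A : V →ₗ[ℝ] V} {ι κ ι' κ' : Type*}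
    [DecidableEq ι] [DecidableEq κ] [DecidableEq ι'] [DecidableEq κ'] {a b : ι → ℝ} {c : κ → ℝ}
    {p q : ι → V} {r : κ → V} (h : IsNormalFrame B S A a b c p q r) (σ : ι' ≃ ι) (τ : κ' ≃ κ) :
    IsNormalFrame B S A (a ∘ σ) (b ∘ σ) (c ∘ τ) (p ∘ σ) (q ∘ σ) (r ∘ τ) where
  pp i j := by simp [h.pp]
  qq i j := by simp [h.qq]
  rr i j := by simp [h.rr]
  pq i j := h.pq _ _
  pr i j := h.pr _ _
  qr i j := h.qr _ _
  Sp i := h.Sp _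
  Sq i := h.Sq _
  Sr i := h.Sr _
  Ap i := h.Ap _
  Aq i := h.Aq _
  Ar i := h.Ar _

/-- The part of `W` orthogonal to `x`. -/
def orthoIn (B : LinearMap.BilinForm ℝ V) (W : Submodule ℝ V) (x : V) : Submodule ℝ V :=
  W ⊓ LinearMap.ker (B x)

lemma mem_orthoIn {B : LinearMap.BilinForm ℝ V} {W : Submodule ℝ V} {x y : V} :
    y ∈ orthoIn B W x ↔ y ∈ W ∧ B x y = 0 := by
  simp [orthoIn]

lemma finrank_orthoIn [FiniteDimensional ℝ V] {B : LinearMap.BilinForm ℝ V} {W : Submodule ℝ V}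
    {x : V} (hx : x ∈ W) (hxx : B x x ≠ 0) :
    Module.finrank ℝ (orthoIn B W x) + 1 = Module.finrank ℝ W := by
  have hne : B x ∘ₗ W.subtype ≠ 0 := by
    intro h0
    exact hxx (LinearMap.congr_fun h0 ⟨x, hx⟩)
  have h1 := Module.Dual.finrank_ker_add_one_of_ne_zero (f := B x ∘ₗ W.subtype) hne
  have h2 : orthoIn B W x = (LinearMap.ker (B x ∘ₗ W.subtype)).map W.subtype := by
    ext y
    rw [mem_orthoIn]
    constructor
    · rintro ⟨h, h'⟩
      exact ⟨⟨y, h⟩, h', rfl⟩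
    · rintro ⟨z, hz, rfl⟩
      exact ⟨z.2, hz⟩
  rw [h2, Submodule.finrank_map_subtype_eq]
  exact h1

lemma exists_smul_unit {B : LinearMap.BilinForm ℝ V} {x : V} (hx : 0 < B x x) :
    ∃ t : ℝ, t ≠ 0 ∧ B (t • x) (t • x) = 1 := by
  refine ⟨(Real.sqrt (B x x))⁻¹, ?_, ?_⟩
  · exact inv_ne_zero (Real.sqrt_pos.mpr hx).ne'
  · have h := Real.mul_self_sqrt hx.le
    have h0 := (Real.sqrt_pos.mpr hx).ne'
    simp only [map_smul, LinearMap.smul_apply, smul_eq_mul]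
    field_simp
    rw [sq, h]

/-- Commuting self-adjoint and skew operators on a positive definite space admit an adapted
orthonormal basis. -/
lemma exists_isNormalFrame [FiniteDimensional ℝ V] {B : LinearMap.BilinForm ℝ V}
    (hB : ∀ x y, B x y = B y x) {S A : V →ₗ[ℝ] V} (hS : ∀ x y, B (S x) y = B x (S y))
    (hA : ∀ x y, B (A x) y = - B x (A y)) (hSA : ∀ x, S (A x) = A (S x)) (n : ℕ) :
    ∀ W : Submodule ℝ V, Module.finrank ℝ W = n → (∀ x ∈ W, x ≠ 0 → 0 < B x x) →
      (∀ x ∈ W, S x ∈ W) → (∀ x ∈ W, A x ∈ W) →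
      ∃ (k s : ℕ) (a b : Fin k → ℝ) (c : Fin s → ℝ) (p q : Fin k → V) (r : Fin s → V),
        IsNormalFrame B S A a b c p q r ∧ (∀ i, 0 < b i) ∧ (∀ i, p i ∈ W) ∧ (∀ i, q i ∈ W) ∧
        (∀ i, r i ∈ W) ∧ 2 * k + s = n := by
  induction n using Nat.strong_induction_on with
  | _ n ih =>
  intro W hWn hpos hSW hAW
  rcases Nat.eq_zero_or_pos n with rfl | hn
  · refine ⟨0, 0, Fin.elim0, Fin.elim0, Fin.elim0, Fin.elim0, Fin.elim0, Fin.elim0, ?_, ?_⟩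
    · constructor <;> exact fun i => i.elim0
    · simp
  have hWne : W ≠ ⊥ := by
    rintro rfl
    simp at hWn
    omega
  obtain ⟨x₀, hx₀W, hx₀, α, hα⟩ := exists_eigenvector_of_posDef hB hWne hpos hSW hS
  -- A preserves this eigenspace of S, and A² is self-adjoint, so it has an eigenvector x there.
  -- Then x and A x span a block invariant under both operators.
  set E : Submodule ℝ V := W ⊓ LinearMap.ker (S - α • LinearMap.id) with hE
  have memE : ∀ y, y ∈ E ↔ y ∈ W ∧ S y = α • y := by
    intro y
    simp [hE, sub_eq_zero]
  have hEne : E ≠ ⊥ := fun h => hx₀ ((Submodule.eq_bot_iff _).mp h x₀ ((memE _).mpr ⟨hx₀W, hα⟩))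
  have hAE : ∀ y ∈ E, A y ∈ E := by
    intro y hy
    rw [memE] at hy ⊢
    exact ⟨hAW _ hy.1, by rw [hSA, hy.2, map_smul]⟩
  obtain ⟨x₁, hx₁E, hx₁, μ, hμ⟩ := exists_eigenvector_of_posDef (T := A ∘ₗ A) hB hEne
    (fun y hy => hpos y ((memE y).mp hy).1) (fun y hy => hAE _ (hAE _ hy))
    (fun y z => by simp only [LinearMap.comp_apply, hA]; ring)
  obtain ⟨t, ht, hunit⟩ := exists_smul_unit (hpos x₁ ((memE _).mp hx₁E).1 hx₁)
  set x := t • x₁ with hx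
  have hxE : x ∈ E := E.smul_mem _ hx₁E
  have hxW := ((memE _).mp hxE).1
  have hSx := ((memE _).mp hxE).2
  have hAAx : A (A x) = μ • x := by
    have : A (A x₁) = μ • x₁ := hμ
    rw [hx, map_smul, map_smul, this, smul_comm]
  have hxAx : B x (A x) = 0 := by
    have := hA x x
    rw [hB] at this
    linarith
  have hSx' : ∀ W', ∀ y ∈ orthoIn B W' x, B x (S y) = 0 := by
    intro W' y hy
    rw [mem_orthoIn] at hy
    rw [← hS, hSx]
    simp [hy.2]
  by_cases hAx : A x = 0
  · -- a one-dimensional block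
    obtain ⟨k, s, a, b, c, p, q, r, hF, hb, hp, hq, hr, hks⟩ := ih (n - 1) (by omega)
      (orthoIn B W x) (by have := finrank_orthoIn (B := B) hxW (by rw [hunit]; norm_num); omega)
      (fun y hy => hpos y (mem_orthoIn.mp hy).1)
      (fun y hy => mem_orthoIn.mpr ⟨hSW _ (mem_orthoIn.mp hy).1, hSx' _ _ hy⟩)
      (fun y hy => mem_orthoIn.mpr ⟨hAW _ (mem_orthoIn.mp hy).1, by
        have := hA x y
        rw [hAx] at this
        simpa using this.symm⟩)
    have hxp := fun i => (mem_orthoIn.mp (hp i)).2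
    have hxq := fun i => (mem_orthoIn.mp (hq i)).2
    have hxr := fun i => (mem_orthoIn.mp (hr i)).2
    refine ⟨k, s + 1, a, b, Fin.cons α c, p, q, Fin.cons x r, ?_, hb,
      fun i => (mem_orthoIn.mp (hp i)).1, fun i => (mem_orthoIn.mp (hq i)).1, ?_, by omega⟩
    · refine ⟨hF.pp, hF.qq, ?_, hF.pq, ?_, ?_, hF.Sp, hF.Sq, ?_, hF.Ap, hF.Aq, ?_⟩
      · intro i j
        refine Fin.cases ?_ (fun i => ?_) i <;> refine Fin.cases ?_ (fun j => ?_) j <;>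
          simp [hunit, hxr, hF.rr, hB _ x, Fin.succ_ne_zero, (Fin.succ_ne_zero _).symm]
      · intro i j
        refine Fin.cases ?_ (fun j => ?_) j <;> simp [hxp, hF.pr, hB _ x]
      · intro i j
        refine Fin.cases ?_ (fun j => ?_) j <;> simp [hxq, hF.qr, hB _ x]
      · intro j
        refine Fin.cases ?_ (fun j => ?_) j <;> simp [hSx, hF.Sr]
      · intro j
        refine Fin.cases ?_ (fun j => ?_) j <;> simp [hAx, hF.Ar]
    · intro j
      refine Fin.cases ?_ (fun j => ?_) j
      · simpa using hxW
      · simpa using (mem_orthoIn.mp (hr j)).1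
  · -- a two-dimensional block
    obtain ⟨u, hu, huu⟩ := exists_smul_unit (hpos _ (hAW _ hxW) hAx)
    obtain ⟨β, hβ, y, hy1, hxy, hAy⟩ : ∃ β : ℝ, 0 < β ∧ ∃ y, B y y = 1 ∧ A x = β • y ∧
        A y = -β • x := by
      -- The normalising factor is taken positive so that the rotation speed β = v⁻¹ is positive.
      have hv : ∃ v : ℝ, 0 < v ∧ B (v • A x) (v • A x) = 1 := by
        rcases lt_or_gt_of_ne hu with h | h
        · exact ⟨-u, by linarith, by simpa using huu⟩
        · exact ⟨u, h, huu⟩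
      obtain ⟨v, hv, hvv⟩ := hv
      refine ⟨v⁻¹, inv_pos.mpr hv, v • A x, hvv, ?_, ?_⟩
      · rw [smul_smul, inv_mul_cancel₀ hv.ne', one_smul]
      · have h1 : μ * (v * v) = -1 := by
          have h2 := hA x (A x)
          rw [hAAx] at h2
          simp only [map_smul, LinearMap.smul_apply, smul_eq_mul, hunit] at hvv h2
          rw [h2] at hvv
          linarith
        rw [map_smul, hAAx, smul_smul]
        congr 1
        field_simp
        linarith
    have hyW : y ∈ W := by
      have := W.smul_mem β⁻¹ (hAW _ hxW)
      rwa [hxy, smul_smul, inv_mul_cancel₀ hβ.ne', one_smul] at this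
    have hxy0 : B x y = 0 := by
      rw [hxy] at hxAx
      simpa [hβ.ne'] using hxAx
    have hSy : S y = α • y := by
      have h1 := hSA x
      rw [hxy, hSx, map_smul, map_smul, hxy, smul_comm] at h1
      exact smul_right_injective V hβ.ne' h1
    have hyO : y ∈ orthoIn B W x := mem_orthoIn.mpr ⟨hyW, hxy0⟩
    have hd1 := finrank_orthoIn (B := B) hxW (by rw [hunit]; norm_num)
    have hd2 := finrank_orthoIn (B := B) hyO (by rw [hy1]; norm_num)
    obtain ⟨k, s, a, b, c, p, q, r, hF, hb, hp, hq, hr, hks⟩ := ih (n - 2) (by omega)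
      (orthoIn B (orthoIn B W x) y)
      (by omega)
      (fun z hz => hpos z (mem_orthoIn.mp (mem_orthoIn.mp hz).1).1)
      (fun z hz => by
        have hz1 := mem_orthoIn.mp hz
        have hz2 := mem_orthoIn.mp hz1.1
        refine mem_orthoIn.mpr ⟨mem_orthoIn.mpr ⟨hSW _ hz2.1, hSx' _ _ hz1.1⟩, ?_⟩
        rw [← hS, hSy]
        simp [hz1.2])
      (fun z hz => by
        have hz1 := mem_orthoIn.mp hz
        have hz2 := mem_orthoIn.mp hz1.1
        have h1 := hA x z
        have h2 := hA y z
        rw [hxy] at h1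
        rw [hAy] at h2
        simp only [map_smul, LinearMap.smul_apply, hz1.2, hz2.2, smul_zero] at h1 h2
        exact mem_orthoIn.mpr ⟨mem_orthoIn.mpr ⟨hAW _ hz2.1, by linarith⟩, by linarith⟩)
    have hyp := fun i => (mem_orthoIn.mp (hp i)).2
    have hyq := fun i => (mem_orthoIn.mp (hq i)).2
    have hyr := fun i => (mem_orthoIn.mp (hr i)).2
    have hxp := fun i => (mem_orthoIn.mp (mem_orthoIn.mp (hp i)).1).2
    have hxq := fun i => (mem_orthoIn.mp (mem_orthoIn.mp (hq i)).1).2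
    have hxr := fun i => (mem_orthoIn.mp (mem_orthoIn.mp (hr i)).1).2
    refine ⟨k + 1, s, Fin.cons α a, Fin.cons β b, c, Fin.cons x p, Fin.cons y q, r, ?_, ?_, ?_, ?_,
      fun i => (mem_orthoIn.mp (mem_orthoIn.mp (hr i)).1).1, by omega⟩
    · constructor
      · intro i j
        refine Fin.cases ?_ (fun i => ?_) i <;> refine Fin.cases ?_ (fun j => ?_) j <;>
          simp [hunit, hxp, hF.pp, hB _ x, Fin.succ_ne_zero, (Fin.succ_ne_zero _).symm]
      · intro i j
        refine Fin.cases ?_ (fun i => ?_) i <;> refine Fin.cases ?_ (fun j => ?_) j <;>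
          simp [hy1, hyq, hF.qq, hB _ y, Fin.succ_ne_zero, (Fin.succ_ne_zero _).symm]
      · exact hF.rr
      · intro i j
        refine Fin.cases ?_ (fun i => ?_) i <;> refine Fin.cases ?_ (fun j => ?_) j <;>
          simp [hxy0, hxq, hyp, hF.pq, hB _ y]
      · intro i j
        refine Fin.cases ?_ (fun i => ?_) i <;> simp [hxr, hF.pr]
      · intro i j
        refine Fin.cases ?_ (fun i => ?_) i <;> simp [hyr, hF.qr]
      · intro i
        refine Fin.cases ?_ (fun i => ?_) i <;> simp [hSx, hF.Sp]
      · intro i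
        refine Fin.cases ?_ (fun i => ?_) i <;> simp [hSy, hF.Sq]
      · exact hF.Sr
      · intro i
        refine Fin.cases ?_ (fun i => ?_) i <;> simp [hxy, hF.Ap]
      · intro i
        refine Fin.cases ?_ (fun i => ?_) i <;> simp [hAy, hF.Aq]
      · exact hF.Ar
    · intro i
      refine Fin.cases ?_ (fun i => ?_) i <;> simp [hβ, hb]
    · intro i
      refine Fin.cases ?_ (fun i => ?_) i
      · simpa using hxW
      · simpa using (mem_orthoIn.mp (mem_orthoIn.mp (hp i)).1).1
    · intro i
      refine Fin.cases ?_ (fun i => ?_) i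
      · simpa using hyW
      · simpa using (mem_orthoIn.mp (mem_orthoIn.mp (hq i)).1).1

/-- A sorted version of `exists_isNormalFrame`. -/
lemma exists_isNormalFrame_sorted [FiniteDimensional ℝ V] {B : LinearMap.BilinForm ℝ V}
    (hB : ∀ x y, B x y = B y x) {S A : V →ₗ[ℝ] V} (hS : ∀ x y, B (S x) y = B x (S y))
    (hA : ∀ x y, B (A x) y = - B x (A y)) (hSA : ∀ x, S (A x) = A (S x)) (W : Submodule ℝ V)
    (hpos : ∀ x ∈ W, x ≠ 0 → 0 < B x x) (hSW : ∀ x ∈ W, S x ∈ W) (hAW : ∀ x ∈ W, A x ∈ W) :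
      ∃ (k s : ℕ) (a b : Fin k → ℝ) (c : Fin s → ℝ) (p q : Fin k → V) (r : Fin s → V),
        IsNormalFrame B S A a b c p q r ∧ IsPosDecreasing b ∧ Antitone c ∧ (∀ i, p i ∈ W) ∧
        (∀ i, q i ∈ W) ∧ (∀ i, r i ∈ W) ∧ 2 * k + s = Module.finrank ℝ W := by
  obtain ⟨k, s, a, b, c, p, q, r, hF, hb, hp, hq, hr, hks⟩ :=
    exists_isNormalFrame hB hS hA hSA _ W rfl hpos hSW hAW
  -- Sorting the negatives increasingly gives the decreasing order. The speeds b and the eigenvalues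
  -- c are sorted separately; a follows b.
  have hanti : ∀ {m : ℕ} (f : Fin m → ℝ), Antitone (f ∘ Tuple.sort (fun i => - f i)) := by
    intro m f i j hij
    have := Tuple.monotone_sort (fun i => - f i) hij
    simpa using this
  exact ⟨k, s, _, _, _, _, _, _, hF.reindex (Tuple.sort (fun i => - b i))
    (Tuple.sort (fun i => - c i)), ⟨hanti b, fun i => hb _⟩, hanti c, fun i => hp _, fun i => hq _,
    fun i => hr _, hks⟩

end Frames

/-! ### Minkowski spaces, null vectors and Lorentz families -/

section Minkowski

variable {V : Type*} [AddCommGroup V] [Module ℝ V]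

/-- The properties of a Lorentzian scalar product used below. -/
structure IsMinkowski (B : LinearMap.BilinForm ℝ V) : Prop where
  symm : ∀ x y, B x y = B y x
  exists_timelike : ∃ t, B t t < 0
  pos_of_ortho : ∀ t x, B t t < 0 → B t x = 0 → x ≠ 0 → 0 < B x x

lemma IsLorentzianForm.isMinkowski {B : LinearMap.BilinForm ℝ V} (h : IsLorentzianForm B) :
    IsMinkowski B := by
  obtain ⟨m, e, he⟩ := h
  have hB : ∀ x y, B x y = - e.repr x (Sum.inl 0) * e.repr y (Sum.inl 0)
      + ∑ i, e.repr x (Sum.inr i) * e.repr y (Sum.inr i) := by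
    intro x y
    conv_lhs => rw [← e.sum_repr x, ← e.sum_repr y]
    simp only [map_sum, LinearMap.sum_apply, map_smul, LinearMap.smul_apply, smul_eq_mul, he _ _]
    simp [mul_comm]
  refine ⟨fun x y => ?_, ⟨e (Sum.inl 0), ?_⟩, fun t x ht htx hx => ?_⟩
  · rw [hB, hB]
    rw [neg_mul, neg_mul, mul_comm (e.repr x _)]
    simp only [mul_comm]
  · rw [he]
    simp
  · rw [hB] at ht htx ⊢
    set t0 := e.repr t (Sum.inl 0)
    set x0 := e.repr x (Sum.inl 0)
    -- With P < t₀² and R = t₀x₀, Cauchy–Schwarz gives t₀²x₀² ≤ PQ < t₀²Q, hence x₀² < Q. If Q = 0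
    -- it gives x = 0 instead.
    have hCS := Finset.sum_mul_sq_le_sq_mul_sq Finset.univ (fun i => e.repr t (Sum.inr i))
      (fun i => e.repr x (Sum.inr i))
    simp only [sq] at hCS
    set P := ∑ i, e.repr t (Sum.inr i) * e.repr t (Sum.inr i) with hP
    set Q := ∑ i, e.repr x (Sum.inr i) * e.repr x (Sum.inr i) with hQ
    set R := ∑ i, e.repr t (Sum.inr i) * e.repr x (Sum.inr i) with hR
    have hP0 : 0 ≤ P := Finset.sum_nonneg fun i _ => mul_self_nonneg _
    have hQ0 : 0 ≤ Q := Finset.sum_nonneg fun i _ => mul_self_nonneg _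
    have ht0 : 0 < t0 * t0 := by linarith
    have hR' : R = t0 * x0 := by linarith
    rw [hR'] at hCS
    rcases hQ0.eq_or_lt with hq | hq
    · exfalso
      rw [← hq] at hCS
      have hx0 : x0 = 0 := by
        by_contra hne
        have : 0 < x0 * x0 := mul_self_pos.mpr hne
        nlinarith [mul_pos ht0 this]
      have hxi : ∀ i, e.repr x (Sum.inr i) = 0 := by
        intro i
        have := (Finset.sum_eq_zero_iff_of_nonneg (fun i _ => mul_self_nonneg _)).mp hq.symm i
          (Finset.mem_univ i)
        simpa using this
      apply hx
      apply e.ext_elem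
      rintro (i | i)
      · have : i = 0 := Subsingleton.elim _ _
        subst this
        simpa using hx0
      · simpa using hxi i
    · have h1 : P * Q < t0 * t0 * Q := mul_lt_mul_of_pos_right (by linarith) hq
      have h2 : t0 * t0 * (x0 * x0) < t0 * t0 * Q := by nlinarith
      have := lt_of_mul_lt_mul_left h2 ht0.le
      linarith

namespace IsMinkowski

variable {B : LinearMap.BilinForm ℝ V} (h : IsMinkowski B)

include h

lemma eq_zero_of_forall {x : V} (hx : ∀ y, B x y = 0) : x = 0 := by
  by_contra hne
  obtain ⟨t, ht⟩ := h.exists_timelike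
  have := h.pos_of_ortho t x ht (by rw [h.symm, hx]) hne
  rw [hx] at this
  exact lt_irrefl _ this

lemma timelike_null_ne_zero {t l : V} (ht : B t t < 0) (hl : l ≠ 0) (hll : B l l = 0) :
    B t l ≠ 0 := fun h0 => (h.pos_of_ortho t l ht h0 hl).ne' hll

/-- The orthogonal complement of a null vector is positive semi-definite, with kernel the line it
spans. -/
lemma null_ortho {l x : V} (hl : l ≠ 0) (hll : B l l = 0) (hlx : B l x = 0) :
    0 ≤ B x x ∧ (B x x = 0 → ∃ c : ℝ, x = c • l) := by
  obtain ⟨t, ht⟩ := h.exists_timelike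
  have htl := h.timelike_null_ne_zero ht hl hll
  -- Moving x along l to make it orthogonal to the timelike t does not change B(x, x).
  set y := x - (B t x / B t l) • l with hy
  have hty : B t y = 0 := by
    simp only [hy, map_sub, map_smul, smul_eq_mul]
    field_simp
    ring
  have hyy : B y y = B x x := by
    simp only [hy, map_sub, map_smul, LinearMap.sub_apply, LinearMap.smul_apply, smul_eq_mul, hll,
      hlx, h.symm x l]
    ring
  by_cases hy0 : y = 0
  · refine ⟨by rw [← hyy, hy0]; simp, fun _ => ⟨B t x / B t l, sub_eq_zero.mp hy0⟩⟩
  · have := h.pos_of_ortho t y ht hty hy0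
    rw [hyy] at this
    exact ⟨this.le, fun h0 => absurd h0 this.ne'⟩

/-- A multiple of a timelike vector has the prescribed product with l; adding a multiple of l makes
it null and keeps that product. -/
lemma exists_null_partner {l : V} (hl : l ≠ 0) (hll : B l l = 0) (c : ℝ) :
    ∃ k, B k k = 0 ∧ B l k = c := by
  obtain ⟨t, ht⟩ := h.exists_timelike
  have htl := h.timelike_null_ne_zero ht hl hll
  set α := c / B t l with hα
  refine ⟨α • t + (-(α * B t t) / (2 * B t l)) • l, ?_, ?_⟩
  · simp only [map_add, map_smul, LinearMap.add_apply, LinearMap.smul_apply, smul_eq_mul, hll,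
      h.symm l t]
    field_simp
    ring
  · simp only [map_add, map_smul, smul_eq_mul, hll, h.symm l t, hα]
    field_simp
    ring

end IsMinkowski

/-- `e` is orthonormal with `e 0` timelike and the other vectors spacelike. -/
def IsLorentzFamily (B : LinearMap.BilinForm ℝ V) {m : ℕ} (e : Fin (m + 1) → V) : Prop :=
  ∀ i j, B (e i) (e j) = if i = j then (if i = 0 then -1 else 1) else 0

/-- The orthogonal complement of a finite family. -/
def orthoFamily (B : LinearMap.BilinForm ℝ V) {m : ℕ} (e : Fin m → V) : Submodule ℝ V :=
  LinearMap.ker (LinearMap.pi fun i => B (e i))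

lemma mem_orthoFamily {B : LinearMap.BilinForm ℝ V} {m : ℕ} {e : Fin m → V} {x : V} :
    x ∈ orthoFamily B e ↔ ∀ i, B (e i) x = 0 := by
  simp [orthoFamily, funext_iff]

/-- The projection onto the orthogonal complement of a Lorentz family. -/
noncomputable def orthoProj (B : LinearMap.BilinForm ℝ V) {m : ℕ} (e : Fin (m + 1) → V) :
    V →ₗ[ℝ] V :=
  LinearMap.id - ∑ i, (if i = 0 then (-1 : ℝ) else 1) • (B (e i)).smulRight (e i)

lemma orthoProj_apply (B : LinearMap.BilinForm ℝ V) {m : ℕ} (e : Fin (m + 1) → V) (x : V) :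
    orthoProj B e x = x - ∑ i, ((if i = 0 then (-1 : ℝ) else 1) * B (e i) x) • e i := by
  simp only [orthoProj, LinearMap.sub_apply, LinearMap.id_apply, LinearMap.sum_apply,
    LinearMap.smul_apply, LinearMap.smulRight_apply, smul_smul]

lemma orthoProj_mem {B : LinearMap.BilinForm ℝ V} {m : ℕ} {e : Fin (m + 1) → V}
    (he : IsLorentzFamily B e) (x : V) : orthoProj B e x ∈ orthoFamily B e := by
  rw [mem_orthoFamily]
  intro i
  rw [orthoProj_apply, map_sub, map_sum]
  simp only [map_smul, smul_eq_mul, he i, mul_ite, mul_zero, Finset.sum_ite_eq, Finset.mem_univ,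
    if_true]
  split_ifs <;> ring

lemma orthoProj_of_mem {B : LinearMap.BilinForm ℝ V} {m : ℕ} {e : Fin (m + 1) → V} {x : V}
    (hx : x ∈ orthoFamily B e) : orthoProj B e x = x := by
  rw [mem_orthoFamily] at hx
  simp [orthoProj_apply, hx]

lemma orthoProj_symm {B : LinearMap.BilinForm ℝ V} (hB : ∀ x y, B x y = B y x) {m : ℕ}
    (e : Fin (m + 1) → V) (x y : V) : B (orthoProj B e x) y = B x (orthoProj B e y) := by
  simp only [orthoProj_apply, map_sub, LinearMap.sub_apply, map_sum, LinearMap.sum_apply, map_smul,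
    LinearMap.smul_apply, smul_eq_mul, hB x (e _)]
  congr 1
  exact Finset.sum_congr rfl fun i _ => by ring

lemma finrank_orthoFamily [FiniteDimensional ℝ V] {B : LinearMap.BilinForm ℝ V} {m : ℕ}
    {e : Fin (m + 1) → V} (he : IsLorentzFamily B e) :
    m + 1 + Module.finrank ℝ (orthoFamily B e) = Module.finrank ℝ V := by
  have hsurj : LinearMap.range (LinearMap.pi fun i => B (e i)) = ⊤ := by
    rw [LinearMap.range_eq_top]
    intro y
    refine ⟨∑ i, ((if i = 0 then (-1 : ℝ) else 1) * y i) • e i, ?_⟩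
    ext i
    simp only [LinearMap.pi_apply, map_sum, map_smul, smul_eq_mul, he i, mul_ite, mul_zero,
      Finset.sum_ite_eq, Finset.mem_univ, if_true]
    split_ifs <;> ring
  have := LinearMap.finrank_range_add_finrank_ker (LinearMap.pi fun i => B (e i))
  rw [hsurj, finrank_top, Module.finrank_fin_fun] at this
  exact this

lemma orthoFamily_pos {B : LinearMap.BilinForm ℝ V} (h : IsMinkowski B) {m : ℕ}
    {e : Fin (m + 1) → V} (he : IsLorentzFamily B e) :
    ∀ x ∈ orthoFamily B e, x ≠ 0 → 0 < B x x := fun x hx hx0 =>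
  h.pos_of_ortho (e 0) x (by rw [he]; simp) (mem_orthoFamily.mp hx 0) hx0

/-- The family underlying an adapted orthonormal system. -/
def frameVec {k s : ℕ} (p q : Fin k → V) (r : Fin s → V) : (Fin 2 × Fin k) ⊕ Fin s → V :=
  Sum.elim (fun x => if x.1 = 0 then p x.2 else q x.2) r

namespace IsNormalFrame

variable {B : LinearMap.BilinForm ℝ V} {S A : V →ₗ[ℝ] V} {k s : ℕ} {a b : Fin k → ℝ}
  {c : Fin s → ℝ} {p q : Fin k → V} {r : Fin s → V}

lemma ortho (hB : ∀ x y, B x y = B y x) (hF : IsNormalFrame B S A a b c p q r)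
    (x y : (Fin 2 × Fin k) ⊕ Fin s) :
    B (frameVec p q r x) (frameVec p q r y) = if x = y then 1 else 0 := by
  rcases x with ⟨i, x⟩ | x <;> rcases y with ⟨j, y⟩ | y
  · fin_cases i <;> fin_cases j <;> simp [frameVec, hF.pp, hF.qq, hF.pq, hB (q x) (p y)]
  · fin_cases i <;> simp [frameVec, hF.pr, hF.qr]
  · fin_cases j <;> simp [frameVec, hB (r x), hF.pr, hF.qr]
  · simp [frameVec, hF.rr]

lemma apply_frameVec (hF : IsNormalFrame B S A a b c p q r) (x : (Fin 2 × Fin k) ⊕ Fin s) :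
    S (frameVec p q r x) + A (frameVec p q r x)
      = ∑ y, diagL1 a b c y x • frameVec p q r y := by
  rcases x with ⟨i, x⟩ | x
  · fin_cases i <;> simp [frameVec, diagL1, diag2, Fintype.sum_prod_type, Fin.sum_univ_two,
      Matrix.blockDiagonal_apply, matL1, hF.Sp, hF.Sq, hF.Ap, hF.Aq, add_comm]
  · simp [frameVec, diagL1, diag2, Matrix.diagonal_apply, hF.Sr, hF.Ar]

/-- If the self-adjoint part vanishes, so do the corresponding parameters. -/
lemma eq_zero_of_left (hF : IsNormalFrame B (0 : V →ₗ[ℝ] V) A a b c p q r) : a = 0 ∧ c = 0 := by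
  constructor
  · funext i
    have h1 := hF.Sp i
    have h2 := hF.pp i i
    by_contra hne
    have : p i = 0 := (smul_eq_zero.mp h1.symm).resolve_left hne
    simp [this] at h2
  · funext i
    have h1 := hF.Sr i
    have h2 := hF.rr i i
    by_contra hne
    have : r i = 0 := (smul_eq_zero.mp h1.symm).resolve_left hne
    simp [this] at h2

end IsNormalFrame

section Complement

variable [FiniteDimensional ℝ V] {B : LinearMap.BilinForm ℝ V} {m : ℕ} {e : Fin (m + 1) → V}

omit [FiniteDimensional ℝ V] in
lemma lorentzFamily_frame_ortho (hB : ∀ x y, B x y = B y x) (he : IsLorentzFamily B e)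
    {κ : Type*} [DecidableEq κ] {w : κ → V}
    (hw : ∀ x y, B (w x) (w y) = if x = y then 1 else 0)
    (hew : ∀ i x, B (e i) (w x) = 0) (x y : Fin (m + 1) ⊕ κ) :
    B (Sum.elim e w x) (Sum.elim e w y) = if x = y then lorentzSigns m κ x else 0 := by
  rcases x with x | x <;> rcases y with y | y
  · simp [lorentzSigns, he x]
  · simp [lorentzSigns, hew]
  · simp [lorentzSigns, hew, hB (w x) (e _)]
  · simp [lorentzSigns, hw]

lemma lorentzSigns_ne_zero {κ : Type*} (x : Fin (m + 1) ⊕ κ) : lorentzSigns m κ x ≠ 0 := by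
  rcases x with x | x
  · simp only [lorentzSigns, Sum.elim_inl]
    split_ifs <;> norm_num
  · simp [lorentzSigns]

lemma lorentzSigns_mul_self {κ : Type*} (x : Fin (m + 1) ⊕ κ) :
    lorentzSigns m κ x * lorentzSigns m κ x = 1 := by
  rcases x with x | x
  · simp only [lorentzSigns, Sum.elim_inl]
    split_ifs <;> norm_num
  · simp [lorentzSigns]

/-- A matrix representation in a basis consisting of a Lorentz family and an orthonormal basis of
its complement. -/
lemma hasMatrix_fromBlocks (hB : ∀ x y, B x y = B y x) (he : IsLorentzFamily B e)
    {κ : Type*} [Fintype κ] [DecidableEq κ] {w : κ → V}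
    (hw : ∀ x y, B (w x) (w y) = if x = y then 1 else 0)
    (hew : ∀ i x, B (e i) (w x) = 0) (hcard : m + 1 + Fintype.card κ = Module.finrank ℝ V)
    {f : V →ₗ[ℝ] V} {M₁₁ : Matrix (Fin (m + 1)) (Fin (m + 1)) ℝ} {M₁₂ : Matrix (Fin (m + 1)) κ ℝ}
    {M₂₁ : Matrix κ (Fin (m + 1)) ℝ} {M₂₂ : Matrix κ κ ℝ}
    (h₁ : ∀ j, f (e j) = ∑ i, M₁₁ i j • e i + ∑ x, M₂₁ x j • w x)
    (h₂ : ∀ y, f (w y) = ∑ i, M₁₂ i y • e i + ∑ x, M₂₂ x y • w x) :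
    HasMatrix B f (lorentzSigns m κ) (Matrix.fromBlocks M₁₁ M₁₂ M₂₁ M₂₂) := by
  refine hasMatrix_of_family (Sum.elim e w) (lorentzFamily_frame_ortho hB he hw hew)
    lorentzSigns_ne_zero (by simpa using hcard) ?_
  rintro (j | j)
  · simp [h₁]
  · simp [h₂]

/-- Expansion of a vector in a pseudo-orthonormal basis. -/
lemma sum_of_ortho {ι : Type*} [Fintype ι] [DecidableEq ι] {sgn : ι → ℝ} {e : ι → V}
    (he : ∀ i j, B (e i) (e j) = if i = j then sgn i else 0) (hsgn : ∀ i, sgn i * sgn i = 1)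
    (hcard : Fintype.card ι = Module.finrank ℝ V) (x : V) :
    x = ∑ i, (sgn i * B (e i) x) • e i := by
  have hne : ∀ i, sgn i ≠ 0 := fun i h0 => by simpa [h0] using hsgn i
  obtain ⟨b, hb, -⟩ := hasMatrix_of_family (f := (0 : V →ₗ[ℝ] V)) (M := 0) e he hne hcard
    (by simp)
  have hli : LinearIndependent ℝ e := by
    apply LinearMap.BilinForm.linearIndependent_of_iIsOrtho (B := B)
    · intro i j hij
      change B (e i) (e j) = 0
      rw [he, if_neg hij]
    · intro i hi
      apply hne i
      have := he i i
      rw [if_pos rfl] at this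
      rw [← this]
      exact hi
  have hspan := hli.span_eq_top_of_card_eq_finrank' hcard
  have hx : x ∈ Submodule.span ℝ (Set.range e) := by rw [hspan]; trivial
  obtain ⟨c, rfl⟩ := (Submodule.mem_span_range_iff_exists_fun ℝ).mp hx
  refine Finset.sum_congr rfl fun i _ => ?_
  congr 1
  simp only [map_sum, map_smul, he i, smul_eq_mul, mul_ite, mul_zero, Finset.sum_ite_eq,
    Finset.mem_univ, if_true]
  linear_combination (- c i) * hsgn i

lemma trace_eq_sum_of_ortho {ι : Type*} [Fintype ι] [DecidableEq ι] {sgn : ι → ℝ} {e : ι → V}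
    (he : ∀ i j, B (e i) (e j) = if i = j then sgn i else 0) (hsgn : ∀ i, sgn i * sgn i = 1)
    (hcard : Fintype.card ι = Module.finrank ℝ V) (T : V →ₗ[ℝ] V) :
    LinearMap.trace ℝ V T = ∑ i, sgn i * B (e i) (T (e i)) := by
  have hne : ∀ i, sgn i ≠ 0 := fun i h0 => by simpa [h0] using hsgn i
  have : T = ∑ i, (sgn i • B (e i)).smulRight (T (e i)) := by
    refine LinearMap.ext fun x => ?_
    conv_lhs => rw [sum_of_ortho he hsgn hcard x]
    simp [LinearMap.sum_apply]
  conv_lhs => rw [this]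
  rw [map_sum]
  refine Finset.sum_congr rfl fun i _ => ?_
  rw [LinearMap.trace_smulRight]
  simp

/-- An adapted orthonormal basis of the complement of a Lorentz family. -/
lemma exists_frame_complement (h : IsMinkowski B) (he : IsLorentzFamily B e) {S R : V →ₗ[ℝ] V}
    (hS : ∀ x y, B (S x) y = B x (S y)) (hR : ∀ x y, B (R x) y = - B x (R y))
    (hSR : ∀ x, S (R x) = R (S x))
    (hSW : ∀ x ∈ orthoFamily B e, S x ∈ orthoFamily B e)
    (hRW : ∀ x ∈ orthoFamily B e, R x ∈ orthoFamily B e) :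
    ∃ (k s : ℕ) (a b : Fin k → ℝ) (c : Fin s → ℝ) (p q : Fin k → V) (r : Fin s → V),
      IsNormalFrame B S R a b c p q r ∧ IsPosDecreasing b ∧ Antitone c ∧
      (∀ i x, B (e i) (frameVec p q r x) = 0) ∧
      m + 1 + (2 * k + s) = Module.finrank ℝ V ∧
      m + 1 + Fintype.card ((Fin 2 × Fin k) ⊕ Fin s) = Module.finrank ℝ V := by
  obtain ⟨k, s, a, b, c, p, q, r, hF, hb, hc, hp, hq, hr, hks⟩ :=
    exists_isNormalFrame_sorted h.symm hS hR hSR _ (orthoFamily_pos h he) hSW hRW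
  have hd := finrank_orthoFamily he
  refine ⟨k, s, a, b, c, p, q, r, hF, hb, hc, fun i x => ?_, by omega, by simp; omega⟩
  rcases x with ⟨j, x⟩ | x
  · fin_cases j
    · exact mem_orthoFamily.mp (hp x) i
    · exact mem_orthoFamily.mp (hq x) i
  · exact mem_orthoFamily.mp (hr x) i

end Complement

end Minkowski

/-! ### Causal eigenvectors and invariant planes -/

section RealEigen

variable {V : Type*} [AddCommGroup V] [Module ℝ V]

/-- A real operator has a real eigenvector or an invariant plane on which it acts as a complex
number. -/
lemma exists_eigenvector_or_plane [FiniteDimensional ℝ V] (T : V →ₗ[ℝ] V) {W : Submodule ℝ V}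
    (hW : W ≠ ⊥) (hT : ∀ x ∈ W, T x ∈ W) :
    (∃ x ∈ W, x ≠ 0 ∧ ∃ μ : ℝ, T x = μ • x) ∨
      ∃ x ∈ W, ∃ y ∈ W, x ≠ 0 ∧ ∃ α β : ℝ, β ≠ 0 ∧ T x = α • x + β • y ∧ T y = α • y - β • x := by
  have hnt : Nontrivial W := Submodule.nontrivial_iff_ne_bot.mpr hW
  set n := Module.finrank ℝ W with hn
  have hn0 : 0 < n := Module.finrank_pos
  let b := Module.finBasis ℝ W
  set M := LinearMap.toMatrix b b (T.restrict hT) with hM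
  have hne : Nonempty (Fin n) := ⟨⟨0, hn0⟩⟩
  -- Below, x and y are the real and imaginary parts of a complex eigenvector, T(x + iy) = μ(x +
  -- iy), which is why β = −Im μ.
  obtain ⟨μ, hμ⟩ := Module.End.exists_eigenvalue (Matrix.toLin' (M.map Complex.ofReal))
  obtain ⟨z, hz⟩ := hμ.exists_hasEigenvector
  have hz1 := hz.apply_eq_smul
  rw [Matrix.toLin'_apply] at hz1
  have hTv : ∀ u : Fin n → ℝ, T ((∑ j, u j • b j : W) : V) = ((∑ i, (M.mulVec u) i • b i : W) : V) := by
    intro u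
    have h1 : T.restrict hT (∑ j, u j • b j) = ∑ i, (M.mulVec u) i • b i := by
      have h2 : M.mulVec (b.repr (∑ j, u j • b j)) = b.repr (T.restrict hT (∑ j, u j • b j)) :=
        LinearMap.toMatrix_mulVec_repr b b (T.restrict hT) _
      have h3 : ⇑(b.repr (∑ j, u j • b j)) = u := b.repr_sum_self u
      rw [h3] at h2
      rw [h2]
      exact (b.sum_repr _).symm
    exact congrArg Subtype.val h1
  have hre : M.mulVec (fun i => (z i).re)
      = fun i => μ.re * (z i).re - μ.im * (z i).im := by
    funext i
    have := congrArg Complex.re (congrFun hz1 i)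
    simpa [Matrix.mulVec, dotProduct] using this
  have him : M.mulVec (fun i => (z i).im)
      = fun i => μ.re * (z i).im + μ.im * (z i).re := by
    funext i
    have := congrArg Complex.im (congrFun hz1 i)
    simpa [Matrix.mulVec, dotProduct] using this
  set x : W := ∑ j, (z j).re • b j with hx
  set y : W := ∑ j, (z j).im • b j with hy
  have hTx : T (x : V) = μ.re • (x : V) - μ.im • (y : V) := by
    have := hTv fun i => (z i).re
    rw [hre] at this
    rw [hx, this, ← hx]
    have h2 : ∑ i, (μ.re * (z i).re - μ.im * (z i).im) • b i = μ.re • x - μ.im • y := by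
      simp only [sub_smul, Finset.sum_sub_distrib, mul_smul, hx, hy, Finset.smul_sum]
    rw [h2]
    rfl
  have hTy : T (y : V) = μ.re • (y : V) + μ.im • (x : V) := by
    have := hTv fun i => (z i).im
    rw [him] at this
    rw [hy, this, ← hy]
    have h2 : ∑ i, (μ.re * (z i).im + μ.im * (z i).re) • b i = μ.re • y + μ.im • x := by
      simp only [add_smul, Finset.sum_add_distrib, mul_smul, hx, hy, Finset.smul_sum]
    rw [h2]
    rfl
  have hxy : ¬ ((x : V) = 0 ∧ (y : V) = 0) := by
    rintro ⟨h1, h2⟩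
    apply hz.2
    have h1' : x = 0 := Subtype.ext h1
    have h2' : y = 0 := Subtype.ext h2
    have h3 : (fun i => (z i).re) = 0 := by
      have := b.repr_sum_self fun i => (z i).re
      rw [← hx, h1'] at this
      simpa using this.symm
    have h4 : (fun i => (z i).im) = 0 := by
      have := b.repr_sum_self fun i => (z i).im
      rw [← hy, h2'] at this
      simpa using this.symm
    funext i
    exact Complex.ext (congrFun h3 i) (congrFun h4 i)
  by_cases him0 : μ.im = 0
  · left
    rw [him0, zero_smul] at hTx hTy
    by_cases hx0 : (x : V) = 0
    · refine ⟨y, y.2, fun h => hxy ⟨hx0, h⟩, μ.re, by simpa using hTy⟩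
    · exact ⟨x, x.2, hx0, μ.re, by simpa using hTx⟩
  · right
    refine ⟨x, x.2, y, y.2, ?_, μ.re, -μ.im, neg_ne_zero.mpr him0, ?_, ?_⟩
    · intro hx0
      rw [hx0] at hTx
      simp only [map_zero, smul_zero, zero_sub, zero_eq_neg, smul_eq_zero, him0, false_or] at hTx
      exact hxy ⟨hx0, hTx⟩
    · rw [hTx]; module
    · rw [hTy]; module

variable {B : LinearMap.BilinForm ℝ V}

/-- Removing the component along a spacelike x lowers B(t, t) by B(x, t)²/B(x, x). -/
lemma exists_timelike_orthoIn (hB : ∀ x y, B x y = B y x) {W : Submodule ℝ V} {x t : V}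
    (hx : x ∈ W) (hxx : 0 < B x x) (ht : t ∈ W) (htt : B t t < 0) :
    ∃ u ∈ orthoIn B W x, B u u < 0 := by
  refine ⟨t - (B x t / B x x) • x,
    mem_orthoIn.mpr ⟨W.sub_mem ht (W.smul_mem _ hx), ?_⟩, ?_⟩
  · simp only [map_sub, map_smul, smul_eq_mul]
    field_simp
    ring
  · have : B (t - (B x t / B x x) • x) (t - (B x t / B x x) • x)
        = B t t - B x t * B x t / B x x := by
      simp only [map_sub, map_smul, LinearMap.sub_apply, LinearMap.smul_apply, smul_eq_mul, hB t x]
      field_simp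
      ring
    rw [this]
    have := div_nonneg (mul_self_nonneg (B x t)) hxx.le
    linarith

namespace IsMinkowski

variable [FiniteDimensional ℝ V] (h : IsMinkowski B)

include h

/-- Spacelike eigenvectors are split off one by one. The complement stays invariant and keeps a
timelike vector, so the descent stops only at a causal eigenvector or at a plane. -/
lemma exists_eigenvector_or_plane_of_selfAdjoint {S : V →ₗ[ℝ] V}
    (hS : ∀ x y, B (S x) y = B x (S y)) (n : ℕ) :
    ∀ W : Submodule ℝ V, Module.finrank ℝ W = n → (∃ t ∈ W, B t t < 0) → (∀ x ∈ W, S x ∈ W) →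
      (∃ x, x ≠ 0 ∧ B x x ≤ 0 ∧ ∃ μ : ℝ, S x = μ • x) ∨
      ∃ x y, x ≠ 0 ∧ ∃ α β : ℝ, β ≠ 0 ∧ S x = α • x + β • y ∧ S y = α • y - β • x := by
  induction n using Nat.strong_induction_on with
  | _ n ih =>
  rintro W hWn ⟨t, htW, ht⟩ hSW
  have hW : W ≠ ⊥ := by
    rintro rfl
    rw [Submodule.mem_bot] at htW
    simp [htW] at ht
  rcases exists_eigenvector_or_plane S hW hSW with ⟨x, hxW, hx, μ, hμ⟩ |
    ⟨x, -, y, -, hx, α, β, hβ, h1, h2⟩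
  · by_cases hxx : B x x ≤ 0
    · exact Or.inl ⟨x, hx, hxx, μ, hμ⟩
    · push Not at hxx
      have hd := finrank_orthoIn hxW hxx.ne'
      refine ih _ (by omega) (orthoIn B W x) rfl (exists_timelike_orthoIn h.symm hxW hxx htW ht) ?_
      intro y hy
      rw [mem_orthoIn] at hy ⊢
      refine ⟨hSW _ hy.1, ?_⟩
      rw [← hS, hμ]
      simp [hy.2]
  · exact Or.inr ⟨x, y, hx, α, β, hβ, h1, h2⟩

/-- For skew operators planes do not stop the descent. Skewness makes x and y orthogonal of equal
square, which cannot be negative in Lorentzian signature. If it is zero, y is a multiple of x and x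
is an eigenvector; if it is positive, the plane is split off. -/
lemma exists_eigenvector_of_skewAdjoint {A : V →ₗ[ℝ] V}
    (hA : ∀ x y, B (A x) y = - B x (A y)) (n : ℕ) :
    ∀ W : Submodule ℝ V, Module.finrank ℝ W = n → (∃ t ∈ W, B t t < 0) → (∀ x ∈ W, A x ∈ W) →
      ∃ x, x ≠ 0 ∧ B x x ≤ 0 ∧ ∃ μ : ℝ, A x = μ • x := by
  induction n using Nat.strong_induction_on with
  | _ n ih =>
  rintro W hWn ⟨t, htW, ht⟩ hAW
  have hW : W ≠ ⊥ := by
    rintro rfl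
    rw [Submodule.mem_bot] at htW
    simp [htW] at ht
  have hself : ∀ x, B (A x) x = 0 := by
    intro x
    have := hA x x
    rw [h.symm x] at this
    linarith
  rcases exists_eigenvector_or_plane A hW hAW with ⟨x, hxW, hx, μ, hμ⟩ |
    ⟨x, hxW, y, hyW, hx, α, β, hβ, h1, h2⟩
  · by_cases hxx : B x x ≤ 0
    · exact ⟨x, hx, hxx, μ, hμ⟩
    · push Not at hxx
      have hAx : A x = 0 := by
        have := hself x
        rw [hμ] at this
        simp only [map_smul, LinearMap.smul_apply, smul_eq_mul, mul_eq_zero, hxx.ne', or_false]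
          at this
        rw [hμ, this, zero_smul]
      have hd := finrank_orthoIn hxW hxx.ne'
      refine ih _ (by omega) (orthoIn B W x) rfl (exists_timelike_orthoIn h.symm hxW hxx htW ht) ?_
      intro y hy
      rw [mem_orthoIn] at hy ⊢
      refine ⟨hAW _ hy.1, ?_⟩
      have := hA x y
      rw [hAx] at this
      simpa using this.symm
  · have e1 := hself x
    have e2 := hself y
    have e3 := hA x y
    rw [h1] at e1
    rw [h2] at e2
    rw [h1, h2] at e3
    simp only [map_add, map_sub, map_smul, LinearMap.add_apply, LinearMap.sub_apply,
      LinearMap.smul_apply, smul_eq_mul, h.symm y x] at e1 e2 e3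
    have hq : B x y = 0 := by
      have k1 : (α * α + β * β) * B x y = 0 := by
        linear_combination (α / 2) * e3 + (β / 2) * (e1 - e2)
      have k2 : 0 < α * α + β * β := by nlinarith [mul_self_nonneg α, mul_self_pos.mpr hβ]
      exact (mul_eq_zero.mp k1).resolve_left k2.ne'
    have hpp : B x x = B y y := by
      have : β * (B x x - B y y) = 0 := by rw [hq] at e3; linarith
      have := (mul_eq_zero.mp this).resolve_left hβ
      linarith
    rcases lt_trichotomy (B x x) 0 with hneg | hzero | hpos
    · exfalso
      have hy0 : y ≠ 0 := by
        rintro rfl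
        simp at hpp
        linarith
      have := h.pos_of_ortho x y hneg hq hy0
      linarith
    · obtain ⟨c, rfl⟩ := (h.null_ortho hx hzero hq).2 (by linarith)
      refine ⟨x, hx, hzero.le, α + β * c, ?_⟩
      rw [h1]
      module
    · have hα : α = 0 := by
        rw [hq] at e1
        have : α * B x x = 0 := by linarith
        exact (mul_eq_zero.mp this).resolve_right hpos.ne'
      subst hα
      simp only [zero_smul, zero_add, zero_sub] at h1 h2
      have hyO : y ∈ orthoIn B W x := mem_orthoIn.mpr ⟨hyW, hq⟩
      have hd1 := finrank_orthoIn hxW hpos.ne'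
      have hd2 := finrank_orthoIn hyO (by rw [← hpp]; exact hpos.ne')
      obtain ⟨u, huW, hu⟩ := exists_timelike_orthoIn h.symm hxW hpos htW ht
      refine ih _ (by omega) (orthoIn B (orthoIn B W x) y) rfl
        (exists_timelike_orthoIn h.symm hyO (by rw [← hpp]; exact hpos) huW hu) ?_
      intro z hz
      have hz1 := mem_orthoIn.mp hz
      have hz2 := mem_orthoIn.mp hz1.1
      have k1 := hA x z
      have k2 := hA y z
      rw [h1] at k1
      rw [h2] at k2
      simp only [map_smul, map_neg, LinearMap.neg_apply, LinearMap.smul_apply, hz1.2, hz2.2,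
        smul_zero, neg_zero] at k1 k2
      exact mem_orthoIn.mpr ⟨mem_orthoIn.mpr ⟨hAW _ hz2.1, by linarith⟩, by linarith⟩

end IsMinkowski

end RealEigen

/-! ### Self-adjoint part with non-real eigenvalues -/

section SelfAdjoint

variable {V : Type*} [AddCommGroup V] [Module ℝ V] [FiniteDimensional ℝ V]
  {B : LinearMap.BilinForm ℝ V} {S A : V →ₗ[ℝ] V}

/-- The trace of the square of a self-adjoint operator in terms of a Lorentz family and an
orthonormal basis of its complement. -/
lemma trace_sq_eq_sum (hB : ∀ x y, B x y = B y x) (hS : ∀ x y, B (S x) y = B x (S y)) {m : ℕ}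
    {e : Fin (m + 1) → V} (he : IsLorentzFamily B e) {κ : Type*} [Fintype κ] [DecidableEq κ]
    {w : κ → V} (hw : ∀ x y, B (w x) (w y) = if x = y then 1 else 0)
    (hew : ∀ i x, B (e i) (w x) = 0) (hcard : m + 1 + Fintype.card κ = Module.finrank ℝ V) :
    LinearMap.trace ℝ V (S ∘ₗ S) = ∑ i, (if i = 0 then (-1 : ℝ) else 1) * B (S (e i)) (S (e i))
      + ∑ x, B (S (w x)) (S (w x)) := by
  rw [trace_eq_sum_of_ortho (lorentzFamily_frame_ortho hB he hw hew) lorentzSigns_mul_self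
    (by simpa using hcard), Fintype.sum_sum_type]
  simp only [Sum.elim_inl, Sum.elim_inr, LinearMap.comp_apply, ← hS, lorentzSigns, one_mul]

lemma eq_of_basis_of_ortho (hB : ∀ x y, B x y = B y x) {m : ℕ}
    {e : Fin (m + 1) → V} (he : IsLorentzFamily B e) {κ : Type*} [Fintype κ] [DecidableEq κ]
    {w : κ → V} (hw : ∀ x y, B (w x) (w y) = if x = y then 1 else 0)
    (hew : ∀ i x, B (e i) (w x) = 0) (hcard : m + 1 + Fintype.card κ = Module.finrank ℝ V)
    {T T' : V →ₗ[ℝ] V} (h1 : ∀ i, T (e i) = T' (e i)) (h2 : ∀ x, T (w x) = T' (w x)) : T = T' := by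
  refine LinearMap.ext fun v => ?_
  rw [sum_of_ortho (lorentzFamily_frame_ortho hB he hw hew) lorentzSigns_mul_self
    (by simpa using hcard) v, map_sum, map_sum]
  refine Finset.sum_congr rfl fun i _ => ?_
  rcases i with i | i <;> simp [h1, h2]

omit [FiniteDimensional ℝ V] in
lemma isLorentzFamily_pair {x y : V} (hB : ∀ x y, B x y = B y x) (hxx : B x x = -1)
    (hyy : B y y = 1) (hxy : B x y = 0) : IsLorentzFamily B ![x, y] := by
  intro i j
  fin_cases i <;> fin_cases j <;> simp [hxx, hyy, hxy, hB y x]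

omit [FiniteDimensional ℝ V] in
lemma isLorentzFamily_triple {x y z : V} (hB : ∀ x y, B x y = B y x) (hxx : B x x = -1)
    (hyy : B y y = 1) (hzz : B z z = 1) (hxy : B x y = 0) (hxz : B x z = 0) (hyz : B y z = 0) :
    IsLorentzFamily B ![x, y, z] := by
  intro i j
  fin_cases i <;> fin_cases j <;> simp [hxx, hyy, hzz, hxy, hxz, hyz, hB y x, hB z x, hB z y]

omit [FiniteDimensional ℝ V] in
lemma orthoProj_pair (x y z : V) :
    orthoProj B ![x, y] z = z + B x z • x - B y z • y := by
  rw [orthoProj_apply, Fin.sum_univ_two]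
  simp
  module

/-- The operator in the complex-eigenvalue case. -/
lemma formIV_of_plane (h : IsMinkowski B) (hS : ∀ x y, B (S x) y = B x (S y))
    (hA : ∀ x y, B (A x) y = - B x (A y)) (hSA : ∀ x, S (A x) = A (S x))
    (htr : LinearMap.trace ℝ V (S ∘ₗ S) = 0) {x y : V} (hx : x ≠ 0) {α β : ℝ} (hβ : β ≠ 0)
    (hSx : S x = α • x + β • y) (hSy : S y = α • y - β • x) : FormIV B (S + A) := by
  -- normalise the pair
  obtain ⟨x, y, β, hβ, hxx, hyy, hxy, hSx, hSy⟩ : ∃ x y : V, ∃ β : ℝ, 0 < β ∧ B x x = -1 ∧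
      B y y = 1 ∧ B x y = 0 ∧ S x = α • x + β • y ∧ S y = α • y - β • x := by
    have hyy : B y y = - B x x := by
      have := hS x y
      rw [hSx, hSy] at this
      simp only [map_add, map_sub, map_smul, LinearMap.add_apply, LinearMap.smul_apply,
        smul_eq_mul] at this
      have : β * (B y y + B x x) = 0 := by linarith
      have := (mul_eq_zero.mp this).resolve_left hβ
      linarith
    -- S acts on x + iy as a complex scalar, so x + iy may be multiplied by any complex c, which
    -- multiplies z = B(x, x) + iB(x, y) by c². The choice c²z = −1 makes the pair orthonormal. If z
    -- were zero, y would be a real multiple of x whose factor squares to −1.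
    have hne : (⟨B x x, B x y⟩ : ℂ) ≠ 0 := by
      intro h0
      have h1 : B x x = 0 := congrArg Complex.re h0
      have h2 : B x y = 0 := congrArg Complex.im h0
      obtain ⟨c, rfl⟩ := (h.null_ortho hx h1 h2).2 (by rw [hyy, h1, neg_zero])
      rw [map_smul, hSx] at hSy
      have h3 : (β * (c * c + 1)) • x = 0 := by
        linear_combination (norm := module) hSy
      have h4 := (smul_eq_zero.mp h3).resolve_right hx
      have h5 := (mul_eq_zero.mp h4).resolve_left hβ
      nlinarith [mul_self_nonneg c]
    obtain ⟨c, hc⟩ := IsAlgClosed.exists_pow_nat_eq (-1 / (⟨B x x, B x y⟩ : ℂ)) two_pos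
    rw [eq_div_iff hne] at hc
    have hre := congrArg Complex.re hc
    have him := congrArg Complex.im hc
    simp only [sq, Complex.mul_re, Complex.mul_im, Complex.neg_re, Complex.neg_im, Complex.one_re,
      Complex.one_im] at hre him
    set u := c.re • x - c.im • y with hu
    set v := c.im • x + c.re • y with hv
    have huu : B u u = -1 := by
      simp only [hu, map_sub, map_smul, LinearMap.sub_apply, LinearMap.smul_apply, smul_eq_mul,
        h.symm y x, hyy]
      linear_combination hre
    have hvv : B v v = 1 := by
      simp only [hv, map_add, map_smul, LinearMap.add_apply, LinearMap.smul_apply, smul_eq_mul,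
        h.symm y x, hyy]
      linear_combination - hre
    have huv : B u v = 0 := by
      simp only [hu, hv, map_add, map_sub, map_smul, LinearMap.sub_apply, LinearMap.add_apply,
        LinearMap.smul_apply, smul_eq_mul, h.symm y x, hyy]
      linear_combination him
    have hSu : S u = α • u + β • v := by
      simp only [hu, hv, map_sub, map_smul, hSx, hSy]
      module
    have hSv : S v = α • v - β • u := by
      simp only [hu, hv, map_add, map_smul, hSx, hSy]
      module
    rcases lt_or_gt_of_ne hβ with hneg | hpos
    · refine ⟨u, -v, -β, by linarith, huu, by simpa using hvv, by simpa using huv, ?_, ?_⟩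
      · rw [hSu]; module
      · rw [map_neg, hSv]; module
    · exact ⟨u, v, β, hpos, huu, hvv, huv, hSu, hSv⟩
  have he := isLorentzFamily_pair h.symm hxx hyy hxy
  have hPS : ∀ z, orthoProj B ![x, y] (S z) = S (orthoProj B ![x, y] z) := by
    intro z
    rw [orthoProj_pair, orthoProj_pair, ← hS, ← hS, hSx, hSy]
    simp only [map_add, map_sub, map_smul, LinearMap.add_apply, LinearMap.sub_apply,
      LinearMap.smul_apply, smul_eq_mul, hSx, hSy]
    module
  have hself : ∀ z, B z (A z) = 0 := by
    intro z
    have := hA z z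
    rw [h.symm (A z)] at this
    linarith
  -- The components u, v of A x, A y orthogonal to the plane again satisfy Su = αu + βv and Sv = αv
  -- − βu. Self-adjointness then gives B(u, u) + B(v, v) = 0 on a positive definite space.
  have hPA : orthoProj B ![x, y] (A x) = 0 ∧ orthoProj B ![x, y] (A y) = 0 := by
    have hu := orthoProj_mem he (A x)
    have hv := orthoProj_mem he (A y)
    have hSu := hPS (A x)
    have hSv := hPS (A y)
    rw [hSA, hSx] at hSu
    rw [hSA, hSy] at hSv
    simp only [map_add, map_sub, map_smul] at hSu hSv
    set u := orthoProj B ![x, y] (A x)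
    set v := orthoProj B ![x, y] (A y)
    have h1 := hS u v
    rw [← hSu, ← hSv] at h1
    simp only [map_add, map_sub, map_smul, LinearMap.add_apply, LinearMap.smul_apply,
      smul_eq_mul] at h1
    have h2 : β * (B v v + B u u) = 0 := by linarith
    have h3 := (mul_eq_zero.mp h2).resolve_left hβ.ne'
    have hpos := orthoFamily_pos h he
    have hnn : ∀ z ∈ orthoFamily B ![x, y], 0 ≤ B z z := by
      intro z hz
      by_cases hz0 : z = 0
      · simp [hz0]
      · exact (hpos z hz hz0).le
    constructor
    · by_contra hne
      linarith [hpos u hu hne, hnn v hv]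
    · by_contra hne
      linarith [hpos v hv hne, hnn u hu]
  obtain ⟨hAx, hAy⟩ := hPA
  rw [orthoProj_pair, hself, zero_smul, add_zero, sub_eq_zero] at hAx
  rw [orthoProj_pair, hself, zero_smul, sub_zero] at hAy
  -- What remains of A on the plane is a boost, and a non-zero boost does not commute with S there
  -- because β ≠ 0.
  have hρ : B y (A x) = 0 := by
    have h1 := hSA x
    have h2 : B x (A y) = - B y (A x) := by
      have := hA y x
      rw [h.symm (A y)] at this
      exact this
    rw [h2] at hAy
    have hAy' : A y = B y (A x) • x := by linear_combination (norm := module) hAy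
    rw [hSx, map_add, map_smul, map_smul, hAy'] at h1
    rw [hAx, map_smul, hSy] at h1
    have h3 := congrArg (B x) h1
    simp only [map_add, map_sub, map_smul, smul_eq_mul, hxx, hxy, hyy] at h3
    have h4 : β * B y (A x) = 0 := by linarith
    exact (mul_eq_zero.mp h4).resolve_left hβ.ne'
  rw [hρ, zero_smul] at hAx
  have hAy0 : A y = 0 := by
    have h2 : B x (A y) = 0 := by
      have := hA y x
      rw [h.symm (A y), hρ] at this
      linarith
    rw [h2] at hAy
    simpa using hAy
  -- the complement
  obtain ⟨k, s, a, b, c, p, q, r, hF, hb, hc, hew, -, hcard⟩ :=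
    exists_frame_complement h he hS hA hSA
      (fun z hz => by
        rw [← orthoProj_of_mem hz, ← hPS]
        exact orthoProj_mem he _)
      (fun z hz => by
        have hz' := mem_orthoFamily.mp hz
        rw [mem_orthoFamily]
        intro i
        have h1 := hA x z
        have h2 := hA y z
        rw [hAx] at h1
        rw [hAy0] at h2
        simp only [map_zero, LinearMap.zero_apply] at h1 h2
        fin_cases i
        · simp; linarith
        · simp; linarith)
  have hw := hF.ortho h.symm
  -- The vanishing trace reads 2α² − 2β² + 2Σaᵢ² + Σcⱼ² = 0, which determines β > 0.
  have hsq := trace_sq_eq_sum h.symm hS he hw hew hcard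
  rw [htr, Fin.sum_univ_two] at hsq
  have hSe : ∀ z, B (S (frameVec p q r z)) (S (frameVec p q r z))
      = Sum.elim (fun z => a z.2 ^ 2) (fun z => c z ^ 2) z := by
    intro z
    have : S (frameVec p q r z) = Sum.elim (fun z : Fin 2 × Fin k => a z.2) c z • frameVec p q r z := by
      rcases z with ⟨i, z⟩ | z
      · fin_cases i
        · exact hF.Sp z
        · exact hF.Sq z
      · exact hF.Sr z
    rw [this, map_smul, map_smul, LinearMap.smul_apply, hw, if_pos rfl]
    rcases z with z | z
    · simp [sq]
    · simp [sq]
  simp only [hSe, Fintype.sum_sum_type, Sum.elim_inl, Sum.elim_inr, Fintype.sum_prod_type,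
    Fin.sum_univ_two, Matrix.cons_val_zero, Matrix.cons_val_one, hSx, hSy, map_add, map_sub,
    map_smul, LinearMap.add_apply, LinearMap.sub_apply, LinearMap.smul_apply, smul_eq_mul, hxx,
    hyy, hxy, h.symm y x, if_true, if_neg (one_ne_zero : (1 : Fin 2) ≠ 0)] at hsq
  refine ⟨α, β, k, s, a, b, c, hb, hc, ?_, hβ, ?_⟩
  · have : α ^ 2 + (∑ i, a i ^ 2) + ∑ j, c j ^ 2 / 2 = β ^ 2 := by
      rw [← Finset.sum_div]
      linarith
    rw [this, Real.sqrt_sq hβ.le]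
  · refine hasMatrix_fromBlocks h.symm he hw hew hcard ?_ ?_
    · intro j
      rw [Fin.sum_univ_two]
      fin_cases j
      · simp [matL1, hSx, hAx]
      · simp [matL1, hSy, hAy0]
        module
    · intro z
      simpa using hF.apply_frameVec z

end SelfAdjoint

/-! ### Self-adjoint part with a causal eigenvector; the rank-one case -/

section SelfAdjointReal

variable {V : Type*} [AddCommGroup V] [Module ℝ V] [FiniteDimensional ℝ V]
  {B : LinearMap.BilinForm ℝ V} {S A : V →ₗ[ℝ] V}

/-- Every Lorentz family can be completed by an orthonormal basis of its complement. -/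
lemma exists_orthonormal_complement (h : IsMinkowski B) {m : ℕ} {e : Fin (m + 1) → V}
    (he : IsLorentzFamily B e) : ∃ (d : ℕ) (w : Fin d → V),
      (∀ x y, B (w x) (w y) = if x = y then 1 else 0) ∧ (∀ i x, B (e i) (w x) = 0) ∧
      m + 1 + Fintype.card (Fin d) = Module.finrank ℝ V := by
  obtain ⟨k, s, a, b, c, p, q, r, hF, hb, -, hew, hd, -⟩ :=
    exists_frame_complement h he (S := 0) (R := 0) (by simp) (by simp) (by simp)
      (fun z _ => by simp) (fun z _ => by simp)
  obtain rfl : k = 0 := by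
    by_contra hk
    have i : Fin k := ⟨0, Nat.pos_of_ne_zero hk⟩
    have h1 := hF.Ap i
    have h2 := hF.qq i i
    have h3 : q i = 0 := (smul_eq_zero.mp h1.symm).resolve_left (hb.2 i).ne'
    simp [h3] at h2
  exact ⟨s, r, hF.rr, fun i x => hew i (Sum.inr x), by simpa using hd⟩

/-- The complement of x is S-invariant and positive definite, so tr S² is μ² plus the squared
lengths of S on an orthonormal basis of it. -/
lemma selfAdjoint_eq_zero_of_timelike (h : IsMinkowski B) (hS : ∀ x y, B (S x) y = B x (S y))
    (htr : LinearMap.trace ℝ V (S ∘ₗ S) = 0) {x : V} (hx : B x x < 0) {μ : ℝ}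
    (hμ : S x = μ • x) : S = 0 := by
  obtain ⟨t, ht⟩ : ∃ t : ℝ, B (t • x) (t • x) = -1 := by
    refine ⟨(Real.sqrt (-B x x))⁻¹, ?_⟩
    have h1 := Real.mul_self_sqrt (show 0 ≤ -B x x by linarith)
    have h0 : Real.sqrt (-B x x) ≠ 0 := (Real.sqrt_pos.mpr (by linarith)).ne'
    simp only [map_smul, LinearMap.smul_apply, smul_eq_mul]
    field_simp
    rw [sq, h1]
    ring
  have hSt : S (t • x) = μ • (t • x) := by rw [map_smul, hμ, smul_comm]
  generalize t • x = u at ht hSt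
  have he : IsLorentzFamily B ![u] := by
    intro i j
    fin_cases i; fin_cases j
    simp [ht]
  obtain ⟨d, w, hw, hew, hcard⟩ := exists_orthonormal_complement h he
  have hsq := trace_sq_eq_sum h.symm hS he hw hew hcard
  rw [htr, Fin.sum_univ_one] at hsq
  simp only [Matrix.cons_val_zero, hSt, map_smul, LinearMap.smul_apply, ht,
    smul_eq_mul, if_true] at hsq
  have hSw : ∀ z, B u (S (w z)) = 0 := by
    intro z
    rw [← hS, hSt]
    have := hew 0 z
    simp only [Matrix.cons_val_zero] at this
    simp [this]
  have hnn : ∀ z, 0 ≤ B (S (w z)) (S (w z)) := by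
    intro z
    by_cases h0 : S (w z) = 0
    · simp [h0]
    · exact (h.pos_of_ortho u _ (by rw [ht]; norm_num) (hSw z) h0).le
  have hsum : 0 ≤ ∑ z, B (S (w z)) (S (w z)) := Finset.sum_nonneg fun z _ => hnn z
  have hμ0 : μ = 0 := by nlinarith [mul_self_nonneg μ]
  have hsum0 : ∑ z, B (S (w z)) (S (w z)) = 0 := by rw [hμ0] at hsq; linarith
  refine eq_of_basis_of_ortho h.symm he hw hew hcard ?_ ?_
  · intro i
    fin_cases i
    simp [hSt, hμ0]
  · intro z
    have h1 := (Finset.sum_eq_zero_iff_of_nonneg fun z _ => hnn z).mp hsum0 z (Finset.mem_univ z)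
    by_contra h0
    exact (h.pos_of_ortho u _ (by rw [ht]; norm_num) (hSw z) h0).ne' h1

omit [FiniteDimensional ℝ V] in
lemma isLorentzFamily_of_null (hB : ∀ x y, B x y = B y x) {l k : V} (hll : B l l = 0)
    (hkk : B k k = 0) (hlk : B l k = -2) :
    IsLorentzFamily B ![(1 / 2 : ℝ) • (l + k), (1 / 2 : ℝ) • (k - l)] := by
  refine isLorentzFamily_pair hB ?_ ?_ ?_ <;>
  · simp only [map_add, map_sub, map_smul, LinearMap.add_apply, LinearMap.sub_apply,
      LinearMap.smul_apply, smul_eq_mul, hll, hkk, hlk, hB k l]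
    norm_num

/-- A self-adjoint operator whose square has no trace and which has a null eigenvector maps the
orthogonal complement of this vector to the line it spans. -/
lemma selfAdjoint_null_eigenvector (h : IsMinkowski B) (hS : ∀ x y, B (S x) y = B x (S y))
    (htr : LinearMap.trace ℝ V (S ∘ₗ S) = 0) {l : V} (hl : l ≠ 0) (hll : B l l = 0) {μ : ℝ}
    (hμ : S l = μ • l) : S l = 0 ∧ ∀ w, B l w = 0 → ∃ c : ℝ, S w = c • l := by
  obtain ⟨k, hkk, hlk⟩ := h.exists_null_partner hl hll (-2)
  have he := isLorentzFamily_of_null h.symm hll hkk hlk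
  obtain ⟨d, w, hw, hew, hcard⟩ := exists_orthonormal_complement h he
  -- The plane of l and k contributes 2μ². Each S w is orthogonal to l, hence has non-negative
  -- square, so all terms vanish; a vector of l^⊥ with zero square lies in ℝl.
  have hsq := trace_sq_eq_sum h.symm hS he hw hew hcard
  have hlSk : B l (S k) = -2 * μ := by
    rw [← hS, hμ]
    simp [hlk, mul_comm]
  rw [htr, Fin.sum_univ_two] at hsq
  simp only [Matrix.cons_val_zero, Matrix.cons_val_one, map_smul, map_add,
    map_sub, hμ, LinearMap.add_apply, LinearMap.sub_apply, LinearMap.smul_apply, hll, hlSk,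
    h.symm (S k) l, smul_eq_mul, if_true, if_neg (one_ne_zero : (1 : Fin 2) ≠ 0)] at hsq
  have hlw : ∀ z, B l (w z) = 0 := by
    intro z
    have h0 := hew 0 z
    have h1 := hew 1 z
    simp only [Matrix.cons_val_zero, Matrix.cons_val_one, map_smul, map_add, map_sub,
      LinearMap.add_apply, LinearMap.sub_apply, LinearMap.smul_apply, smul_eq_mul] at h0 h1
    linarith
  have hSw : ∀ z, B l (S (w z)) = 0 := by
    intro z
    rw [← hS, hμ]
    simp [hlw]
  have hnn : ∀ z, 0 ≤ B (S (w z)) (S (w z)) := fun z => (h.null_ortho hl hll (hSw z)).1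
  have hsum : 0 ≤ ∑ z, B (S (w z)) (S (w z)) := Finset.sum_nonneg fun z _ => hnn z
  have hμ0 : μ = 0 := by nlinarith [mul_self_nonneg μ]
  have hsum0 : ∑ z, B (S (w z)) (S (w z)) = 0 := by rw [hμ0] at hsq; linarith
  have hSl : S l = 0 := by rw [hμ, hμ0, zero_smul]
  refine ⟨hSl, fun v hv => ?_⟩
  have hc : ∀ z, ∃ c : ℝ, S (w z) = c • l := fun z => (h.null_ortho hl hll (hSw z)).2
    ((Finset.sum_eq_zero_iff_of_nonneg fun z _ => hnn z).mp hsum0 z (Finset.mem_univ z))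
  choose c hc using hc
  have hexp := sum_of_ortho (lorentzFamily_frame_ortho h.symm he hw hew) lorentzSigns_mul_self
    (by simpa using hcard) v
  refine ⟨∑ z, B (w z) v * c z, ?_⟩
  conv_lhs => rw [hexp]
  rw [Fintype.sum_sum_type, Fin.sum_univ_two, map_add, map_add, map_sum, Finset.sum_smul]
  simp only [Sum.elim_inl, Sum.elim_inr, hc, lorentzSigns, Matrix.cons_val_zero,
    Matrix.cons_val_one, map_smul, map_add, map_sub, LinearMap.add_apply, LinearMap.sub_apply,
    LinearMap.smul_apply, hv, hSl, if_true, if_neg (one_ne_zero : (1 : Fin 2) ≠ 0), one_mul, smul_smul]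
  module

omit [FiniteDimensional ℝ V] in
/-- A skew operator commuting with a rank one self-adjoint operator kills its image. -/
lemma skewAdjoint_apply_eq_zero (h : IsMinkowski B) (hA : ∀ x y, B (A x) y = - B x (A y))
    {T : V →ₗ[ℝ] V} (hTA : ∀ x, T (A x) = A (T x)) {l : V} (hl : l ≠ 0) {c : ℝ} (hc : c ≠ 0)
    (hT : ∀ v, T v = (c * B l v) • l) : A l = 0 := by
  obtain ⟨y, hy⟩ : ∃ y, B l y ≠ 0 := by
    by_contra hne
    push Not at hne
    exact hl (h.eq_zero_of_forall hne)
  have h1 := hTA y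
  rw [hT, hT, map_smul] at h1
  have h2 := hA l y
  -- Commutation makes l an eigenvector of A with eigenvalue B(l, Ay)/B(l, y); by skewness this
  -- number is its own negative.
  have h3 : B l y • A l = B l (A y) • l := by
    have : c • (B l y • A l) = c • (B l (A y) • l) := by rw [smul_smul, smul_smul, h1]
    exact smul_right_injective V hc this
  have h4 : A l = (B l (A y) / B l y) • l := by
    rw [div_eq_inv_mul, mul_smul, ← h3, smul_smul, inv_mul_cancel₀ hy, one_smul]
  have h5 := congrArg (fun v => B v y) h4
  simp only [map_smul, LinearMap.smul_apply, smul_eq_mul, h2] at h5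
  rw [div_mul_cancel₀ _ hy] at h5
  have h6 : B l (A y) = 0 := by linarith
  rw [h4, h6, zero_div, zero_smul]

omit [FiniteDimensional ℝ V] in
lemma skewAdjoint_compression (hB : ∀ x y, B x y = B y x) (hA : ∀ x y, B (A x) y = - B x (A y))
    {m : ℕ} (e : Fin (m + 1) → V) (x y : V) :
    B ((orthoProj B e ∘ₗ A ∘ₗ orthoProj B e) x) y
      = - B x ((orthoProj B e ∘ₗ A ∘ₗ orthoProj B e) y) := by
  simp only [LinearMap.comp_apply]
  rw [orthoProj_symm hB, hA, orthoProj_symm hB]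

/-- The normal form of a skew operator relative to the complement of a Lorentz family. -/
lemma exists_compression_frame (h : IsMinkowski B) (hA : ∀ x y, B (A x) y = - B x (A y))
    {m : ℕ} {e : Fin (m + 1) → V} (he : IsLorentzFamily B e) :
    ∃ (k s : ℕ) (b : Fin k → ℝ) (w : (Fin 2 × Fin k) ⊕ Fin s → V),
      IsPosDecreasing b ∧ (∀ x y, B (w x) (w y) = if x = y then 1 else 0) ∧
      (∀ i x, B (e i) (w x) = 0) ∧ m + 1 + (2 * k + s) = Module.finrank ℝ V ∧
      m + 1 + Fintype.card ((Fin 2 × Fin k) ⊕ Fin s) = Module.finrank ℝ V ∧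
      ∀ x, A (w x) = ∑ i, ((if i = 0 then (-1 : ℝ) else 1) * B (e i) (A (w x))) • e i
        + ∑ y, diagRot s b y x • w y := by
  obtain ⟨k, s, a, b, c, p, q, r, hF, hb, -, hew, hd, hcard⟩ :=
    exists_frame_complement h he (S := 0) (R := orthoProj B e ∘ₗ A ∘ₗ orthoProj B e) (by simp)
      (skewAdjoint_compression h.symm hA e) (by simp)
      (fun z _ => by simp) (fun z _ => orthoProj_mem he _)
  obtain ⟨rfl, rfl⟩ := hF.eq_zero_of_left
  refine ⟨k, s, b, frameVec p q r, hb, hF.ortho h.symm, hew, hd, hcard, fun x => ?_⟩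
  have h1 := hF.apply_frameVec x
  have h2 : orthoProj B e (frameVec p q r x) = frameVec p q r x :=
    orthoProj_of_mem (mem_orthoFamily.mpr fun i => hew i x)
  rw [LinearMap.zero_apply, zero_add, LinearMap.comp_apply, LinearMap.comp_apply, h2,
    orthoProj_apply] at h1
  rw [diagRot, ← h1]
  abel

/-- Commutation gives A l = 0, so A e₁ = A e₂ for l = e₁ − e₂. This common value lies in the
complement of e₁, e₂ and is the vector v; the compression of A to the complement is put in normal
form. -/
lemma formV_of_rank_one (h : IsMinkowski B) (hA : ∀ x y, B (A x) y = - B x (A y))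
    (hSA : ∀ x, S (A x) = A (S x)) {l : V} (hl : l ≠ 0) (hll : B l l = 0) {c : ℝ} (hc : c ≠ 0)
    (hS : ∀ v, S v = (c * B l v) • l) : FormV B (S + A) := by
  -- normalise the null vector
  obtain ⟨l, ε, hε, hl, hll, hS⟩ : ∃ (l : V) (ε : ℝ), (ε = 1 ∨ ε = -1) ∧ l ≠ 0 ∧ B l l = 0 ∧
      ∀ v, S v = (-(ε / 2) * B l v) • l := by
    have h2 : 0 < 2 * |c| := by positivity
    have h3 := Real.mul_self_sqrt h2.le
    -- The rescaling turns c into ±1/2. It is written −ε/2 because B(l, e₁) = −1, so that S e₁ =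
    -- (ε/2)(e₁ − e₂).
    refine ⟨Real.sqrt (2 * |c|) • l, if c < 0 then 1 else -1, ?_, ?_, ?_, ?_⟩
    · split_ifs <;> simp
    · exact smul_ne_zero (Real.sqrt_pos.mpr h2).ne' hl
    · simp [hll]
    · intro v
      rw [hS v, map_smul, LinearMap.smul_apply, smul_smul, smul_eq_mul]
      congr 1
      set t := Real.sqrt (2 * |c|)
      split_ifs with hneg
      · rw [abs_of_neg hneg] at h3
        linear_combination (B l v / 2) * h3
      · rw [abs_of_nonneg (not_lt.mp hneg)] at h3
        linear_combination (- B l v / 2) * h3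
  have hε0 : -(ε / 2) ≠ 0 := by rcases hε with rfl | rfl <;> norm_num
  have hAl := skewAdjoint_apply_eq_zero h hA hSA hl hε0 hS
  obtain ⟨k, hkk, hlk⟩ := h.exists_null_partner hl hll (-2)
  have he := isLorentzFamily_of_null h.symm hll hkk hlk
  obtain ⟨d, s, b, w, hb, hw, hew, -, hcard, hAw⟩ := exists_compression_frame h hA he
  set e₁ := (1 / 2 : ℝ) • (l + k) with he₁
  set e₂ := (1 / 2 : ℝ) • (k - l) with he₂
  have hl12 : l = e₁ - e₂ := by rw [he₁, he₂]; module
  have hle₁ : B l e₁ = -1 := by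
    simp only [he₁, map_smul, map_add, smul_eq_mul, hll, hlk]; norm_num
  have hle₂ : B l e₂ = -1 := by
    simp only [he₂, map_smul, map_sub, smul_eq_mul, hll, hlk]; norm_num
  have hA12 : A e₁ = A e₂ := by
    rw [hl12, map_sub, sub_eq_zero] at hAl
    exact hAl
  have hself : ∀ z, B z (A z) = 0 := by
    intro z
    have := hA z z
    rw [h.symm (A z)] at this
    linarith
  set v := fun x => B (w x) (A e₁) with hv
  have hew₁ : ∀ x, B e₁ (A (w x)) = - v x := by
    intro x
    have := hA e₁ (w x)
    rw [h.symm (A e₁)] at this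
    rw [hv]; linarith
  have hew₂ : ∀ x, B e₂ (A (w x)) = - v x := by
    intro x
    have := hA e₂ (w x)
    rw [h.symm (A e₂), ← hA12] at this
    rw [hv]; linarith
  have hAe₁ : A e₁ = ∑ x, v x • w x := by
    have hexp := sum_of_ortho (lorentzFamily_frame_ortho h.symm he hw hew) lorentzSigns_mul_self
      (by simpa using hcard) (A e₁)
    rw [Fintype.sum_sum_type, Fin.sum_univ_two] at hexp
    have h2 : B e₂ (A e₁) = 0 := by rw [hA12]; exact hself e₂
    simp only [Sum.elim_inl, Sum.elim_inr, Matrix.cons_val_zero, Matrix.cons_val_one, hself, h2,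
      mul_zero, zero_smul, zero_add, lorentzSigns, one_mul] at hexp
    exact hexp
  refine ⟨ε, d, s, v, b, hε, hb, ?_⟩
  refine hasMatrix_fromBlocks h.symm he hw hew hcard ?_ ?_
  · intro j
    rw [Fin.sum_univ_two]
    fin_cases j
    · simp only [LinearMap.add_apply, Fin.zero_eta, Matrix.cons_val_zero, Matrix.cons_val_one, hS,
        hle₁, hAe₁, Matrix.transpose_apply, Matrix.of_apply, Matrix.cons_val']
      rw [hl12]
      simp
      module
    · simp only [LinearMap.add_apply, Fin.mk_one, Matrix.cons_val_zero, Matrix.cons_val_one, hS,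
        hle₂, ← hA12, hAe₁, Matrix.transpose_apply, Matrix.of_apply, Matrix.cons_val']
      rw [hl12]
      simp
      module
  · intro x
    have hlw : B l (w x) = 0 := by
      rw [hl12, map_sub, LinearMap.sub_apply]
      have h0 := hew 0 x
      have h1 := hew 1 x
      simp only [Matrix.cons_val_zero, Matrix.cons_val_one] at h0 h1
      rw [h0, h1, sub_zero]
    rw [LinearMap.add_apply, hS, hlw, mul_zero, zero_smul, zero_add]
    conv_lhs => rw [hAw]
    congr 1
    simp [Fin.sum_univ_two, hew₁, hew₂]

end SelfAdjointReal

/-! ### The nilpotent case of order three and the classification for S ≠ 0 -/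

section SelfAdjointNilpotent

variable {V : Type*} [AddCommGroup V] [Module ℝ V] [FiniteDimensional ℝ V]
  {B : LinearMap.BilinForm ℝ V} {S A : V →ₗ[ℝ] V}

/-- S² is the rank-one map B(l, ·)l, so A kills l, and then also u. In the frame (x − l)/√2, u, (x +
l)/√2 the operator S is the 3×3 corner, and A has the same value on the first and third vectors. -/
lemma formVI_of_chain (h : IsMinkowski B) (hS : ∀ x y, B (S x) y = B x (S y))
    (hA : ∀ x y, B (A x) y = - B x (A y)) (hSA : ∀ x, S (A x) = A (S x)) {x u l : V}
    (hSx : S x = u) (hSu : S u = l) (hSl : S l = 0) (hxx : B x x = 0) (hxu : B x u = 0)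
    (huu : B u u = 1) (hSw : ∀ w, B l w = 0 → ∃ c : ℝ, S w = c • l) : FormVI B (S + A) := by
  have hxl : B x l = 1 := by rw [← hSu, ← hS, hSx, huu]
  have hul : B u l = 0 := by rw [← hSx, hS, hSl, map_zero]
  have hll : B l l = 0 := by
    conv_lhs => rw [← hSu]
    rw [hS, hSu, hSl, map_zero]
  have hl : l ≠ 0 := by
    rintro rfl
    simp at hxl
  have hSS : ∀ v, (S ∘ₗ S) v = (1 * B l v) • l := by
    intro v
    obtain ⟨c, hc⟩ := hSw (v - B l v • x) (by
      rw [map_sub, map_smul, h.symm l x, hxl]; simp)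
    rw [map_sub, map_smul, sub_eq_iff_eq_add, hSx] at hc
    rw [LinearMap.comp_apply, hc, map_add, map_smul, map_smul, hSl, hSu]
    simp
  have hAl : A l = 0 := skewAdjoint_apply_eq_zero h hA (T := S ∘ₗ S)
    (fun x => by simp [hSA]) hl one_ne_zero hSS
  have hself : ∀ z, B z (A z) = 0 := by
    intro z
    have := hA z z
    rw [h.symm (A z)] at this
    linarith
  -- Test against V = ℝx + l^⊥, using A u = S A x. Against x, self-adjointness and skewness make the
  -- product its own negative; on l^⊥, S takes values in ℝl and A l = 0.
  have hAu : A u = 0 := by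
    refine h.eq_zero_of_forall fun y => ?_
    obtain ⟨c, hc⟩ := hSw (y - B l y • x) (by
      rw [map_sub, map_smul, h.symm l x, hxl]; simp)
    have h1 : B (A u) x = 0 := by
      have h2 : B (A u) x = B (A x) u := by rw [← hSx, ← hSA, hS]
      have h3 := hA x u
      rw [h.symm x] at h3
      linarith
    have h2 : B (A u) (y - B l y • x) = 0 := by
      rw [← hSx, ← hSA, hS, hc, map_smul, hA, hAl]
      simp
    rw [map_sub, map_smul, h1] at h2
    simpa using h2
  set ρ : ℝ := 1 / Real.sqrt 2 with hρ
  have hρ2 : ρ * ρ = 1 / 2 := by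
    rw [hρ, div_mul_div_comm, Real.mul_self_sqrt (by norm_num)]; norm_num
  set e₁ := ρ • (x - l) with he₁
  set e₃ := ρ • (x + l) with he₃
  have he : IsLorentzFamily B ![e₁, u, e₃] := by
    refine isLorentzFamily_triple h.symm ?_ huu ?_ ?_ ?_ ?_ <;>
    · simp only [he₁, he₃, map_add, map_sub, map_smul, LinearMap.add_apply, LinearMap.sub_apply,
        LinearMap.smul_apply, smul_eq_mul, hxx, hll, hxl, hxu, hul, h.symm l x, h.symm l u,
        h.symm u x]
      linarith
  obtain ⟨k, s, b, w, hb, hw, hew, -, hcard, hAw⟩ := exists_compression_frame h hA he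
  have hA13 : A e₃ = A e₁ := by simp [he₁, he₃, hAl]
  have hl13 : l = ρ • (e₃ - e₁) := by
    have : ρ • (e₃ - e₁) = (2 * (ρ * ρ)) • l := by rw [he₁, he₃]; module
    rw [this, hρ2]; simp
  set v := fun x => B (w x) (A e₁) with hv
  have hew₁ : ∀ x, B e₁ (A (w x)) = - v x := by
    intro x
    have := hA e₁ (w x)
    rw [h.symm (A e₁)] at this
    rw [hv]; linarith
  have hew₂ : ∀ x, B u (A (w x)) = 0 := by
    intro x
    have := hA u (w x)
    rw [hAu] at this
    simpa using this.symm
  have hew₃ : ∀ x, B e₃ (A (w x)) = - v x := by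
    intro x
    have := hA e₃ (w x)
    rw [h.symm (A e₃), hA13] at this
    rw [hv]; linarith
  have hAe₁ : A e₁ = ∑ x, v x • w x := by
    have hexp := sum_of_ortho (lorentzFamily_frame_ortho h.symm he hw hew) lorentzSigns_mul_self
      (by simpa using hcard) (A e₁)
    rw [Fintype.sum_sum_type, Fin.sum_univ_three] at hexp
    have h2 : B e₃ (A e₁) = 0 := by rw [← hA13]; exact hself e₃
    have h3 : B u (A e₁) = 0 := by
      have := hA u e₁
      rw [hAu] at this
      simpa using this.symm
    simp only [Sum.elim_inl, Sum.elim_inr, Matrix.cons_val_zero, Matrix.cons_val_one,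
      Matrix.cons_val, hself, h2, h3,
      mul_zero, zero_smul, zero_add, lorentzSigns, one_mul] at hexp
    exact hexp
  have hSe₁ : S e₁ = ρ • u := by rw [he₁, map_smul, map_sub, hSx, hSl, sub_zero]
  have hSe₃ : S e₃ = ρ • u := by rw [he₃, map_smul, map_add, hSx, hSl, add_zero]
  refine ⟨k, s, v, b, hb, ?_⟩
  refine hasMatrix_fromBlocks h.symm he hw hew hcard ?_ ?_
  · intro j
    rw [Fin.sum_univ_three]
    fin_cases j
    · simp [hSe₁, hAe₁]
      rw [hρ, one_div]
    · simp [hSu, hAu]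
      rw [← one_div, ← hρ]
      conv_lhs => rw [hl13]
      module
    · simp [hSe₃, hA13, hAe₁]
      rw [hρ, one_div]
  · intro z
    have hz : ∀ i, B (![e₁, u, e₃] i) (w z) = 0 := fun i => hew i z
    have h1 := hz 0
    have h2 := hz 1
    have h3 := hz 2
    simp only [Matrix.cons_val_zero, Matrix.cons_val_one, Matrix.cons_val] at h1 h2 h3
    have hlw : B l (w z) = 0 := by
      rw [hl13, map_smul, map_sub, LinearMap.smul_apply, LinearMap.sub_apply, h1, h3]
      simp
    have hSw0 : S (w z) = 0 := by
      obtain ⟨c, hc⟩ := hSw _ hlw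
      have h4 := hS x (w z)
      rw [hSx, h2, hc, map_smul, hxl] at h4
      have : c = 0 := by simpa using h4.symm
      rw [hc, this, zero_smul]
    rw [LinearMap.add_apply, hSw0, zero_add]
    conv_lhs => rw [hAw]
    congr 1
    simp [Fin.sum_univ_three, hew₁, hew₂, hew₃]

/-- The classification of commuting pairs `S`, `A` with `S` self-adjoint, `A` skew and
`tr (S²) = 0`, up to the case `S = 0`. -/
theorem selfAdjoint_eq_zero_or_form (h : IsMinkowski B) (hS : ∀ x y, B (S x) y = B x (S y))
    (hA : ∀ x y, B (A x) y = - B x (A y)) (hSA : ∀ x, S (A x) = A (S x))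
    (htr : LinearMap.trace ℝ V (S ∘ₗ S) = 0) :
    S = 0 ∨ FormIV B (S + A) ∨ FormV B (S + A) ∨ FormVI B (S + A) := by
  obtain ⟨t, ht⟩ := h.exists_timelike
  rcases h.exists_eigenvector_or_plane_of_selfAdjoint hS _ ⊤ rfl ⟨t, trivial, ht⟩
    (fun _ _ => trivial) with ⟨l, hl, hll, μ, hμ⟩ | ⟨x, y, hx, α, β, hβ, h1, h2⟩
  swap
  · exact Or.inr (Or.inl (formIV_of_plane h hS hA hSA htr hx hβ h1 h2))
  rcases hll.lt_or_eq with hneg | hll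
  · exact Or.inl (selfAdjoint_eq_zero_of_timelike h hS htr hneg hμ)
  obtain ⟨hSl, hSw⟩ := selfAdjoint_null_eigenvector h hS htr hl hll hμ
  obtain ⟨k, hkk, hlk⟩ := h.exists_null_partner hl hll 1
  have hkl : B k l = 1 := by rw [h.symm, hlk]
  have hlg : B l (S k) = 0 := by rw [← hS, hSl]; simp
  obtain ⟨c, hc⟩ := hSw (S k) hlg
  have hgg : B (S k) (S k) = c := by rw [hS, hc, map_smul, hkl]; simp
  have hgg0 := (h.null_ortho hl hll hlg).1
  -- S k is orthogonal to l. If it is null, S has rank at most one; if it is spacelike, k ↦ S k ↦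
  -- S²k = c l is a chain with c > 0.
  rcases eq_or_lt_of_le hgg0 with hg0 | hpos
  · obtain ⟨p, hp⟩ := (h.null_ortho hl hll hlg).2 hg0.symm
    have hSv : ∀ v, S v = (p * B l v) • l := by
      intro v
      have hv0 : B l (v - B l v • k) = 0 := by rw [map_sub, map_smul, hlk]; simp
      obtain ⟨d, hd⟩ := hSw _ hv0
      have h1 := hS (v - B l v • k) k
      rw [hd, hp, map_smul, map_smul, LinearMap.smul_apply, hlk,
        h.symm _ l, hv0] at h1
      have hd0 : d = 0 := by simpa using h1
      rw [hd0, zero_smul, map_sub, map_smul, hp, sub_eq_zero] at hd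
      rw [hd, smul_smul, mul_comm]
    by_cases hp0 : p = 0
    · left
      refine LinearMap.ext fun v => ?_
      rw [hSv, hp0]; simp
    · exact Or.inr (Or.inr (Or.inl (formV_of_rank_one h hA hSA hl hll hp0 hSv)))
  · right; right; right
    rw [hgg] at hpos
    set ρ := Real.sqrt c with hρ
    have hρ0 : ρ ≠ 0 := (Real.sqrt_pos.mpr hpos).ne'
    have hρ2 : ρ * ρ = c := Real.mul_self_sqrt hpos.le
    -- The chain starts at x = ρ⁻¹(1 + qS + rS²)k, where S²k = ρ²l. The condition B(x, Sx) = 0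
    -- determines q, and then B(x, x) = 0 reads −3q² + 2r = 0.
    set q := - (B k (S k) * (ρ⁻¹ * ρ⁻¹)) / 2 with hq
    set r := 3 * q ^ 2 / 2 with hr
    set u := ρ⁻¹ • S k + (q * ρ) • l with hu
    have hri : ρ⁻¹ * ρ⁻¹ * c = 1 := by rw [← hρ2]; field_simp
    refine formVI_of_chain h hS hA hSA (x := ρ⁻¹ • k + (q * ρ⁻¹) • S k + (r * ρ) • l) (u := u)
      (l := ρ • l) ?_ ?_ ?_ ?_ ?_ ?_ ?_
    · simp only [map_add, map_smul, hSl, hc, hu, smul_smul, smul_zero, add_zero]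
      congr 2
      rw [← hρ2]
      field_simp
    · simp only [hu, map_add, map_smul, hSl, hc, smul_smul, smul_zero, add_zero]
      congr 1
      rw [← hρ2]
      field_simp
    · simp [hSl]
    · simp only [map_add, map_smul, LinearMap.add_apply, LinearMap.smul_apply, smul_eq_mul, hkk,
        hgg, hkl, hlk, hlg, hll, h.symm (S k) l, h.symm (S k) k, mul_zero, add_zero, zero_add,
        mul_one]
      have h1 : B k (S k) * (ρ⁻¹ * ρ⁻¹) = -2 * q := by rw [hq]; ring
      have h2 : ρ⁻¹ * ρ = 1 := inv_mul_cancel₀ hρ0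
      linear_combination (2 * q) * h1 + q ^ 2 * hri + 2 * r * h2 + 2 * hr
    · simp only [hu, map_add, map_smul, LinearMap.add_apply, LinearMap.smul_apply, smul_eq_mul, hkk,
        hgg, hkl, hlk, hlg, hll, h.symm (S k) l, h.symm (S k) k, mul_zero, add_zero, zero_add,
        mul_one]
      have h1 : B k (S k) * (ρ⁻¹ * ρ⁻¹) = -2 * q := by rw [hq]; ring
      have h2 : ρ⁻¹ * ρ = 1 := inv_mul_cancel₀ hρ0
      linear_combination h1 + q * hri + q * h2
    · simp only [hu, map_add, map_smul, LinearMap.add_apply, LinearMap.smul_apply, smul_eq_mul,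
        hgg, hlg, hll, h.symm (S k) l, mul_zero, add_zero]
      linear_combination hri
    · intro w hw
      rw [map_smul, LinearMap.smul_apply, smul_eq_mul] at hw
      obtain ⟨d, hd⟩ := hSw w ((mul_eq_zero.mp hw).resolve_left hρ0)
      refine ⟨d * ρ⁻¹, ?_⟩
      rw [hd, smul_smul, mul_assoc, inv_mul_cancel₀ hρ0, mul_one]

end SelfAdjointNilpotent

/-! ### The three types of skew operators on Minkowski space -/

section SkewAdjoint

variable {V : Type*} [AddCommGroup V] [Module ℝ V] [FiniteDimensional ℝ V]
  {B : LinearMap.BilinForm ℝ V} {A : V →ₗ[ℝ] V}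

/-- A skew operator with a null eigenvector `l` has a null vector `k` which it maps, modulo `l`, to
`-μ k + v`, with `v` orthogonal to `l` and `v = 0` if `μ ≠ 0`. -/
lemma exists_adapted_null_partner (h : IsMinkowski B) (hA : ∀ x y, B (A x) y = - B x (A y)) {l : V}
    (hl : l ≠ 0) (hll : B l l = 0) {μ : ℝ} (hμ : A l = μ • l) :
    ∃ (k v : V) (d d' : ℝ), B k k = 0 ∧ B l k = -2 ∧ B l v = 0 ∧ μ • v = 0 ∧
      (v ≠ 0 → 0 < B v v) ∧ A k = -μ • k + v + d • l ∧ A v = μ • v + d' • l := by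
  obtain ⟨k, hkk, hlk⟩ := h.exists_null_partner hl hll (-2)
  have hself : ∀ z, B z (A z) = 0 := by
    intro z
    have := hA z z
    rw [h.symm (A z)] at this
    linarith
  have hkl : B k l = -2 := by rw [h.symm, hlk]
  set W : Submodule ℝ V := LinearMap.ker (B l) ⊓ LinearMap.ker (B k) with hW
  have memW : ∀ w, w ∈ W ↔ B l w = 0 ∧ B k w = 0 := fun w => by simp [hW]
  have hpos : ∀ w ∈ W, w ≠ 0 → 0 < B w w := by
    intro w hw hw0
    rw [memW] at hw
    obtain ⟨h1, h2⟩ := h.null_ortho hl hll hw.1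
    refine lt_of_le_of_ne h1 fun h3 => hw0 ?_
    obtain ⟨c, rfl⟩ := h2 h3.symm
    have := hw.2
    rw [map_smul, hkl] at this
    have : c = 0 := by simpa using this
    rw [this, zero_smul]
  -- This is the orthogonal projection onto W; the factors 1/2 come from B(l, k) = −2.
  let P : V →ₗ[ℝ] V := LinearMap.id + (1 / 2 : ℝ) • (B k).smulRight l
    + (1 / 2 : ℝ) • (B l).smulRight k
  have hP : ∀ z, P z = z + (1 / 2 * B k z) • l + (1 / 2 * B l z) • k := by
    intro z
    simp [P, smul_smul]
  have hPmem : ∀ z, P z ∈ W := by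
    intro z
    rw [memW, hP]
    simp only [map_add, map_smul, smul_eq_mul, hll, hkk, hlk, hkl]
    constructor <;> ring
  have hPB : ∀ z w, w ∈ W → B (P z) w = B z w := by
    intro z w hw
    rw [memW] at hw
    rw [hP]
    simp [hw.1, hw.2]
  -- Replacing k by k − u + (B(u, u)/4)l with u ∈ W keeps it a null partner of l and changes v = P A
  -- k into v − Qu. So v may be taken orthogonal to Q(W), i.e. in the kernel of the adjoint μ − PA
  -- of Q on W.
  let Q : V →ₗ[ℝ] V := P ∘ₗ A + μ • LinearMap.id
  have hQ : ∀ z, Q z = P (A z) + μ • z := fun z => rfl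
  have hQW : ∀ z ∈ W, Q z ∈ W := fun z hz => W.add_mem (hPmem _) (W.smul_mem _ hz)
  set K := W.map Q with hK
  have hKW : K ≤ W := by
    rintro _ ⟨z, hz, rfl⟩
    exact hQW z hz
  have hrefl : B.IsRefl := fun x y hxy => by rw [h.symm]; exact hxy
  have hnd : (B.restrict K).Nondegenerate := by
    have hd : ∀ x : K, (∀ y : K, B x y = 0) → x = 0 := by
      intro x hx
      by_contra hne
      exact (hpos x (hKW x.2) fun h0 => hne (Subtype.ext h0)).ne' (hx x)
    exact ⟨fun x hx => hd x fun y => hx y, fun x hx => hd x fun y => by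
      rw [h.symm]; exact hx y⟩
  have hcompl := LinearMap.BilinForm.isCompl_orthogonal_of_restrict_nondegenerate hrefl hnd
  set v := P (A k) with hv
  have hvW : v ∈ W := hPmem _
  have hlAk : B l (A k) = 2 * μ := by
    have := hA l k
    rw [hμ] at this
    simp only [map_smul, LinearMap.smul_apply, smul_eq_mul, hlk] at this
    linarith
  have hAk : A k = -μ • k + v := by
    rw [hv, hP, hself, hlAk]
    module
  have hvtop : v ∈ K ⊔ B.orthogonal K := by
    rw [hcompl.sup_eq_top]; trivial
  obtain ⟨κ, hκ, v₀, hv₀, hsum⟩ := Submodule.mem_sup.mp hvtop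
  obtain ⟨u, huW, rfl⟩ := hκ
  have hv₀W : v₀ ∈ W := by
    have : v₀ = v - Q u := by rw [← hsum]; abel
    rw [this]
    exact W.sub_mem hvW (hQW u huW)
  have hv₀K : ∀ w ∈ W, B (Q w) v₀ = 0 := fun w hw => hv₀ _ ⟨w, hw, rfl⟩
  have hPAv : P (A v₀) = μ • v₀ := by
    set z := P (A v₀) - μ • v₀ with hz
    have hzW : z ∈ W := W.sub_mem (hPmem _) (W.smul_mem _ hv₀W)
    have h1 := hv₀K z hzW
    have h2 : B z z = - B (Q z) v₀ := by
      have h3 : B (P (A z)) v₀ = - B (P (A v₀)) z := by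
        rw [hPB _ _ hv₀W, hPB _ _ hzW, hA, h.symm]
      have h4 : ∀ y, B z y = B (P (A v₀)) y - μ * B v₀ y := fun y => by rw [hz]; simp
      rw [hQ, map_add, LinearMap.add_apply, h3, map_smul, LinearMap.smul_apply, h.symm z v₀, h4 z,
        smul_eq_mul]
      ring
    rw [h1, neg_zero] at h2
    by_contra hne
    exact (hpos z hzW fun h0 => hne (sub_eq_zero.mp h0)).ne' h2
  have hAW : ∀ w ∈ W, A w = P (A w) - (1 / 2 * B k (A w)) • l := by
    intro w hw
    rw [memW] at hw
    have h1 : B l (A w) = 0 := by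
      have := hA l w
      rw [hμ] at this
      simp only [map_smul, LinearMap.smul_apply, hw.1, smul_zero] at this
      linarith
    rw [hP, h1]
    module
  have hμv : μ • v₀ = 0 := by
    by_contra hne
    have hv0 : v₀ ≠ 0 := fun h0 => hne (by rw [h0, smul_zero])
    have h1 := hPB (A v₀) v₀ hv₀W
    rw [hPAv, h.symm (A v₀), hself, map_smul, LinearMap.smul_apply, smul_eq_mul] at h1
    have := (mul_eq_zero.mp h1).resolve_right (hpos _ hv₀W hv0).ne'
    rw [this, zero_smul] at hne
    exact hne rfl
  have huW' := (memW u).mp huW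
  have hv₀W' := (memW v₀).mp hv₀W
  refine ⟨k - u + (B u u / 4) • l, v₀, 1 / 2 * B k (A u) + 2 * μ * (B u u / 4),
    -(1 / 2 * B k (A v₀)), ?_, ?_, hv₀W'.1, hμv, hpos _ hv₀W, ?_, ?_⟩
  · simp only [map_add, map_sub, map_smul, LinearMap.add_apply, LinearMap.sub_apply,
      LinearMap.smul_apply, smul_eq_mul, hkk, hll, hlk, hkl, huW'.1, huW'.2, h.symm u k,
      h.symm u l]
    ring
  · simp only [map_add, map_sub, map_smul, smul_eq_mul, hll, hlk, huW'.1]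
    ring
  · have h1 : P (A u) = v - v₀ - μ • u := by rw [← hsum, hQ]; abel
    have h2 := hAW u huW
    rw [h1] at h2
    rw [map_add, map_sub, map_smul, hμ, hAk]
    linear_combination (norm := module) -h2
  · have h2 := hAW v₀ hv₀W
    rw [hPAv] at h2
    linear_combination (norm := module) h2

/-- The three types of skew operators on Minkowski space. -/
lemma skewAdjoint_trichotomy (h : IsMinkowski B) (hA : ∀ x y, B (A x) y = - B x (A y)) :
    (∃ t, B t t = -1 ∧ A t = 0) ∨
    (∃ t x, ∃ ρ : ℝ, 0 < ρ ∧ IsLorentzFamily B ![t, x] ∧ A t = ρ • x ∧ A x = ρ • t) ∨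
    ∃ e₁ e₂ e₃, IsLorentzFamily B ![e₁, e₂, e₃] ∧ A e₁ = - e₃ ∧ A e₂ = e₃ ∧ A e₃ = - (e₁ + e₂) := by
  obtain ⟨t, ht⟩ := h.exists_timelike
  obtain ⟨l, hl, hll, μ, hμ⟩ := h.exists_eigenvector_of_skewAdjoint hA _ ⊤ rfl ⟨t, trivial, ht⟩
    (fun _ _ => trivial)
  have hself : ∀ z, B z (A z) = 0 := by
    intro z
    have := hA z z
    rw [h.symm (A z)] at this
    linarith
  rcases hll.lt_or_eq with hneg | hll
  · left
    refine ⟨(Real.sqrt (-B l l))⁻¹ • l, ?_, ?_⟩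
    · have h1 := Real.mul_self_sqrt (show 0 ≤ -B l l by linarith)
      have h0 : Real.sqrt (-B l l) ≠ 0 := (Real.sqrt_pos.mpr (by linarith)).ne'
      simp only [map_smul, LinearMap.smul_apply, smul_eq_mul]
      field_simp
      rw [sq, h1]
      ring
    · have h1 := hself l
      rw [hμ, map_smul, smul_eq_mul] at h1
      have h2 := (mul_eq_zero.mp h1).resolve_right hneg.ne
      rw [map_smul, hμ, h2, zero_smul, smul_zero]
  obtain ⟨k, v, d, d', hkk, hlk, hlv, hμv, hvv, hAk, hAv⟩ :=
    exists_adapted_null_partner h hA hl hll hμ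
  have hkl : B k l = -2 := by rw [h.symm, hlk]
  -- If v = 0, the plane of l and k is invariant, and A is zero or a boost on it. If v ≠ 0, then μ =
  -- 0 and A is a null rotation k ↦ v' ↦ (m/2)l ↦ 0.
  by_cases hv : v = 0
  · have hd : d = 0 := by
      have := hself k
      rw [hAk, hv] at this
      simpa [hkk, hkl] using this
    rw [hv, hd, zero_smul, add_zero, add_zero] at hAk
    have he := isLorentzFamily_of_null h.symm hll hkk hlk
    rcases eq_or_ne μ 0 with rfl | hμ0
    · left
      refine ⟨(1 / 2 : ℝ) • (l + k), he 0 0, ?_⟩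
      simp [hμ, hAk]
    · right; left
      have h1 : A ((1 / 2 : ℝ) • (l + k)) = -μ • ((1 / 2 : ℝ) • (k - l)) := by
        rw [map_smul, map_add, hμ, hAk]; module
      have h2 : A ((1 / 2 : ℝ) • (k - l)) = -μ • ((1 / 2 : ℝ) • (l + k)) := by
        rw [map_smul, map_sub, hμ, hAk]; module
      rcases lt_or_gt_of_ne hμ0 with hlt | hgt
      · exact ⟨_, _, -μ, by linarith, he, h1, h2⟩
      · refine ⟨(1 / 2 : ℝ) • (l + k), -((1 / 2 : ℝ) • (k - l)), μ, hgt, ?_, ?_, ?_⟩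
        · have he11 : B ((1 / 2 : ℝ) • (k - l)) ((1 / 2 : ℝ) • (k - l)) = 1 := he 1 1
          have he01 : B ((1 / 2 : ℝ) • (l + k)) ((1 / 2 : ℝ) • (k - l)) = 0 := he 0 1
          refine isLorentzFamily_pair h.symm (he 0 0) ?_ ?_
          · rw [LinearMap.BilinForm.neg_left, LinearMap.BilinForm.neg_right, neg_neg, he11]
          · rw [map_neg, he01, neg_zero]
        · rw [h1]; module
        · rw [map_neg, h2]; module
  · right; right
    have hμ0 : μ = 0 := (smul_eq_zero.mp hμv).resolve_right hv
    subst hμ0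
    have hm := hvv hv
    set m := B v v with hm'
    set ρ := Real.sqrt m with hρ
    have hρ0 : ρ ≠ 0 := (Real.sqrt_pos.mpr hm).ne'
    have hρ2 : ρ * ρ = m := Real.mul_self_sqrt hm.le
    simp only [neg_zero, zero_smul, zero_add] at hAk hAv hμ
    set v' := v + d • l with hv'
    have hvl : B v l = 0 := by rw [h.symm, hlv]
    have hvv' : B v' v' = m := by
      simp only [hv', map_add, map_smul, LinearMap.add_apply, LinearMap.smul_apply, smul_eq_mul,
        hll, hlv, hvl, ← hm']
      ring
    have hAv' : A v' = (m / 2) • l := by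
      have h1 : A v' = d' • l := by rw [hv', map_add, map_smul, hμ, hAv]; simp
      have h2 := hA v' k
      rw [h1, hAk, hvv', map_smul, LinearMap.smul_apply, hlk, smul_eq_mul] at h2
      rw [h1]
      congr 1
      linarith
    have hkv : B k v' = 0 := by rw [← hAk, hself]
    have hlv' : B l v' = 0 := by simp [hv', hlv, hll]
    -- The two coefficients have product 1/4, so sum and difference are unit vectors; their ratio is
    -- fixed by A(ρ⁻¹v') = (ρ/2)l being the sum of the first two vectors.
    refine ⟨(ρ / 4) • l + ρ⁻¹ • k, (ρ / 4) • l - ρ⁻¹ • k, -ρ⁻¹ • v', ?_, ?_, ?_, ?_⟩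
    · have hri : ρ⁻¹ * ρ = 1 := inv_mul_cancel₀ hρ0
      refine isLorentzFamily_triple h.symm ?_ ?_ ?_ ?_ ?_ ?_ <;>
        simp only [map_add, map_sub, map_smul, LinearMap.add_apply, LinearMap.sub_apply,
          LinearMap.smul_apply, smul_eq_mul, hll, hkk, hlk, hkl, hkv, hlv', hvv', h.symm v' k,
          h.symm v' l]
      · linear_combination - hri
      · linear_combination hri
      · rw [← hρ2]; linear_combination (ρ⁻¹ * ρ + 1) * hri
      · ring
      · ring
      · ring
    · rw [map_add, map_smul, map_smul, hμ, hAk]; simp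
    · rw [map_sub, map_smul, map_smul, hμ, hAk]; simp
    · rw [map_smul, hAv', ← hρ2]
      match_scalars <;> field_simp <;> ring

/-- If the span of a Lorentz family is invariant under a skew operator, the operator is block
diagonal. -/
lemma exists_invariant_frame (h : IsMinkowski B) (hA : ∀ x y, B (A x) y = - B x (A y))
    {m : ℕ} {e : Fin (m + 1) → V} (he : IsLorentzFamily B e)
    {M : Matrix (Fin (m + 1)) (Fin (m + 1)) ℝ} (hM : ∀ j, A (e j) = ∑ i, M i j • e i) :
    ∃ (k s : ℕ) (b : Fin k → ℝ) (w : (Fin 2 × Fin k) ⊕ Fin s → V),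
      IsPosDecreasing b ∧ (∀ x y, B (w x) (w y) = if x = y then 1 else 0) ∧
      (∀ i x, B (e i) (w x) = 0) ∧ m + 1 + (2 * k + s) = Module.finrank ℝ V ∧
      (∀ i, A (w (Sum.inl (0, i))) = b i • w (Sum.inl (1, i))) ∧
      (∀ i, A (w (Sum.inl (1, i))) = - b i • w (Sum.inl (0, i))) ∧
      (∀ i, A (w (Sum.inr i)) = 0) ∧
      HasMatrix B A (lorentzSigns m _) (diag2 M (diagRot s b)) := by
  obtain ⟨k, s, b, w, hb, hw, hew, hd, hcard, hAw⟩ := exists_compression_frame h hA he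
  have heA : ∀ i x, B (e i) (A (w x)) = 0 := by
    intro i x
    have := hA (e i) (w x)
    rw [hM, map_sum, LinearMap.sum_apply] at this
    simp only [map_smul, LinearMap.smul_apply, hew, smul_zero, Finset.sum_const_zero] at this
    linarith
  have hAw' : ∀ x, A (w x) = ∑ y, diagRot s b y x • w y := by
    intro x
    conv_lhs => rw [hAw]
    simp [heA]
  refine ⟨k, s, b, w, hb, hw, hew, hd, fun i => ?_, fun i => ?_, fun i => ?_, ?_⟩
  · rw [hAw']
    simp [diagRot, diagL1, diag2, Fintype.sum_prod_type, Fin.sum_univ_two,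
      Matrix.blockDiagonal_apply, matL1]
  · rw [hAw']
    simp [diagRot, diagL1, diag2, Fintype.sum_prod_type, Fin.sum_univ_two,
      Matrix.blockDiagonal_apply, matL1]
  · rw [hAw']
    simp [diagRot, diagL1, diag2]
  · refine hasMatrix_fromBlocks h.symm he hw hew hcard (fun j => ?_) (fun x => ?_)
    · rw [hM]; simp
    · rw [hAw']; simp

lemma formI_of_finrank_eq_two (h : IsMinkowski B) (hA : ∀ x y, B (A x) y = - B x (A y))
    (hd : Module.finrank ℝ V = 2) : FormI 3 B A := by
  obtain ⟨t, ht⟩ := h.exists_timelike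
  obtain ⟨u, hu⟩ : ∃ u, B u u = -1 := by
    refine ⟨(Real.sqrt (-B t t))⁻¹ • t, ?_⟩
    have h1 := Real.mul_self_sqrt (show 0 ≤ -B t t by linarith)
    have h0 : Real.sqrt (-B t t) ≠ 0 := (Real.sqrt_pos.mpr (by linarith)).ne'
    simp only [map_smul, LinearMap.smul_apply, smul_eq_mul]
    field_simp
    rw [sq, h1]
    ring
  have he : IsLorentzFamily B ![u] := by
    intro i j
    fin_cases i; fin_cases j
    simp [hu]
  obtain ⟨d, w, hw, hew, hcard⟩ := exists_orthonormal_complement h he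
  obtain rfl : d = 1 := by
    have : 1 + d = 2 := by simpa [hd] using hcard
    omega
  have hself : ∀ z, B z (A z) = 0 := by
    intro z
    have := hA z z
    rw [h.symm (A z)] at this
    linarith
  have hexp := sum_of_ortho (lorentzFamily_frame_ortho h.symm he hw hew) lorentzSigns_mul_self
    (by simpa using hcard)
  simp only [Fintype.sum_sum_type, Fin.sum_univ_one, Sum.elim_inl, Sum.elim_inr, lorentzSigns,
    Matrix.cons_val_zero, if_true] at hexp
  have h01 : B u (w 0) = 0 := by simpa using hew 0 0
  have h11 : B (w 0) (w 0) = 1 := by simpa using hw 0 0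
  refine ⟨rfl, B (w 0) (A u), ?_⟩
  refine hasMatrix_of_family ![u, w 0] ?_ ?_ (by simp [hd]) ?_
  · exact isLorentzFamily_pair h.symm hu h11 h01
  · intro i
    fin_cases i <;> simp
  · intro j
    rw [Fin.sum_univ_two]
    fin_cases j
    · have := hexp (A u)
      rw [Fin.sum_univ_one] at this
      simpa [hself] using this
    · have h2 := hexp (A (w 0))
      have h3 := hA u (w 0)
      rw [h.symm (A u)] at h3
      have h4 : B u (A (w 0)) = - B (w 0) (A u) := by linarith
      rw [Fin.sum_univ_one] at h2
      simpa [hself, h4] using h2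

end SkewAdjoint

/-! ### The normal forms M₃ and M₄ -/

section SkewForms

variable {V : Type*} [AddCommGroup V] [Module ℝ V]
  {B : LinearMap.BilinForm ℝ V} {A : V →ₗ[ℝ] V}

/-- A Lorentz boost of a timelike and a spacelike unit vector. -/
lemma boosted_pair (hB : ∀ x y, B x y = B y x) {t p : V} (htt : B t t = -1) (hpp : B p p = 1)
    (htp : B t p = 0) {D : ℝ} (hD : D ≠ 0) :
    IsLorentzFamily B ![D⁻¹ • (t + p) + (D / 4) • (t - p), (D / 4) • (t - p) - D⁻¹ • (t + p)] := by
  have h1 : D⁻¹ * D = 1 := inv_mul_cancel₀ hD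
  refine isLorentzFamily_pair hB ?_ ?_ ?_ <;>
    simp only [map_add, map_sub, map_smul, LinearMap.add_apply, LinearMap.sub_apply,
      LinearMap.smul_apply, smul_eq_mul, htt, hpp, htp, hB p t]
  · linear_combination -h1
  · linear_combination h1
  · ring

/-- The normal form `matM3` for a skew operator on a three-dimensional Lorentzian subspace. -/
lemma exists_family_matM3 (hB : ∀ x y, B x y = B y x) {t p y : V}
    (he : IsLorentzFamily B ![t, p, y]) {ρ a : ℝ} (hD : ρ + a ≠ 0) (ht : A t = ρ • y)
    (hp : A p = a • y) (hy : A y = ρ • t - a • p) :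
    ∃ (σ : ℝ) (e : Fin 3 → V), IsLorentzFamily B e ∧ ∀ j, A (e j) = ∑ i, matM3 σ i j • e i := by
  have hty : B t y = 0 := he 0 2
  have hpy : B p y = 0 := he 1 2
  have hyy : B y y = 1 := he 2 2
  set D := ρ + a with hD'
  have hbp := boosted_pair hB (he 0 0) (he 1 1) (he 0 1) hD
  -- σ is forced by tr A², which is 2(ρ² − a²) on this space and −8σ for M₃(σ). The boost factor D =
  -- ρ + a makes A map D⁻¹(t + p) to y.
  refine ⟨(a ^ 2 - ρ ^ 2) / 4, ![D⁻¹ • (t + p) + (D / 4) • (t - p),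
    (D / 4) • (t - p) - D⁻¹ • (t + p), -y],
    isLorentzFamily_triple hB (hbp 0 0) (hbp 1 1) ?_ (hbp 0 1) ?_ ?_, fun j => ?_⟩
  · simpa using hyy
  · simp [hty, hpy]
  · simp [hty, hpy]
  · rw [Fin.sum_univ_three]
    have hDi : D⁻¹ * (ρ + a) = 1 := inv_mul_cancel₀ hD
    fin_cases j <;> simp [matM3, ht, hp, hy] <;> match_scalars
    · linear_combination hDi + (ρ - a) / 4 * hD'
    · linear_combination -hDi + (ρ - a) / 4 * hD'
    · linear_combination ((ρ - a) / 2) * hDi + (1 / 2) * hD'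
    · linear_combination ((ρ - a) / 2) * hDi - (1 / 2) * hD'

lemma isLorentzFamily_quadruple {x y z w : V} (hB : ∀ x y, B x y = B y x) (hxx : B x x = -1)
    (hyy : B y y = 1) (hzz : B z z = 1) (hww : B w w = 1) (hxy : B x y = 0) (hxz : B x z = 0)
    (hxw : B x w = 0) (hyz : B y z = 0) (hyw : B y w = 0) (hzw : B z w = 0) :
    IsLorentzFamily B ![x, y, z, w] := by
  intro i j
  fin_cases i <;> fin_cases j <;> simp [hxx, hyy, hzz, hww, hxy, hxz, hxw, hyz, hyw, hzw, hB y x,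
    hB z x, hB z y, hB w x, hB w y, hB w z]

/-- The normal form `matM4` for a skew operator on a four-dimensional Lorentzian subspace. -/
lemma exists_family_matM4 (hB : ∀ x y, B x y = B y x) {t x p q : V}
    (he : IsLorentzFamily B ![t, x, p, q]) {ρ a : ℝ} (hρ : 0 ≤ ρ) (ha : 0 ≤ a)
    (hD : 0 < ρ ^ 2 + a ^ 2) (ht : A t = ρ • x) (hx : A x = ρ • t)
    (hp : A p = a • q) (hq : A q = - a • p) :
    ∃ (σ τ : ℝ) (e : Fin 4 → V), 0 ≤ τ ∧ IsLorentzFamily B e ∧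
      ∀ j, A (e j) = ∑ i, matM4 σ τ i j • e i := by
  have htx : B t x = 0 := he 0 1
  have htq : B t q = 0 := he 0 3
  have hpx : B p x = 0 := by rw [hB]; exact he 1 2
  have hpq : B p q = 0 := he 2 3
  have hxx : B x x = 1 := he 1 1
  have hqq : B q q = 1 := he 3 3
  have hxq : B x q = 0 := he 1 3
  set D := Real.sqrt (ρ ^ 2 + a ^ 2) with hD'
  have hD0 : D ≠ 0 := (Real.sqrt_pos.mpr hD).ne'
  have hDD : D * D = ρ ^ 2 + a ^ 2 := Real.mul_self_sqrt hD.le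
  have hDi : D⁻¹ * D = 1 := inv_mul_cancel₀ hD0
  have hbp := boosted_pair hB (he 0 0) (he 2 2) (he 0 2) hD0
  have h00 := hbp 0 0
  have h11 := hbp 1 1
  have h01 := hbp 0 1
  set e₁ := D⁻¹ • (t + p) + (D / 4) • (t - p) with he₁
  set e₂ := (D / 4) • (t - p) - D⁻¹ • (t + p) with he₂
  set e₃ := -(D⁻¹ • (ρ • x + a • q)) with he₃
  set e₄ := D⁻¹ • (a • x - ρ • q) with he₄
  simp only [Matrix.cons_val_zero, Matrix.cons_val_one, if_true] at h00 h11 h01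
  have h33 : B e₃ e₃ = 1 := by
    simp only [he₃, map_add, map_neg, LinearMap.neg_apply, map_smul, LinearMap.add_apply,
      LinearMap.smul_apply, smul_eq_mul, hxx, hqq, hxq, hB q x]
    linear_combination (-D⁻¹ ^ 2) * hDD + (D⁻¹ * D + 1) * hDi
  have h44 : B e₄ e₄ = 1 := by
    simp only [he₄, map_sub, map_smul, LinearMap.sub_apply,
      LinearMap.smul_apply, smul_eq_mul, hxx, hqq, hxq, hB q x]
    linear_combination (-D⁻¹ ^ 2) * hDD + (D⁻¹ * D + 1) * hDi
  have h34 : B e₃ e₄ = 0 := by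
    simp only [he₃, he₄, map_add, map_sub, map_neg, LinearMap.neg_apply, map_smul,
      LinearMap.add_apply, LinearMap.smul_apply, smul_eq_mul, hxx, hqq, hxq, hB q x]
    ring
  have h13 : B e₁ e₃ = 0 := by simp [he₁, he₃, htx, htq, hpx, hpq]
  have h14 : B e₁ e₄ = 0 := by simp [he₁, he₄, htx, htq, hpx, hpq]
  have h23 : B e₂ e₃ = 0 := by simp [he₂, he₃, htx, htq, hpx, hpq]
  have h24 : B e₂ e₄ = 0 := by simp [he₂, he₄, htx, htq, hpx, hpq]
  -- As for M₃, the trace of A² gives σ; the determinant −ρ²a² = −4τ² gives τ up to sign. The vector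
  -- e₃ is −A(D⁻¹(t + p)), and D = √(ρ² + a²) makes it a unit vector.
  refine ⟨(a ^ 2 - ρ ^ 2) / 4, a * ρ / 2, ![e₁, e₂, e₃, e₄], by positivity, ?_, fun j => ?_⟩
  · exact isLorentzFamily_quadruple hB h00 h11 h33 h44 h01 h13 h14 h23 h24 h34
  · rw [Fin.sum_univ_four]
    fin_cases j <;> simp [matM4, he₁, he₂, he₃, he₄, ht, hp, hx, hq] <;> match_scalars
    all_goals field_simp
    all_goals simp only [hDD, pow_succ, pow_zero, one_mul]
    all_goals ring_nf

variable [FiniteDimensional ℝ V]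

lemma formII_of_family (h : IsMinkowski B) (hA : ∀ x y, B (A x) y = - B x (A y)) {n : ℕ}
    (hn : Even n) (hM : ∃ (σ : ℝ) (e : Fin 3 → V), IsLorentzFamily B e ∧
      ∀ j, A (e j) = ∑ i, matM3 σ i j • e i) : FormII n B A := by
  obtain ⟨σ, e, he, hM⟩ := hM
  obtain ⟨k, s, b, w, hb, -, -, -, -, -, -, hmat⟩ := exists_invariant_frame h hA he hM
  exact ⟨hn, Or.inr ⟨σ, k, s, b, hb, hmat⟩⟩

lemma formIII_of_family (h : IsMinkowski B) (hA : ∀ x y, B (A x) y = - B x (A y)) {n : ℕ}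
    (hn : 5 ≤ n) (hn' : Odd n) (hM : ∃ (σ τ : ℝ) (e : Fin 4 → V), 0 ≤ τ ∧ IsLorentzFamily B e ∧
      ∀ j, A (e j) = ∑ i, matM4 σ τ i j • e i) : FormIII n B A := by
  obtain ⟨σ, τ, e, hτ, he, hM⟩ := hM
  obtain ⟨k, s, b, w, hb, -, -, -, -, -, -, hmat⟩ := exists_invariant_frame h hA he hM
  exact ⟨hn, hn', Or.inr ⟨σ, τ, k, s, b, hτ, hb, hmat⟩⟩

/-- The normal forms of skew operators on Minkowski space. -/
theorem skewAdjoint_form (hL : IsLorentzianForm B) (hA : ∀ x y, B (A x) y = - B x (A y)) {n : ℕ}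
    (hn : 3 ≤ n) (hd : Module.finrank ℝ V + 1 = n) :
    FormI n B A ∨ FormII n B A ∨ FormIII n B A := by
  have h := hL.isMinkowski
  rcases hn.eq_or_lt with rfl | hn
  · exact Or.inl (formI_of_finrank_eq_two h hA (by omega))
  right
  rcases eq_or_ne A 0 with hA0 | hA0
  · rcases Nat.even_or_odd n with he | ho
    · exact Or.inl ⟨he, Or.inl ⟨hL, hA0⟩⟩
    · have : n ≠ 4 := by rintro rfl; exact absurd ho (by decide)
      exact Or.inr ⟨by omega, ho, Or.inl ⟨hL, hA0⟩⟩
  -- A rotation with a fixed timelike vector gives σ > 0, a boost with a fixed spacelike vector σ <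
  -- 0, a null rotation σ = 0. An odd dim V = n − 1 takes the block M₃, an even one M₄. The missing
  -- vectors come from ker A or from a rotation plane of the complement.
  rcases skewAdjoint_trichotomy h hA with ⟨t, htt, ht⟩ | ⟨t, x, ρ, hρ, he, ht, hx⟩ |
    ⟨e₁, e₂, e₃, he, h1, h2, h3⟩
  · have he : IsLorentzFamily B ![t] := by
      intro i j
      fin_cases i; fin_cases j
      simp [htt]
    obtain ⟨k, s, b, w, hb, hw, hew, hcard, hp, hq, hr, -⟩ := exists_invariant_frame h hA he
      (M := 0) (fun j => by fin_cases j; simp [ht])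
    have hew0 : ∀ x, B t (w x) = 0 := hew 0
    rcases Nat.eq_zero_or_pos k with rfl | hk
    · refine absurd (eq_of_basis_of_ortho h.symm he hw hew (T' := 0) (by simp; omega) (fun i => ?_)
        fun x => ?_) hA0
      · fin_cases i; simp [ht]
      · rcases x with ⟨_, x⟩ | x
        · exact x.elim0
        · exact hr x
    have hb0 := hb.2 ⟨0, hk⟩
    rcases Nat.even_or_odd n with hev | ho
    · left
      refine formII_of_family h hA hev (exists_family_matM3 h.symm
        (t := t) (p := w (Sum.inl (0, ⟨0, hk⟩))) (y := w (Sum.inl (1, ⟨0, hk⟩))) (ρ := 0)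
        (a := b ⟨0, hk⟩) ?_ (by simpa using hb0.ne') (by simp [ht]) (hp _) ?_)
      · refine isLorentzFamily_triple h.symm htt ?_ ?_ (hew0 _) (hew0 _) ?_ <;> simp [hw]
      · rw [hq]; simp
    · right
      -- Here 1 + 2k + s = n − 1 is even, so a kernel vector is left to complete the
      -- four-dimensional block.
      have hs : 0 < s := by
        obtain ⟨j, rfl⟩ := ho
        omega
      refine formIII_of_family h hA (by obtain ⟨j, rfl⟩ := ho; omega) ho
        (exists_family_matM4 h.symm (t := t) (x := w (Sum.inr ⟨0, hs⟩))
        (p := w (Sum.inl (0, ⟨0, hk⟩))) (q := w (Sum.inl (1, ⟨0, hk⟩))) (ρ := 0)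
        (a := b ⟨0, hk⟩) ?_ le_rfl hb0.le (by positivity) (by simp [ht]) (by simp [hr])
        (hp _) (hq _))
      intro i j
      fin_cases i <;> fin_cases j <;> simp [hw, htt, hew0, h.symm (w _) t]
  · have htt : B t t = -1 := he 0 0
    have hxx : B x x = 1 := he 1 1
    have htx : B t x = 0 := he 0 1
    obtain ⟨k, s, b, w, hb, hw, hew, hcard, hp, hq, hr, -⟩ := exists_invariant_frame h hA he
      (M := !![0, ρ; ρ, 0]) (fun j => by fin_cases j <;> simp [ht, hx])
    have hewt : ∀ x, B t (w x) = 0 := hew 0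
    have hewx : ∀ y, B x (w y) = 0 := hew 1
    rcases Nat.even_or_odd n with hev | ho
    · left
      have hs : 0 < s := by
        obtain ⟨j, rfl⟩ := hev
        omega
      refine formII_of_family h hA hev (exists_family_matM3 h.symm
        (t := t) (p := w (Sum.inr ⟨0, hs⟩)) (y := x) (ρ := ρ) (a := 0) ?_ (by simpa using hρ.ne')
        ht (by simp [hr]) (by simp [hx]))
      refine isLorentzFamily_triple h.symm htt ?_ hxx (hewt _) htx ?_
      · simp [hw]
      · rw [h.symm, hewx]
    · right
      have hn5 : 5 ≤ n := by obtain ⟨j, rfl⟩ := ho; omega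
      refine formIII_of_family h hA hn5 ho ?_
      rcases Nat.eq_zero_or_pos k with rfl | hk
      · have hs : 1 < s := by omega
        refine exists_family_matM4 h.symm (t := t) (x := x) (p := w (Sum.inr ⟨0, by omega⟩))
          (q := w (Sum.inr ⟨1, hs⟩)) (ρ := ρ) (a := 0) ?_ hρ.le le_rfl (by positivity) ht hx
          (by simp [hr]) (by simp [hr])
        intro i j
        fin_cases i <;> fin_cases j <;>
          simp [hw, htt, htx, hxx, hewt, hewx, h.symm x t, h.symm (w _) t, h.symm (w _) x]
      · refine exists_family_matM4 h.symm (t := t) (x := x) (p := w (Sum.inl (0, ⟨0, hk⟩)))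
          (q := w (Sum.inl (1, ⟨0, hk⟩))) (ρ := ρ) (a := b ⟨0, hk⟩) ?_ hρ.le (hb.2 _).le
          (by positivity) ht hx (hp _) (hq _)
        intro i j
        fin_cases i <;> fin_cases j <;>
          simp [hw, htt, htx, hxx, hewt, hewx, h.symm x t, h.symm (w _) t, h.symm (w _) x]
  · have hM : ∀ j, A (![e₁, e₂, e₃] j) = ∑ i, matM3 0 i j • ![e₁, e₂, e₃] i := by
      intro j
      rw [Fin.sum_univ_three]
      fin_cases j <;> simp [matM3, h1, h2, h3]
      module
    rcases Nat.even_or_odd n with hev | ho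
    · exact Or.inl (formII_of_family h hA hev ⟨0, _, he, hM⟩)
    · right
      obtain ⟨k, s, b, w, hb, hw, hew, hcard, hp, hq, hr, -⟩ := exists_invariant_frame h hA he hM
      have hn5 : 5 ≤ n := by obtain ⟨j, rfl⟩ := ho; omega
      have hs : 0 < s := by
        obtain ⟨j, rfl⟩ := ho
        omega
      set z := w (Sum.inr ⟨0, hs⟩) with hz
      have h1z : B e₁ z = 0 := hew 0 _
      have h2z : B e₂ z = 0 := hew 1 _
      have h3z : B e₃ z = 0 := hew 2 _
      have hzz : B z z = 1 := by simp [hz, hw]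
      have hAz : A z = 0 := hr _
      refine formIII_of_family h hA hn5 ho ⟨0, 0, ![e₁, e₂, e₃, z], le_rfl, ?_, fun j => ?_⟩
      · have h00 : B e₁ e₁ = -1 := he 0 0
        have h11 : B e₂ e₂ = 1 := he 1 1
        have h22 : B e₃ e₃ = 1 := he 2 2
        have h01 : B e₁ e₂ = 0 := he 0 1
        have h02 : B e₁ e₃ = 0 := he 0 2
        have h12 : B e₂ e₃ = 0 := he 1 2
        intro i j
        fin_cases i <;> fin_cases j <;> simp [h1z, h2z, h3z, hzz, h00, h11, h22, h01, h02, h12,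
          h.symm e₂ e₁, h.symm e₃ e₁, h.symm e₃ e₂, h.symm z e₁, h.symm z e₂, h.symm z e₃]
      · rw [Fin.sum_univ_four]
        fin_cases j <;> simp [matM4, h1, h2, h3, hAz]
        module

end SkewForms

/-! ### Reading S and A off the normal forms -/

section MatrixForms

variable {V : Type*} [AddCommGroup V] [Module ℝ V] {B : LinearMap.BilinForm ℝ V}
  {S A f : V →ₗ[ℝ] V}

lemma IsOrthonormalBasis.isLorentzianForm {ι : Type*} [Fintype ι] [DecidableEq ι] {sgn : ι → ℝ}
    {e : Module.Basis ι ℝ V} (he : IsOrthonormalBasis B sgn e) (i₀ : ι)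
    (hsgn : ∀ i, sgn i = if i = i₀ then -1 else 1) : IsLorentzianForm B := by
  classical
  let φ : ι ≃ Fin 1 ⊕ Fin (Fintype.card {i // ¬ i = i₀}) :=
    (Equiv.sumCompl (fun i => i = i₀)).symm.trans
      (Equiv.sumCongr (Equiv.ofUnique _ _) (Fintype.equivFin _))
  refine ⟨_, e.reindex φ, fun x y => ?_⟩
  rw [Module.Basis.reindex_apply, Module.Basis.reindex_apply, he]
  simp only [EmbeddingLike.apply_eq_iff_eq]
  congr 1
  rw [hsgn]
  rcases x with x | x
  · rw [if_pos]
    · rfl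
    · exact ((Equiv.ofUnique {i // i = i₀} (Fin 1)).symm x).2
  · rw [if_neg]
    · rfl
    · exact ((Fintype.equivFin {i // ¬ i = i₀}).symm x).2

lemma HasMatrix.isLorentzianForm {p : ℕ} {κ : Type*} [Fintype κ] [DecidableEq κ]
    {M : Matrix (Fin (p + 1) ⊕ κ) (Fin (p + 1) ⊕ κ) ℝ}
    (h : HasMatrix B f (lorentzSigns p κ) M) : IsLorentzianForm B := by
  obtain ⟨e, he, -⟩ := h
  refine he.isLorentzianForm (Sum.inl 0) ?_
  rintro (i | i) <;> simp [lorentzSigns]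

lemma HasMatrix.isPositiveDefiniteForm {ι : Type*} [Fintype ι] [DecidableEq ι]
    {M : Matrix ι ι ℝ} (h : HasMatrix B f (fun _ => 1) M) : IsPositiveDefiniteForm B := by
  obtain ⟨e, he, -⟩ := h
  intro x hx
  have hxx : B x x = ∑ i, e.repr x i * e.repr x i := by
    conv_lhs => rw [← e.sum_repr x]
    simp only [map_sum, LinearMap.sum_apply, map_smul, LinearMap.smul_apply, smul_eq_mul, he _ _]
    simp
  rw [hxx]
  refine lt_of_le_of_ne (Finset.sum_nonneg fun i _ => mul_self_nonneg _) fun h0 => hx ?_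
  refine e.ext_elem fun i => ?_
  have := (Finset.sum_eq_zero_iff_of_nonneg (fun i _ => mul_self_nonneg _)).mp h0.symm i
    (Finset.mem_univ i)
  simpa using this

/-- The matrices of the self-adjoint and the skew part of an operator. -/
lemma HasMatrix.exists_basis (hB : ∀ x y, B x y = B y x) (hS : ∀ x y, B (S x) y = B x (S y))
    (hA : ∀ x y, B (A x) y = - B x (A y)) {ι : Type*} [Fintype ι] [DecidableEq ι] {sgn : ι → ℝ}
    (hsgn : ∀ i, sgn i ≠ 0) {P Q : Matrix ι ι ℝ} (h : HasMatrix B (S + A) sgn (P + Q))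
    (hP : ∀ i j, sgn i * P i j = sgn j * P j i) (hQ : ∀ i j, sgn i * Q i j = -(sgn j * Q j i)) :
    ∃ e : Module.Basis ι ℝ V, LinearMap.toMatrix e e S = P ∧ LinearMap.toMatrix e e A = Q := by
  obtain ⟨e, he, hM⟩ := h
  have key : ∀ (T : V →ₗ[ℝ] V) i j, B (e i) (T (e j)) = sgn i * LinearMap.toMatrix e e T i j := by
    intro T i j
    rw [LinearMap.toMatrix_apply]
    conv_lhs => rw [← e.sum_repr (T (e j))]
    simp only [map_sum, map_smul, he _ _, smul_eq_mul, mul_ite, mul_zero, Finset.sum_ite_eq,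
      Finset.mem_univ, if_true]
    exact mul_comm _ _
  have hs : ∀ i j, sgn i * LinearMap.toMatrix e e S i j
      = sgn j * LinearMap.toMatrix e e S j i := by
    intro i j
    rw [← key, ← key, ← hS, hB]
  have ha : ∀ i j, sgn i * LinearMap.toMatrix e e A i j
      = -(sgn j * LinearMap.toMatrix e e A j i) := by
    intro i j
    rw [← key, ← key, ← hA, hB]
  rw [map_add] at hM
  have hij : ∀ i j, LinearMap.toMatrix e e S i j + LinearMap.toMatrix e e A i j = P i j + Q i j :=
    fun i j => congrFun (congrFun hM i) j
  -- Both S + A and P + Q split into parts symmetric and skew for the signs; symmetrising identifies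
  -- the first parts.
  have hSP : LinearMap.toMatrix e e S = P := by
    ext i j
    apply mul_left_cancel₀ (hsgn i)
    linear_combination (1 / 2) * (sgn i * hij i j + sgn j * hij j i + hs i j - ha i j
      - hP i j + hQ i j)
  refine ⟨e, hSP, ?_⟩
  rw [hSP] at hM
  exact add_left_cancel hM

lemma HasMatrix.eq_zero_of_skew (hB : ∀ x y, B x y = B y x) (hS : ∀ x y, B (S x) y = B x (S y))
    (hA : ∀ x y, B (A x) y = - B x (A y)) {ι : Type*} [Fintype ι] [DecidableEq ι] {sgn : ι → ℝ}
    (hsgn : ∀ i, sgn i ≠ 0) {Q : Matrix ι ι ℝ} (h : HasMatrix B (S + A) sgn Q)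
    (hQ : ∀ i j, sgn i * Q i j = -(sgn j * Q j i)) : S = 0 := by
  rw [← zero_add Q] at h
  obtain ⟨e, hS', -⟩ := h.exists_basis hB hS hA hsgn (by simp) hQ
  exact (LinearMap.toMatrix e e).injective (by rw [hS', map_zero])

lemma comm_of_toMatrix {ι : Type*} [Fintype ι] [DecidableEq ι] {P Q : Matrix ι ι ℝ}
    {e : Module.Basis ι ℝ V} (hP : LinearMap.toMatrix e e S = P) (hQ : LinearMap.toMatrix e e A = Q)
    (hPQ : P * Q = Q * P) : S ∘ₗ A = A ∘ₗ S := by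
  apply (LinearMap.toMatrix e e).injective
  rw [LinearMap.toMatrix_comp e e e, LinearMap.toMatrix_comp e e e, hP, hQ, hPQ]

lemma trace_sq_of_toMatrix {ι : Type*} [Fintype ι] [DecidableEq ι] {P : Matrix ι ι ℝ}
    {e : Module.Basis ι ℝ V} (hP : LinearMap.toMatrix e e S = P) :
    LinearMap.trace ℝ V (S ∘ₗ S) = (P * P).trace := by
  rw [LinearMap.trace_eq_matrix_trace ℝ e, LinearMap.toMatrix_comp e e e, hP]

lemma sq_eq_of_toMatrix {ι : Type*} [Fintype ι] [DecidableEq ι] {P : Matrix ι ι ℝ}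
    {e : Module.Basis ι ℝ V} (hP : LinearMap.toMatrix e e S = P) :
    S ∘ₗ S = 0 ↔ P * P = 0 := by
  rw [← (LinearMap.toMatrix e e).injective.eq_iff, LinearMap.toMatrix_comp e e e, hP, map_zero]

/-! ### Symmetry properties of the model matrices -/

lemma diagL1_symm {k s : ℕ} (a : Fin k → ℝ) (c : Fin s → ℝ) (x y) :
    diagL1 a 0 c x y = diagL1 a 0 c y x := by
  rcases x with ⟨i, x⟩ | x <;> rcases y with ⟨j, y⟩ | y
  · simp only [diagL1, diag2, Matrix.fromBlocks_apply₁₁, Matrix.blockDiagonal_apply]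
    rcases eq_or_ne x y with rfl | hne
    · fin_cases i <;> fin_cases j <;> simp [matL1]
    · simp [hne, hne.symm]
  · rfl
  · rfl
  · simp only [diagL1, diag2, Matrix.fromBlocks_apply₂₂, Matrix.diagonal_apply]
    rcases eq_or_ne x y with rfl | hne
    · rfl
    · simp [hne, hne.symm]

lemma diagRot_skew {k : ℕ} (s : ℕ) (b : Fin k → ℝ) (x y) :
    diagRot s b x y = -diagRot s b y x := by
  rcases x with ⟨i, x⟩ | x <;> rcases y with ⟨j, y⟩ | y
  · simp only [diagRot, diagL1, diag2, Matrix.fromBlocks_apply₁₁, Matrix.blockDiagonal_apply]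
    rcases eq_or_ne x y with rfl | hne
    · fin_cases i <;> fin_cases j <;> simp [matL1]
    · simp [hne, hne.symm]
  · simp [diagRot, diagL1, diag2]
  · simp [diagRot, diagL1, diag2]
  · simp [diagRot, diagL1, diag2]

lemma diagL1_eq_add {k s : ℕ} (a b : Fin k → ℝ) (c : Fin s → ℝ) :
    diagL1 a b c = diagL1 a 0 c + diagRot s b := by
  ext x y
  rcases x with ⟨i, x⟩ | x <;> rcases y with ⟨j, y⟩ | y
  · simp only [diagRot, diagL1, diag2, Matrix.add_apply, Matrix.fromBlocks_apply₁₁,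
      Matrix.blockDiagonal_apply]
    rcases eq_or_ne x y with rfl | hne
    · fin_cases i <;> fin_cases j <;> simp [matL1]
    · simp [hne]
  · simp [diagRot, diagL1, diag2]
  · simp [diagRot, diagL1, diag2]
  · simp [diagRot, diagL1, diag2]

lemma diagL1_mul_diagRot {k s : ℕ} (a b : Fin k → ℝ) (c : Fin s → ℝ) :
    diagL1 a 0 c * diagRot s b = diagRot s b * diagL1 a 0 c := by
  simp only [diagRot, diagL1, diag2, Matrix.fromBlocks_multiply, ← Matrix.blockDiagonal_mul]
  congr 1
  · simp only [Matrix.mul_zero, add_zero]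
    congr 1
    funext i
    ext x y
    fin_cases x <;> fin_cases y <;> simp [matL1, mul_comm]
  · simp
  · simp
  · simp

lemma trace_fromBlocks {ι κ : Type*} [Fintype ι] [Fintype κ] (M₁₁ : Matrix ι ι ℝ)
    (M₁₂ : Matrix ι κ ℝ) (M₂₁ : Matrix κ ι ℝ) (M₂₂ : Matrix κ κ ℝ) :
    (Matrix.fromBlocks M₁₁ M₁₂ M₂₁ M₂₂).trace = M₁₁.trace + M₂₂.trace := by
  simp [Matrix.trace, Fintype.sum_sum_type]

lemma trace_diagL1_sq {k s : ℕ} (a : Fin k → ℝ) (c : Fin s → ℝ) :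
    (diagL1 a 0 c * diagL1 a 0 c).trace = 2 * ∑ i, a i ^ 2 + ∑ j, c j ^ 2 := by
  simp only [diagL1, diag2, Matrix.fromBlocks_multiply, ← Matrix.blockDiagonal_mul,
    trace_fromBlocks, Matrix.mul_zero, Matrix.zero_mul, add_zero, zero_add,
    Matrix.trace_blockDiagonal, Matrix.diagonal_mul_diagonal, Matrix.trace_diagonal,
    Finset.mul_sum]
  congr 1
  · refine Finset.sum_congr rfl fun i _ => ?_
    simp [Matrix.trace_fin_two, matL1]
    ring
  · exact Finset.sum_congr rfl fun i _ => (sq _).symm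

/-! ### The operators described by the normal forms -/

section Operators

variable (hB : ∀ x y, B x y = B y x) (hS : ∀ x y, B (S x) y = B x (S y))
  (hA : ∀ x y, B (A x) y = - B x (A y))

include hB hS hA

lemma FormRiem.eq_zero (h : FormRiem B (S + A)) : S = 0 := by
  obtain ⟨k, s, a, -, h⟩ := h
  refine h.eq_zero_of_skew hB hS hA (by simp) fun i j => ?_
  rw [diagRot_skew]
  ring

lemma FormI.eq_zero {n : ℕ} (h : FormI n B (S + A)) : IsLorentzianForm B ∧ S = 0 := by
  obtain ⟨-, ρ, h⟩ := h
  refine ⟨?_, ?_⟩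
  · obtain ⟨e, he, -⟩ := h
    exact he.isLorentzianForm 0 fun _ => rfl
  · refine h.eq_zero_of_skew hB hS hA (fun i => ?_) fun i j => ?_
    · split_ifs <;> norm_num
    · fin_cases i <;> fin_cases j <;> simp

lemma HasMatrix.eq_zero_of_diag2 {m k s : ℕ} {M : Matrix (Fin (m + 1)) (Fin (m + 1)) ℝ}
    {a : Fin k → ℝ}
    (h : HasMatrix B (S + A) (lorentzSigns m ((Fin 2 × Fin k) ⊕ Fin s)) (diag2 M (diagRot s a)))
    (hM : ∀ i j, (if i = 0 then -1 else 1) * M i j = -((if j = 0 then -1 else 1) * M j i)) :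
    S = 0 := by
  refine h.eq_zero_of_skew hB hS hA lorentzSigns_ne_zero ?_
  rintro (i | i) (j | j)
  · exact hM i j
  · simp [diag2]
  · simp [diag2]
  · simpa [diag2, lorentzSigns] using diagRot_skew s a i j

omit hB in
lemma IsLorentzianForm.eq_zero_of_add_eq_zero (h : IsLorentzianForm B) (h0 : S + A = 0) :
    S = 0 := by
  refine LinearMap.ext fun x => h.isMinkowski.eq_zero_of_forall fun y => ?_
  have h1 : ∀ z, A z = - S z := fun z => by
    have := LinearMap.congr_fun h0 z
    exact eq_neg_of_add_eq_zero_right this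
  have h2 := hA x y
  rw [h1, h1, map_neg, LinearMap.neg_apply, map_neg, ← hS] at h2
  linarith

lemma FormII.eq_zero {n : ℕ} (h : FormII n B (S + A)) : IsLorentzianForm B ∧ S = 0 := by
  obtain ⟨-, ⟨hL, h0⟩ | ⟨σ, k, s, a, -, h⟩⟩ := h
  · exact ⟨hL, hL.eq_zero_of_add_eq_zero hS hA h0⟩
  · refine ⟨h.isLorentzianForm, h.eq_zero_of_diag2 hB hS hA fun i j => ?_⟩
    fin_cases i <;> fin_cases j <;> simp [matM3] <;> ring

lemma FormIII.eq_zero {n : ℕ} (h : FormIII n B (S + A)) : IsLorentzianForm B ∧ S = 0 := by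
  obtain ⟨-, -, ⟨hL, h0⟩ | ⟨σ, τ, k, s, a, -, -, h⟩⟩ := h
  · exact ⟨hL, hL.eq_zero_of_add_eq_zero hS hA h0⟩
  · refine ⟨h.isLorentzianForm, h.eq_zero_of_diag2 hB hS hA fun i j => ?_⟩
    fin_cases i <;> fin_cases j <;> simp [matM4] <;> ring

/-- In this signature the first block is wholly self-adjoint, while the other L₁ blocks split into
scalars and rotations. The formula for β is tr S² = 0. On the first plane S² is the square of the
complex number α + iβ ≠ 0. -/
lemma FormIV.parts (h : FormIV B (S + A)) : IsLorentzianForm B ∧ S ∘ₗ A = A ∘ₗ S ∧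
    LinearMap.trace ℝ V (S ∘ₗ S) = 0 ∧ S ∘ₗ S ≠ 0 := by
  obtain ⟨α, β, k, s, a, b, c, -, -, hβ, hβ0, h⟩ := h
  refine ⟨h.isLorentzianForm, ?_⟩
  have hM : diag2 (matL1 α β) (diagL1 a b c)
      = diag2 (matL1 α β) (diagL1 a 0 c) + diag2 0 (diagRot s b) := by
    rw [diagL1_eq_add a b c, diag2, diag2, diag2, Matrix.fromBlocks_add]
    simp
  rw [hM] at h
  obtain ⟨e, hP, hQ⟩ := h.exists_basis hB hS hA lorentzSigns_ne_zero (by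
    rintro (i | i) (j | j)
    · fin_cases i <;> fin_cases j <;> simp [diag2, lorentzSigns, matL1]
    · simp [diag2]
    · simp [diag2]
    · simpa [diag2, lorentzSigns] using diagL1_symm a c i j) (by
    rintro (i | i) (j | j)
    · simp [diag2]
    · simp [diag2]
    · simp [diag2]
    · simpa [diag2, lorentzSigns] using diagRot_skew s b i j)
  have hββ : β ^ 2 = α ^ 2 + (∑ i, a i ^ 2) + ∑ j, c j ^ 2 / 2 := by
    rw [hβ, Real.sq_sqrt]
    positivity
  refine ⟨comm_of_toMatrix hP hQ ?_, ?_, ?_⟩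
  · simp only [diag2, Matrix.fromBlocks_multiply]
    simp [diagL1_mul_diagRot]
  · rw [trace_sq_of_toMatrix hP]
    simp only [diag2, Matrix.fromBlocks_multiply, trace_fromBlocks, Matrix.mul_zero,
      Matrix.zero_mul, add_zero, zero_add, trace_diagL1_sq, Matrix.trace_fin_two]
    rw [← Finset.sum_div] at hββ
    simp [matL1]
    linarith
  · rw [Ne, sq_eq_of_toMatrix hP]
    intro h0
    have h00 := congrFun (congrFun h0 (Sum.inl 0)) (Sum.inl 0)
    have h01 := congrFun (congrFun h0 (Sum.inl 0)) (Sum.inl 1)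
    simp [diag2, Matrix.fromBlocks_multiply, matL1, Matrix.mul_apply, Fin.sum_univ_two] at h00 h01
    have : α * β = 0 := by linarith
    have hα := (mul_eq_zero.mp this).resolve_right hβ0.ne'
    rw [hα] at h00
    nlinarith

/-- S is the 2×2 corner, nilpotent of rank at most one, with image in the null line of e₁ − e₂,
which the skew remainder kills. The last clause feeds `isFlat_of_comp_eq_zero`. -/
lemma FormV.parts (h : FormV B (S + A)) : IsLorentzianForm B ∧ S ∘ₗ A = A ∘ₗ S ∧
    S ∘ₗ S = 0 ∧ ∃ (φ : V → ℝ) (u : V), ∀ x, S x = φ x • u := by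
  obtain ⟨ε, k, s, v, a, -, -, h⟩ := h
  refine ⟨h.isLorentzianForm, ?_⟩
  have hM : Matrix.fromBlocks !![ε / 2, ε / 2; -(ε / 2), -(ε / 2)] (Matrix.of ![v, -v])
        (Matrix.of ![v, v]).transpose (diagRot s a)
      = Matrix.fromBlocks !![ε / 2, ε / 2; -(ε / 2), -(ε / 2)] 0 0 0 +
        Matrix.fromBlocks 0 (Matrix.of ![v, -v]) (Matrix.of ![v, v]).transpose (diagRot s a) := by
    rw [Matrix.fromBlocks_add]
    simp
  rw [hM] at h
  obtain ⟨e, hP, hQ⟩ := h.exists_basis hB hS hA lorentzSigns_ne_zero (by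
    rintro (i | i) (j | j)
    · fin_cases i <;> fin_cases j <;> simp [lorentzSigns]
    · simp
    · simp
    · simp) (by
    rintro (i | i) (j | j)
    · simp
    · fin_cases i <;> simp [lorentzSigns]
    · fin_cases j <;> simp [lorentzSigns]
    · simpa [lorentzSigns] using diagRot_skew s a i j)
  refine ⟨comm_of_toMatrix hP hQ ?_, (sq_eq_of_toMatrix hP).mpr ?_, ?_⟩
  · rw [Matrix.fromBlocks_multiply, Matrix.fromBlocks_multiply]
    congr 1
    · simp
    · ext i x
      fin_cases i <;> simp [Matrix.mul_apply, Fin.sum_univ_two]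
    · ext x i
      fin_cases i <;> simp [Matrix.mul_apply, Fin.sum_univ_two]
    · simp
  · have hT : !![ε / 2, ε / 2; -(ε / 2), -(ε / 2)] * !![ε / 2, ε / 2; -(ε / 2), -(ε / 2)]
        = (0 : Matrix (Fin 2) (Fin 2) ℝ) := by
      ext i j
      fin_cases i <;> fin_cases j <;> simp [Matrix.mul_apply, Fin.sum_univ_two]
    rw [Matrix.fromBlocks_multiply, hT]
    simp
  · refine ⟨fun x => (ε / 2) * (e.repr x (Sum.inl 0) + e.repr x (Sum.inl 1)),
      e (Sum.inl 0) - e (Sum.inl 1), fun x => ?_⟩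
    have hSe : ∀ j, S (e j) = ∑ i, LinearMap.toMatrix e e S i j • e i := fun j => by
      simp only [LinearMap.toMatrix_apply]
      exact (e.sum_repr _).symm
    rw [hP] at hSe
    conv_lhs => rw [← e.sum_repr x]
    have h2 : ∀ F : Fin (1 + 1) → V, ∑ i, F i = F 0 + F 1 := fun F => Fin.sum_univ_two F
    simp only [map_sum, map_smul, hSe]
    simp only [Fintype.sum_sum_type, h2,
      Matrix.fromBlocks_apply₁₁, Matrix.fromBlocks_apply₂₁, Matrix.fromBlocks_apply₁₂,
      Matrix.fromBlocks_apply₂₂, Matrix.zero_apply, zero_smul, smul_zero, Finset.sum_const_zero,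
      add_zero, Matrix.of_apply, Matrix.cons_val_zero, Matrix.cons_val_one]
    module

/-- S is the 3×3 corner. Its square has trace zero, but its first entry is −1/2, so S² ≠ 0 and
flatness fails. -/
lemma FormVI.parts (h : FormVI B (S + A)) : IsLorentzianForm B ∧ S ∘ₗ A = A ∘ₗ S ∧
    LinearMap.trace ℝ V (S ∘ₗ S) = 0 ∧ S ∘ₗ S ≠ 0 := by
  obtain ⟨k, s, v, a, -, h⟩ := h
  refine ⟨h.isLorentzianForm, ?_⟩
  have hr : 1 / Real.sqrt 2 ≠ 0 := by positivity
  set r := 1 / Real.sqrt 2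
  set P₀ : Matrix (Fin 3) (Fin 3) ℝ := !![0, -r, 0; r, 0, r; 0, r, 0] with hP₀
  have hM : Matrix.fromBlocks P₀ (Matrix.of ![v, 0, -v])
        (Matrix.of ![v, 0, v]).transpose (diagRot s a)
      = Matrix.fromBlocks P₀ 0 0 0 + Matrix.fromBlocks 0 (Matrix.of ![v, 0, -v])
        (Matrix.of ![v, 0, v]).transpose (diagRot s a) := by
    rw [Matrix.fromBlocks_add]
    simp
  rw [hM] at h
  obtain ⟨e, hP, hQ⟩ := h.exists_basis hB hS hA lorentzSigns_ne_zero (by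
    rintro (i | i) (j | j)
    · fin_cases i <;> fin_cases j <;> simp [lorentzSigns, hP₀]
    · simp
    · simp
    · simp) (by
    rintro (i | i) (j | j)
    · simp
    · fin_cases i <;> simp [lorentzSigns]
    · fin_cases j <;> simp [lorentzSigns]
    · simpa [lorentzSigns] using diagRot_skew s a i j)
  refine ⟨comm_of_toMatrix hP hQ ?_, ?_, ?_⟩
  · rw [Matrix.fromBlocks_multiply, Matrix.fromBlocks_multiply]
    congr 1
    · simp
    · ext i x
      fin_cases i <;> simp [Matrix.mul_apply, Fin.sum_univ_three, hP₀]
    · ext x i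
      fin_cases i <;> simp [Matrix.mul_apply, Fin.sum_univ_three, hP₀]
    · simp
  · rw [trace_sq_of_toMatrix hP]
    simp [Matrix.fromBlocks_multiply, trace_fromBlocks, Matrix.trace_fin_three, hP₀,
      Matrix.mul_apply, Fin.sum_univ_three]
  · rw [Ne, sq_eq_of_toMatrix hP]
    intro h0
    have h00 := congrFun (congrFun h0 (Sum.inl 0)) (Sum.inl 0)
    simp [Matrix.fromBlocks_multiply, hP₀, Matrix.mul_apply, Fin.sum_univ_three] at h00
    exact hr h00

end Operators

end MatrixForms

/-! ### Assembly of the theorem -/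

section Main

/-- The normal form of a normal operator on a Euclidean space whose self-adjoint part has
trace-free square. -/
lemma formRiem_of_posDef {V : Type*} [AddCommGroup V] [Module ℝ V] [FiniteDimensional ℝ V]
    {B : LinearMap.BilinForm ℝ V} {S A : V →ₗ[ℝ] V} (hB : ∀ x y, B x y = B y x)
    (hpos : IsPositiveDefiniteForm B) (hS : ∀ x y, B (S x) y = B x (S y))
    (hA : ∀ x y, B (A x) y = - B x (A y)) (hSA : S ∘ₗ A = A ∘ₗ S)
    (htr : LinearMap.trace ℝ V (S ∘ₗ S) = 0) : FormRiem B (S + A) := by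
  obtain ⟨k, s, a, b, c, p, q, r, hF, hb, -, -, -, -, hks⟩ :=
    exists_isNormalFrame_sorted hB hS hA (LinearMap.congr_fun hSA) ⊤ (fun x _ => hpos x)
      (fun _ _ => trivial) (fun _ _ => trivial)
  rw [finrank_top] at hks
  have hmat : HasMatrix B (S + A) (fun _ => 1) (diagL1 a b c) :=
    hasMatrix_of_family (frameVec p q r) (hF.ortho hB) (by simp) (by simp; omega)
      hF.apply_frameVec
  have hmat' := hmat
  rw [diagL1_eq_add] at hmat'
  obtain ⟨e, hP, -⟩ := hmat'.exists_basis hB hS hA (by simp)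
    (fun i j => by rw [diagL1_symm]) (fun i j => by rw [diagRot_skew]; ring)
  -- Now 2Σaᵢ² + Σcⱼ² = 0, so only the rotations remain.
  rw [trace_sq_of_toMatrix hP, trace_diagL1_sq] at htr
  have h1 : 0 ≤ ∑ i, a i ^ 2 := Finset.sum_nonneg fun i _ => sq_nonneg _
  have h2 : 0 ≤ ∑ i, c i ^ 2 := Finset.sum_nonneg fun i _ => sq_nonneg _
  have ha : a = 0 := by
    funext i
    have := (Finset.sum_eq_zero_iff_of_nonneg fun i _ => sq_nonneg (a i)).mp
      (show ∑ i, a i ^ 2 = 0 by linarith) i (Finset.mem_univ i)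
    simpa using this
  have hc : c = 0 := by
    funext i
    have := (Finset.sum_eq_zero_iff_of_nonneg fun i _ => sq_nonneg (c i)).mp
      (show ∑ i, c i ^ 2 = 0 by linarith) i (Finset.mem_univ i)
    simpa using this
  rw [ha, hc] at hmat
  exact ⟨k, s, b, hb, hmat⟩

/-- The symmetric part is self-adjoint, its complement is skew, and normality means that they
commute. -/
lemma symmetricPart_properties {V : Type*} [AddCommGroup V] [Module ℝ V] [FiniteDimensional ℝ V]
    {B : LinearMap.BilinForm ℝ V} (hB : ∀ x y, B x y = B y x) (hBnd : B.Nondegenerate)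
    (f : V →ₗ[ℝ] V) :
    (∀ x y, B (symmetricPart B hBnd f x) y = B x (symmetricPart B hBnd f y)) ∧
    (∀ x y, B ((f - symmetricPart B hBnd f) x) y = - B x ((f - symmetricPart B hBnd f) y)) ∧
    (IsNormalFor B hBnd f ↔ symmetricPart B hBnd f ∘ₗ (f - symmetricPart B hBnd f)
      = (f - symmetricPart B hBnd f) ∘ₗ symmetricPart B hBnd f) := by
  have hadj : ∀ x y, B (adjointOf B hBnd f x) y = B x (f y) :=
    LinearMap.BilinForm.isAdjointPairLeftAdjointOfNondegenerate B hBnd f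
  have hadj' : ∀ x y, B (f x) y = B x (adjointOf B hBnd f y) := fun x y => by
    rw [hB, ← hadj, hB]
  refine ⟨fun x y => ?_, fun x y => ?_, ?_⟩
  · simp only [symmetricPart, LinearMap.smul_apply, LinearMap.add_apply, map_smul, map_add, hadj,
      hadj']
    rw [add_comm]
  · simp only [symmetricPart, LinearMap.smul_apply, LinearMap.add_apply, LinearMap.sub_apply,
      map_smul, map_add, map_sub, hadj, hadj', smul_eq_mul]
    ring
  · rw [IsNormalFor]
    set fs := adjointOf B hBnd f with hfs
    simp only [symmetricPart, ← hfs]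
    constructor
    · intro h
      refine LinearMap.ext fun x => ?_
      have hx : f (fs x) = fs (f x) := LinearMap.congr_fun h x
      simp only [LinearMap.comp_apply, LinearMap.smul_apply, LinearMap.add_apply,
        LinearMap.sub_apply, map_smul, map_add, map_sub, hx]
      module
    · intro h
      refine LinearMap.ext fun x => ?_
      have hx := LinearMap.congr_fun h x
      simp only [LinearMap.comp_apply, LinearMap.smul_apply, LinearMap.add_apply,
        LinearMap.sub_apply, map_smul, map_add, map_sub] at hx ⊢
      -- The factor is that of [f, f*] = −2[S, A].
      linear_combination (norm := module) (-2 : ℝ) • hx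

end Main

theorem mainTheorem6 {𝔤 : Type*} [LieRing 𝔤] [LieAlgebra ℝ 𝔤] [FiniteDimensional ℝ 𝔤]
    (n : ℕ) (hn : 3 ≤ n) (hdim : Module.finrank ℝ 𝔤 = n)
    (g : PseudoRiemMetric 𝔤) (hg : IsLorentzianForm g.form)
    (N : LieIdeal ℝ 𝔤) (hNab : IsLieAbelian N) (hNcodim : Module.finrank ℝ N + 1 = n)
    (B : LinearMap.BilinForm ℝ N) (hB : ∀ Y Z : N, B Y Z = g.form (Y : 𝔤) (Z : 𝔤))
    (hBnd : B.Nondegenerate)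
    (X : 𝔤) (hXN : ∀ Y ∈ N, g.form X Y = 0) (hX : g.form X X = 1 ∨ g.form X X = -1)
    (f : N →ₗ[ℝ] N) (hf : ∀ Y : N, ((f Y : N) : 𝔤) = ⁅X, (Y : 𝔤)⁆) :
    (IsGeneralisedEinstein g 0 0 ↔
      IsNormalFor B hBnd f ∧
        LinearMap.trace ℝ N (symmetricPart B hBnd f ∘ₗ symmetricPart B hBnd f) = 0) ∧
    (IsGeneralisedEinstein g 0 0 ∧ IsPositiveDefiniteForm B ↔ FormRiem B f) ∧
    (IsGeneralisedEinstein g 0 0 ∧ IsPositiveDefiniteForm B → g.IsFlat) ∧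
    (IsGeneralisedEinstein g 0 0 ∧ IsLorentzianForm B ↔
      FormI n B f ∨ FormII n B f ∨ FormIII n B f ∨ FormIV B f ∨ FormV B f ∨ FormVI B f) ∧
    (IsGeneralisedEinstein g 0 0 ∧ IsLorentzianForm B →
      (g.IsFlat ↔ FormI n B f ∨ FormII n B f ∨ FormIII n B f ∨ FormV B f)) ∧
    (FormIV B f ∨ FormVI B f → ¬ g.IsFlat) := by
  have hsymm : ∀ Y Z : N, B Y Z = B Z Y := fun Y Z => by rw [hB, hB, g.symm]
  obtain ⟨hS, hA, hnormal⟩ := symmetricPart_properties hsymm hBnd f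
  rw [hnormal]
  obtain ⟨S, hS'⟩ : ∃ S, S = symmetricPart B hBnd f := ⟨_, rfl⟩
  rw [← hS'] at hS hA ⊢
  obtain ⟨A, hA'⟩ : ∃ A, A = f - S := ⟨_, rfl⟩
  rw [← hA'] at hA ⊢
  obtain rfl : f = S + A := by rw [hA']; abel
  clear hA' hS' hnormal
  have h : IsAlmostAbelian g N B X (g.form X X) S A :=
    { lie_eq_zero := fun Y Z => by
        have := hNab.trivial Y Z
        exact congrArg Subtype.val this
      finrank := by rw [hNcodim, hdim]
      form_eq := hB
      form_normal := hXN
      form_self := rfl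
      sq_eq_one := by rcases hX with h1 | h1 <;> rw [h1] <;> norm_num
      lie_normal := fun Y => (hf Y).symm
      selfAdjoint := hS
      skewAdjoint := hA }
  have hE := h.isGeneralisedEinstein_iff hBnd (by omega)
  have hE0 : S = 0 → IsGeneralisedEinstein g 0 0 := fun h0 => hE.mpr (by simp [h0])
  have hflat0 : S = 0 → g.IsFlat := fun h0 =>
    h.isFlat_of_comp_eq_zero (by simp [h0]) (by simp [h0]) (by simp [h0])
  have hflatV : FormV B (S + A) → g.IsFlat := fun hV => by
    obtain ⟨-, hc, hsq, φ, u, hu⟩ := hV.parts hsymm hS hA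
    refine h.isFlat_of_comp_eq_zero hc hsq fun Y Z W => ?_
    simp only [hu, map_smul, LinearMap.smul_apply, smul_smul, smul_eq_mul]
    congr 1
    ring
  -- Flatness gives S² + SA = AS; as S and A commute in these forms, S² would vanish.
  have hnot : FormIV B (S + A) ∨ FormVI B (S + A) → ¬ g.IsFlat := fun hF hflat => by
    obtain ⟨-, hc, -, hne⟩ := hF.elim (fun h' => h'.parts hsymm hS hA)
      (fun h' => h'.parts hsymm hS hA)
    have := h.comp_of_isFlat hflat
    rw [hc] at this
    exact hne (add_eq_right.mp this)
  have hforms : IsGeneralisedEinstein g 0 0 ∧ IsLorentzianForm B →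
      FormI n B (S + A) ∨ FormII n B (S + A) ∨ FormIII n B (S + A) ∨ FormIV B (S + A) ∨
        FormV B (S + A) ∨ FormVI B (S + A) := fun ⟨hein, hL⟩ => by
    obtain ⟨hc, htr⟩ := hE.mp hein
    rcases selfAdjoint_eq_zero_or_form hL.isMinkowski hS hA (LinearMap.congr_fun hc) htr with
      h0 | h4 | h5 | h6
    · rw [h0, zero_add]
      rcases skewAdjoint_form hL hA hn hNcodim with h1 | h2 | h3
      · exact Or.inl h1
      · exact Or.inr (Or.inl h2)
      · exact Or.inr (Or.inr (Or.inl h3))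
    · exact Or.inr (Or.inr (Or.inr (Or.inl h4)))
    · exact Or.inr (Or.inr (Or.inr (Or.inr (Or.inl h5))))
    · exact Or.inr (Or.inr (Or.inr (Or.inr (Or.inr h6))))
  refine ⟨hE, ⟨fun ⟨hein, hpos⟩ => ?_, fun hR => ?_⟩, fun ⟨hein, hpos⟩ => ?_, ⟨hforms, ?_⟩,
    fun hein => ⟨fun hflat => ?_, ?_⟩, hnot⟩
  · obtain ⟨hc, htr⟩ := hE.mp hein
    exact formRiem_of_posDef hsymm hpos hS hA hc htr
  · refine ⟨hE0 (hR.eq_zero hsymm hS hA), ?_⟩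
    obtain ⟨k, s, a, -, hmat⟩ := hR
    exact hmat.isPositiveDefiniteForm
  · obtain ⟨hc, htr⟩ := hE.mp hein
    exact hflat0 ((formRiem_of_posDef hsymm hpos hS hA hc htr).eq_zero hsymm hS hA)
  · rintro (h1 | h2 | h3 | h4 | h5 | h6)
    · obtain ⟨hL, h0⟩ := h1.eq_zero hsymm hS hA
      exact ⟨hE0 h0, hL⟩
    · obtain ⟨hL, h0⟩ := h2.eq_zero hsymm hS hA
      exact ⟨hE0 h0, hL⟩
    · obtain ⟨hL, h0⟩ := h3.eq_zero hsymm hS hA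
      exact ⟨hE0 h0, hL⟩
    · obtain ⟨hL, hc, htr, -⟩ := h4.parts hsymm hS hA
      exact ⟨hE.mpr ⟨hc, htr⟩, hL⟩
    · obtain ⟨hL, hc, hsq, -⟩ := h5.parts hsymm hS hA
      exact ⟨hE.mpr ⟨hc, by rw [hsq, map_zero]⟩, hL⟩
    · obtain ⟨hL, hc, htr, -⟩ := h6.parts hsymm hS hA
      exact ⟨hE.mpr ⟨hc, htr⟩, hL⟩
  · rcases hforms hein with h1 | h2 | h3 | h4 | h5 | h6
    · exact Or.inl h1
    · exact Or.inr (Or.inl h2)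
    · exact Or.inr (Or.inr (Or.inl h3))
    · exact absurd hflat (hnot (Or.inl h4))
    · exact Or.inr (Or.inr (Or.inr h5))
    · exact absurd hflat (hnot (Or.inr h6))
  · rintro (h1 | h2 | h3 | h5)
    · exact hflat0 (h1.eq_zero hsymm hS hA).2
    · exact hflat0 (h2.eq_zero hsymm hS hA).2
    · exact hflat0 (h3.eq_zero hsymm hS hA).2
    · exact hflatV h5
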